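/- **Setting.** Let $\mathbb K=\mathbb R$ or $\mathbb C$, let $g$ be a finite-dimensional simple Lie algebra over $\mathbb K$ with Cartan–Killing form $(\cdot,\cdot)$, let $k\in\mathbb K$, $k\neq0$, and let $\{t_0,t_+,t_-\}$ be an $sl_2$ subalgebra of $g$: $[t_0,t_\pm]=\pm t_\pm$, $[t_+,t_-]=2t_0$, $t_0\ne 0$. Let $\{t^{(\mu)}_{j,m}\}$ be a basis of $g$ compatible with the decomposition of $g$ into $sl_2$ multiplets, i.e. $[t_0,t^{(\mu)}_{j,m}]=m\,t^{(\mu)}_{j,m}$, $[t_\pm,t^{(\mu)}_{j,m}]\in\mathbb K\,t^{(\mu)}_{j,m\pm1}$ (zero for $m=\pm j$), with $t^{(1)}_{1,\pm1}=t_\pm$, $t^{(1)}_{1,0}=t_0$; $m$ is called the grade. Write a loop $y\in Map(S^1,g)$ (smooth) as $y=\sum y^a t_a$, and let $J^a(z)(y)=y^a(z)$ be the currents, with the affine Kirillov bracket $$\{J^a(z),J^b(w)\}=f^{ab}{}_c\,J^c(w)\,\delta(z-w)+k\,g^{ab}\,\delta'(z-w)$$ ($g_{ab}=(t_a,t_b)$,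 $g^{ab}$ its inverse, $[t_a,t_b]=f_{ab}{}^c\,t_c$, indices raised and lowered with $g_{ab}$; derivatives of $\delta(z-w)$ are with respect to $z$). The improved affine Sugawara tensor is $$T^I(z)=\tfrac1{2k}\,g_{ab}J^a(z)J^b(z)+\lambda_a\,\partial J^a(z),\qquad \lambda^at_a=t_0 .$$ Let $\bar g_c$ be the set of loops of the form $t_++\sum_{j,\mu}\sum_{m\le0}y^{j,m}_{(\mu)}t^{(\mu)}_{j,m}$, i.e. the zero set of the constraints $\phi^{j,m}_{(\mu)}=J^{j,m}_{(\mu)}-\delta^j_1\delta^m_1\delta^1_\mu$ with $m>0$. Let $\bar H=\{\exp h: h\in Map(S^1,\bigoplus_{n\ge1}g^{(-n)})\}$, where $g^{(l)}$ is the span of the $t^{(\mu)}_{j,l}$, be the gauge group, acting by $y\mapsto\gamma y\gamma^{-1}+k\,\partial\gamma\,\gamma^{-1}$. Let $\bar g_{fix}\subset\bar g_c$ be the set of loops of the form $t_++\sum_{j,\mu}y^{j,-j}_{(\mu)}t^{(\mu)}_{j,-j}$, i.e. the zero set of all $\phi^{j,m}_{(\mu)}$ with $m>-j$; let $\{\cdot,\cdot\}^*$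 be the Dirac bracket of these constraints on $\bar g_{fix}$, and let $\mathcal F_{lw}$ be the algebra of fields on $\bar g_{fix}$ consisting of all polynomials in the currents $J^{j,-j}_{(\mu)}$ and their derivatives. **Theorem.** $W(\bar g;t_0)=(\mathcal F_{lw},\{\cdot,\cdot\}^*)$ is a $W$ algebra. More precisely: 1. ($T^I$ descends.) For every smooth $\varepsilon$ and all $m>0$, $\{\int\varepsilon T^I,\phi^{j,m}_{(\mu)}(w)\}=0$ on $\bar g_c$. The group $\bar H$ preserves $\bar g_c$, and $T^I$ is $\bar H$-invariant on $\bar g_c$. 2. (The Dirac bracket exists and closes.) On $\bar g_{fix}$ the matrix $\Delta=\{\phi(z),\phi(w)\}$ of brackets of the constraints that define $\bar g_{fix}$ is invertible, and $\{J^{j,-j}_{(\mu)}(z),J^{j',-j'}_{(\mu')}(w)\}^*$ is a finite sum $\sum_nP_n(w)\,\delta^{(n)}(z-w)$ with $P_n\in\mathcal F_{lw}$. 3. ($T^I$ is the stress energy tensor.) On $\bar g_{fix}$, $$\{T^I(z),T^I(w)\}^*=2T^I(w)\,\delta'(z-w)-\partial T^I(w)\,\delta(z-w)-k\,(t_0,t_0)\,\delta'''(z-w).$$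 4. Each lowest weight current $J^{j,-j}_{(\mu)}$ with $(j;\mu)\neq(1;1)$ is primary of conformal dimension $j+1$ with respect to $T^I$ and the Dirac bracket: $$\{T^I(z),J^{j,-j}_{(\mu)}(w)\}^*=(j+1)\,J^{j,-j}_{(\mu)}(w)\,\delta'(z-w)-\partial J^{j,-j}_{(\mu)}(w)\,\delta(z-w).$$ The current $J^{1,-1}_{(1)}$ along $t_-$ transforms in the same way with dimension $2$, up to the additional central term $-\tfrac12k^2\,\delta'''(z-w)$. 5. $\mathcal F_{lw}$ is freely generated, as a differential algebra, by the currents $J^{j,-j}_{(\mu)}$; it is also freely generated by $T^I|_{\bar g_{fix}}$ and the primary currents $J^{j,-j}_{(\mu)}$, $(j;\mu)\ne(1;1)$. The generators are labelled by the multiplets $\mathrm{span}\{t^{(\mu)}_{j,m}\}_m$, which are irreducible $sl_2$-modules with direct sum $g$, and the number of generators equals the number of summands in any decomposition of the adjoint representation $g$ into irreducible $sl_2$-modules. -/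

import Mathlib

open scoped ContDiff

noncomputable section

namespace DSReduction

/-! ### Smooth functions on the circle and the loop space -/

/-- Smooth `𝕂`-valued functions on the circle `S¹ = ℝ / 2πℤ`. -/
def SmoothCirc (𝕂 : Type*) [RCLike 𝕂] : Subalgebra 𝕂 (ℝ → 𝕂) where
  carrier := {f | ContDiff ℝ ∞ f ∧ Function.Periodic f (2 * Real.pi)}
  mul_mem' := fun hf hg => ⟨hf.1.mul hg.1, hf.2.mul hg.2⟩
  add_mem' := fun hf hg => ⟨hf.1.add hg.1, hf.2.add hg.2⟩
  algebraMap_mem' := fun _ => ⟨contDiff_const, fun _ => rfl⟩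

theorem deriv_mem_smoothCirc {𝕂 : Type*} [RCLike 𝕂] {f : ℝ → 𝕂} (hf : f ∈ SmoothCirc 𝕂) :
    deriv f ∈ SmoothCirc 𝕂 := by
  refine ⟨?_, fun x => ?_⟩
  · exact (contDiff_infty_iff_deriv.1 hf.1).2
  · have h : (fun y => f (y + 2 * Real.pi)) = f := funext hf.2
    rw [← deriv_comp_add_const f (2 * Real.pi) x, h]

/-- The derivative `∂ = d/dz` on smooth functions on the circle. -/
def dz (𝕂 : Type*) [RCLike 𝕂] : SmoothCirc 𝕂 →ₗ[𝕂] SmoothCirc 𝕂 where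
  toFun f := ⟨deriv f.1, deriv_mem_smoothCirc f.2⟩
  map_add' f g := by
    apply Subtype.ext
    funext x
    exact deriv_add ((f.2.1.differentiable (by simp)) x) ((g.2.1.differentiable (by simp)) x)
  map_smul' c f := by
    apply Subtype.ext
    funext x
    exact deriv_const_smul c ((f.2.1.differentiable (by simp)) x)

section Fields

variable {𝕂 : Type*} [RCLike 𝕂]

/-- `∫_{S¹} f dz`. -/
def circInt (f : SmoothCirc 𝕂) : 𝕂 := ∫ z in (0 : ℝ)..(2 * Real.pi), f.1 z

/-- The space `Map(S¹; g)`; a loop `y = y^a t_a` is given by its components `y^a` in a basis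
`(t_a)` of `g`, which are smooth functions on the circle. -/
abbrev Loop (𝕂 : Type*) [RCLike 𝕂] (A : Type*) : Type _ := A → SmoothCirc 𝕂

/-- A field on a set `M` of loops: `A(z)` is a functional on `M` for every `z`, smooth in `z`. -/
abbrev Field (𝕂 : Type*) [RCLike 𝕂] (M : Type*) : Type _ := M → SmoothCirc 𝕂

/-- The field `∂ⁿ A`. -/
def derivField {M : Type*} (n : ℕ) (A : Field 𝕂 M) : Field 𝕂 M := fun y => (dz 𝕂 ^ n) (A y)

/-- The algebra of classical fields generated by a family of fields: the smallest algebra of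
fields that contains the family and is stable under `∂`, that is, all polynomials in the fields of
the family and their derivatives. -/
def fieldAlgebra {M κ : Type*} (X : κ → Field 𝕂 M) : Subalgebra 𝕂 (Field 𝕂 M) :=
  Algebra.adjoin 𝕂 (Set.range fun p : κ × ℕ => derivField p.2 (X p.1))

/-- A family freely generates an algebra `W` of fields: it generates `W`, and no nontrivial
differential polynomial relation holds between the members of the family. -/
def FreelyGenerates {M κ : Type*} (X : κ → Field 𝕂 M) (W : Subalgebra 𝕂 (Field 𝕂 M)) : Prop :=
  fieldAlgebra X = W ∧ AlgebraicIndependent 𝕂 fun p : κ × ℕ => derivField p.2 (X p.1)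

/-- The functional `∫_{S¹} ε(z) A(z) dz`. -/
def smear {M : Type*} (ε : SmoothCirc 𝕂) (A : Field 𝕂 M) : M → 𝕂 := fun y => circInt (ε * A y)

end Fields

/-! ### The affine Kirillov bracket -/

section Kirillov

variable {𝕂 : Type*} [RCLike 𝕂] {g : Type*} [LieRing g] [LieAlgebra 𝕂 g]
  {A : Type*} [Fintype A] (b : Module.Basis A 𝕂 g)

/-- The constant loop with value `x`. -/
def constLoop (x : g) : Loop 𝕂 A := fun a => algebraMap 𝕂 (SmoothCirc 𝕂) (b.repr x a)

/-- The derivative of a loop. -/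
def dLoop (x : Loop 𝕂 A) : Loop 𝕂 A := fun a => dz 𝕂 (x a)

/-- The pointwise Lie bracket `[x, y](z) = [x(z), y(z)]`. -/
def lieLoop (x y : Loop 𝕂 A) : Loop 𝕂 A :=
  fun c => ∑ a, ∑ d, b.repr ⁅b a, b d⁆ c • (x a * y d)

/-- The pointwise Cartan-Killing form `z ↦ (x(z), y(z))`. -/
def killLoop (x y : Loop 𝕂 A) : SmoothCirc 𝕂 :=
  ∑ a, ∑ d, killingForm 𝕂 g (b a) (b d) • (x a * y d)

/-- `X` is the gradient of the functional `F` at `y`, with respect to the form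
`((x, y)) = ∫ (x(z), y(z)) dz`. -/
def HasGradient (F : Loop 𝕂 A → 𝕂) (y X : Loop 𝕂 A) : Prop :=
  ∀ η : Loop 𝕂 A,
    HasDerivAt (fun r : ℝ => F (y + (r : 𝕂) • η)) (circInt (killLoop b X η)) 0

/-- The Hamiltonian vector `[y, X] - k ∂X` at `y` of a functional with gradient `X`. With it
`{J^a(z), J^b(w)} = f^{ab}_c J^c(w) δ(z-w) + k g^{ab} δ'(z-w)`. -/
def hamiltonianVector (k : 𝕂) (y X : Loop 𝕂 A) : Loop 𝕂 A := lieLoop b y X - k • dLoop X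

/-- `{F, G(w)}(y) = B(w)` for all `w`, for the affine Kirillov bracket at level `k`: the
functional `F` has a gradient at `y`, and the field `G(w)` has derivative `B(w)` along the
Hamiltonian vector of `F`. -/
def HasBracket (k : 𝕂) (F : Loop 𝕂 A → 𝕂) (G : Field 𝕂 (Loop 𝕂 A)) (y : Loop 𝕂 A)
    (B : SmoothCirc 𝕂) : Prop :=
  ∃ X : Loop 𝕂 A, HasGradient b F y X ∧
    ∀ w : ℝ, HasDerivAt
      (fun r : ℝ => (G (y + (r : 𝕂) • hamiltonianVector b k y X)).1 w) (B.1 w) 0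

variable {C : Type*} [Fintype C]

/-- The functional `∑_α ∫ v_α(z) φ^α(z) dz` of a family of constraints `φ^α`. -/
def smearFamily (φ : C → Field 𝕂 (Loop 𝕂 A)) (v : C → SmoothCirc 𝕂) : Loop 𝕂 A → 𝕂 :=
  fun y => ∑ α, smear (v α) (φ α) y

/-- The constraints are second class at `y`: the matrix `Δ^{αβ}(z,w) = {φ^α(z), φ^β(w)}(y)` is
invertible, that is, `∫ ∑_α v_α(z) Δ^{αβ}(z,w) dz = u^β(w)` has exactly one solution `v` for every
`u`. -/
def IsSecondClassAt (k : 𝕂) (φ : C → Field 𝕂 (Loop 𝕂 A)) (y : Loop 𝕂 A) : Prop :=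
  ∀ u : C → SmoothCirc 𝕂, ∃! v : C → SmoothCirc 𝕂,
    ∀ β, HasBracket b k (smearFamily φ v) (φ β) y (u β)

/-- `{F, G(w)}^*(y) = B(w)` for all `w`, where
`{F, G(w)}^* = {F, G(w)} - ∫∫ {F, φ^α(z)} Δ_{αβ}(z,z') {φ^β(z'), G(w)} dz dz'` is the Dirac
bracket of the constraints `φ`. Here `u^α(z) = {F, φ^α(z)}`, and
`v_β(z') = ∫ u^α(z) Δ_{αβ}(z,z') dz` is the solution of `∫ v_α(z) Δ^{αβ}(z,w) dz = u^β(w)`. -/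
def HasDiracBracket (k : 𝕂) (φ : C → Field 𝕂 (Loop 𝕂 A)) (F : Loop 𝕂 A → 𝕂)
    (G : Field 𝕂 (Loop 𝕂 A)) (y : Loop 𝕂 A) (B : SmoothCirc 𝕂) : Prop :=
  ∃ (u v : C → SmoothCirc 𝕂) (B₁ B₂ : SmoothCirc 𝕂),
    (∀ β, HasBracket b k F (φ β) y (u β)) ∧
    (∀ β, HasBracket b k (smearFamily φ v) (φ β) y (u β)) ∧
    HasBracket b k F G y B₁ ∧ HasBracket b k (smearFamily φ v) G y B₂ ∧ B = B₁ - B₂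

/-- The improved affine Sugawara tensor
`T^I(z) = (1/2k) g_{ab} J^a(z) J^b(z) + λ_a ∂J^a(z)` with `λ^a t_a = t₀`. -/
def improvedSugawara (k : 𝕂) (t₀ : g) : Field 𝕂 (Loop 𝕂 A) :=
  fun y => (1 / (2 * k)) • killLoop b y y + killLoop b (constLoop b t₀) (dLoop y)

/-- The action `y ↦ γ y γ⁻¹ + k ∂γ γ⁻¹` of the loop `γ = exp h`, that is,
`∑ₙ (ad h)ⁿ y / n! + k ∑ₙ (ad h)ⁿ ∂h / (n+1)!`. It is only used for nilpotent `h`, for which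
`(ad h)ⁿ = 0` as soon as `n ≥ dim g`. -/
def gaugeAction (k : 𝕂) (h y : Loop 𝕂 A) : Loop 𝕂 A :=
  ∑ n ∈ Finset.range (Fintype.card A),
    (((n.factorial : 𝕂)⁻¹) • (lieLoop b h)^[n] y +
      (k * ((n + 1).factorial : 𝕂)⁻¹) • (lieLoop b h)^[n] (dLoop h))

end Kirillov

/-! ### The reduction attached to an `sl₂` subalgebra -/

/-- Labels `(j, m; μ)` of the basis vectors `t_{j,m}^{(μ)}`: the multiplets `(j; μ)` are indexed by
`i : ι`, `s i = 2j` is twice the spin, and `p = j + m` runs from `0` to `2j`. -/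
abbrev Label {ι : Type*} (s : ι → ℕ) : Type _ := (i : ι) × Fin (s i + 1)

section Reduction

variable {𝕂 : Type*} [RCLike 𝕂] {g : Type*} [LieRing g] [LieAlgebra 𝕂 g]
  {ι : Type*} {s : ι → ℕ}

/-- Twice the grade `m` of a label `(j, m; μ)`. -/
def grade2 (a : Label s) : ℤ := 2 * (a.2 : ℤ) - (s a.1 : ℤ)

/-- The label `(j, -j; μ)` of the lowest weight vector of a multiplet. -/
def lowest (s : ι → ℕ) (i : ι) : Label s := ⟨i, 0⟩

/-- The basis `t_{j,m}^{(μ)}` is compatible with the `sl₂` multiplet structure of `g`: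
`[t₀, t_{j,m}] = m t_{j,m}`, `[t_±, t_{j,m}] = c_±(j,m) t_{j,m±1}`, `[t_±, t_{j,±j}] = 0`, and the
multiplet `i₀` is `t_{1,-1} = t_-`, `t_{1,0} = t₀`, `t_{1,1} = t_+`. -/
structure IsMultipletBasis (t₀ tp tm : g) (b : Module.Basis (Label s) 𝕂 g) (i₀ : ι) : Prop where
  weight : ∀ a : Label s, (2 : 𝕂) • ⁅t₀, b a⁆ = (grade2 a : 𝕂) • b a
  raise : ∀ (i : ι) (p q : Fin (s i + 1)), (q : ℕ) = p + 1 →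
    ∃ c : 𝕂, ⁅tp, b ⟨i, p⟩⁆ = c • b ⟨i, q⟩
  raise_highest : ∀ (i : ι), ⁅tp, b ⟨i, Fin.last (s i)⟩⁆ = 0
  lower : ∀ (i : ι) (p q : Fin (s i + 1)), (q : ℕ) = p + 1 →
    ∃ c : 𝕂, ⁅tm, b ⟨i, q⟩⁆ = c • b ⟨i, p⟩
  lower_lowest : ∀ (i : ι), ⁅tm, b (lowest s i)⁆ = 0
  spin_one : s i₀ = 2
  eq_tm : ∀ p : Fin (s i₀ + 1), (p : ℕ) = 0 → b ⟨i₀, p⟩ = tm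
  eq_t₀ : ∀ p : Fin (s i₀ + 1), (p : ℕ) = 1 → b ⟨i₀, p⟩ = t₀
  eq_tp : ∀ p : Fin (s i₀ + 1), (p : ℕ) = 2 → b ⟨i₀, p⟩ = tp

/-- The current `J^a(z)`. -/
def current (𝕂 : Type*) [RCLike 𝕂] {A : Type*} (a : A) : Field 𝕂 (Loop 𝕂 A) := fun y => y a

/-- `φ^a(z) = J^a(z) - χ^a`, where `χ^a` is `1` for `t_a = t_+` and `0` otherwise, that is,
`t_+ = χ^a t_a`. -/
def constraint (b : Module.Basis (Label s) 𝕂 g) (tp : g) (a : Label s) :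
    Field 𝕂 (Loop 𝕂 (Label s)) :=
  fun y => current 𝕂 a y - constLoop b tp a

/-- The constrained loops `ḡ_c`: `φ^{j,m}_{(μ)} = 0` for all `m > 0`. -/
def constrainedLoops (b : Module.Basis (Label s) 𝕂 g) (tp : g) : Set (Loop 𝕂 (Label s)) :=
  {y | ∀ a : Label s, 0 < grade2 a → constraint b tp a y = 0}

/-- Loops in the gauge algebra `h = ⊕_{k ≥ 1} g^{(-k)}`. -/
def gaugeLoops (𝕂 : Type*) [RCLike 𝕂] {ι : Type*} (s : ι → ℕ) : Set (Loop 𝕂 (Label s)) :=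
  {h | ∀ a : Label s, -2 < grade2 a → h a = 0}

/-- The labels `(j, m; μ)` with `m ≠ -j`. -/
abbrev NonLowest (s : ι → ℕ) : Type _ := {a : Label s // (a.2 : ℕ) ≠ 0}

/-- The total set of constraints that define the lowest weight gauge slice: `φ^{j,m}_{(μ)}` for all
`m > -j`. -/
def sliceConstraints (b : Module.Basis (Label s) 𝕂 g) (tp : g) (a : NonLowest s) :
    Field 𝕂 (Loop 𝕂 (Label s)) :=
  constraint b tp a.1

/-- The gauge slice `ḡ_fix`: the loops `t_+ + ∑ y^{j,-j}_{(μ)}(z) t_{j,-j}^{(μ)}`. -/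
def gaugeSlice (b : Module.Basis (Label s) 𝕂 g) (tp : g) : Set (Loop 𝕂 (Label s)) :=
  {y | ∀ a : NonLowest s, sliceConstraints b tp a y = 0}

/-- The restriction of a field to the gauge slice. -/
def restrictSlice (b : Module.Basis (Label s) 𝕂 g) (tp : g)
    (F : Field 𝕂 (Loop 𝕂 (Label s))) : Field 𝕂 (gaugeSlice b tp) := fun y => F y.1

/-- The field algebra of `W(ḡ; t₀)`: the algebra generated by the lowest weight currents
`J^{j,-j}_{(μ)}`, as fields on the gauge slice. -/
def lowestFields (b : Module.Basis (Label s) 𝕂 g) (tp : g) :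
    Subalgebra 𝕂 (Field 𝕂 (gaugeSlice b tp)) :=
  fieldAlgebra fun i : ι => restrictSlice b tp (current 𝕂 (lowest s i))

variable [Fintype ι]

/-- The current `A` transforms as
`{T(z), A(w)}^* = Δ A(w) δ'(z-w) - ∂A(w) δ(z-w) - c δ'''(z-w)` on the gauge slice. After
integration against `ε(z)` the right-hand side is `-(ε ∂A + Δ ε' A) + c ε'''`. -/
def TransformsWith (b : Module.Basis (Label s) 𝕂 g) (tp : g) (k : 𝕂)
    (T A : Field 𝕂 (Loop 𝕂 (Label s))) (Δ c : 𝕂) : Prop :=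
  ∀ ε : SmoothCirc 𝕂, ∀ y ∈ gaugeSlice b tp,
    HasDiracBracket b k (sliceConstraints b tp) (smear ε T) A y
      (-(ε * dz 𝕂 (A y) + Δ • (dz 𝕂 ε * A y)) + c • (dz 𝕂 ^ 3) ε)

/-- `A` is a primary field of conformal dimension `Δ` with respect to `T` and the Dirac bracket. -/
def IsPrimary (b : Module.Basis (Label s) 𝕂 g) (tp : g) (k : 𝕂)
    (T A : Field 𝕂 (Loop 𝕂 (Label s))) (Δ : 𝕂) : Prop :=
  TransformsWith b tp k T A Δ 0

/-- `{A(z), B(w)}^* = ∑ₙ Pₙ(w) δ^{(n)}(z-w)`, a finite sum with coefficients `Pₙ` in the algebra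
`W` of fields on the gauge slice (the signs `(-1)ⁿ` from integration by parts are absorbed in
`Pₙ`). -/
def DiracClosed (b : Module.Basis (Label s) 𝕂 g) (tp : g) (k : 𝕂)
    (W : Subalgebra 𝕂 (Field 𝕂 (gaugeSlice b tp)))
    (A B : Field 𝕂 (Loop 𝕂 (Label s))) : Prop :=
  ∃ (N : ℕ) (P : ℕ → W), ∀ ε : SmoothCirc 𝕂, ∀ y : gaugeSlice b tp,
    HasDiracBracket b k (sliceConstraints b tp) (smear ε A) B y.1
      (∑ n ∈ Finset.range N, (dz 𝕂 ^ n) ε * (P n).1 y)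

end Reduction

end DSReduction

end

set_option linter.unusedSectionVars false

open scoped ContDiff

noncomputable section

namespace DSReduction


/-! ### Calculus of smooth functions on the circle. -/

section SmoothCirc

variable {𝕂 : Type*} [RCLike 𝕂]

/-! Brackets are computed from gradients. The Killing form is nondegenerate, so a functional has at
most one gradient (`HasGradient.unique`), and its bracket with a component of the loop is that
component of the Hamiltonian vector `[y, X] - k ∂X`. The image of `ad t_-` is the orthogonal
complement of its kernel, so the gradients of combinations of the slice constraints are exactly the
loops `X` without highest weight components (`highest_eq_zero_iff`).

Inverting the constraint matrix at `t_+ + w` thus means solving `[t_+ + w, X] - k ∂X = u` in the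
non-lowest components for such an `X`. Inverting `ad t_+` from the non-lowest to the non-highest
components turns this into `X + M X = L u`, where `M` is built from `w` and `∂` and lowers the grade
by at least one. Hence `M` is nilpotent and the Neumann series is finite. It gives existence and
uniqueness (`isSecondClassAt`); its terms are differential operators with coefficients in the lowest
weight fields, which gives closure (`diracClosed`).

For `T^I` the solution is explicit. Since `[t₀, t_+] = t_+`, the Hamiltonian vector of `∫ ε T^I` at
`t_+ + w` is `-ε ∂w - ε' (w - [t₀, w]) + k ε'' t₀`. On the slice only the last term is not tangent;
subtracting the Hamiltonian vector of `(k/2) ε'' t_-` replaces it by `(k²/2) ε''' t_-`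
(`hamiltonianVector_sub_compensator`). The weights `j + 1` and all central terms can be read off
from this. Gauge invariance follows because `T^I` has zero derivative along the flow of `exp (t h)`,
which stays in the constrained loops.

The lowest weight currents take arbitrary values on the slice, and jets of smooth functions are
arbitrary, so there are no differential relations (`algebraicIndependent_derivField`). In `T^I` the
current along `t_-` occurs only linearly, with nonzero coefficient `(t_+, t_-)/k`, so `T^I` may
replace it. Finally, each irreducible summand of `g` contributes one line to the kernel of `ad t_-`,
whose dimension is the number of multiplets. -/

instance : CoeFun (SmoothCirc 𝕂) fun _ => ℝ → 𝕂 := ⟨fun f => f.1⟩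

theorem circ_ext {f g : SmoothCirc 𝕂} (h : ∀ z : ℝ, f z = g z) : f = g :=
  Subtype.ext (funext h)

@[simp] theorem add_at (f g : SmoothCirc 𝕂) (z : ℝ) : (f + g).1 z = f z + g z := rfl
@[simp] theorem sub_at (f g : SmoothCirc 𝕂) (z : ℝ) : (f - g).1 z = f z - g z := rfl
@[simp] theorem neg_at (f : SmoothCirc 𝕂) (z : ℝ) : (-f).1 z = -f z := rfl
@[simp] theorem mul_at (f g : SmoothCirc 𝕂) (z : ℝ) : (f * g).1 z = f z * g z := rfl
@[simp] theorem smul_at (c : 𝕂) (f : SmoothCirc 𝕂) (z : ℝ) : (c • f).1 z = c * f z := rfl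
@[simp] theorem zero_at (z : ℝ) : (0 : SmoothCirc 𝕂).1 z = 0 := rfl
@[simp] theorem one_at (z : ℝ) : (1 : SmoothCirc 𝕂).1 z = 1 := rfl
@[simp] theorem algebraMap_at (c : 𝕂) (z : ℝ) : (algebraMap 𝕂 (SmoothCirc 𝕂) c).1 z = c := rfl

/-- Evaluation at a point of the circle. -/
def evalAt (𝕂 : Type*) [RCLike 𝕂] (z : ℝ) : SmoothCirc 𝕂 →ₐ[𝕂] 𝕂 where
  toFun f := f z
  map_one' := rfl
  map_mul' _ _ := rfl
  map_zero' := rfl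
  map_add' _ _ := rfl
  commutes' _ := rfl

@[simp] theorem evalAt_apply (z : ℝ) (f : SmoothCirc 𝕂) : evalAt 𝕂 z f = f z := rfl

@[simp] theorem sum_at {κ : Type*} (t : Finset κ) (f : κ → SmoothCirc 𝕂) (z : ℝ) :
    (∑ i ∈ t, f i).1 z = ∑ i ∈ t, f i z := map_sum (evalAt 𝕂 z) f t

@[simp] theorem pow_at (f : SmoothCirc 𝕂) (n : ℕ) (z : ℝ) : (f ^ n).1 z = f z ^ n :=
  map_pow (evalAt 𝕂 z) f n

theorem circ_differentiableAt (f : SmoothCirc 𝕂) (z : ℝ) : DifferentiableAt ℝ f.1 z :=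
  (f.2.1.differentiable (by simp)) z

theorem circ_hasDerivAt (f : SmoothCirc 𝕂) (z : ℝ) : HasDerivAt f.1 ((dz 𝕂 f).1 z) z :=
  (circ_differentiableAt f z).hasDerivAt

theorem circ_continuous (f : SmoothCirc 𝕂) : Continuous f.1 := f.2.1.continuous

theorem circ_intervalIntegrable (f : SmoothCirc 𝕂) (x y : ℝ) :
    IntervalIntegrable f.1 MeasureTheory.volume x y := (circ_continuous f).intervalIntegrable x y

theorem dz_eq_of_hasDerivAt {f f' : SmoothCirc 𝕂} (h : ∀ z, HasDerivAt f.1 (f'.1 z) z) :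
    dz 𝕂 f = f' := circ_ext fun z => (h z).deriv

@[simp] theorem dz_mul (f g : SmoothCirc 𝕂) : dz 𝕂 (f * g) = dz 𝕂 f * g + f * dz 𝕂 g :=
  dz_eq_of_hasDerivAt fun z => (circ_hasDerivAt f z).mul (circ_hasDerivAt g z)

@[simp] theorem dz_algebraMap (c : 𝕂) : dz 𝕂 (algebraMap 𝕂 (SmoothCirc 𝕂) c) = 0 :=
  dz_eq_of_hasDerivAt fun z => hasDerivAt_const z c

@[simp] theorem dz_one : dz 𝕂 (1 : SmoothCirc 𝕂) = 0 := by
  simpa using dz_algebraMap (𝕂 := 𝕂) 1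

theorem circInt_add (f g : SmoothCirc 𝕂) : circInt (f + g) = circInt f + circInt g :=
  intervalIntegral.integral_add (circ_intervalIntegrable f _ _) (circ_intervalIntegrable g _ _)

theorem circInt_smul (c : 𝕂) (f : SmoothCirc 𝕂) : circInt (c • f) = c * circInt f :=
  intervalIntegral.integral_const_mul c f.1

/-- `∫_{S¹}` as a linear functional. -/
def circIntₗ (𝕂 : Type*) [RCLike 𝕂] : SmoothCirc 𝕂 →ₗ[𝕂] 𝕂 where
  toFun := circInt
  map_add' := circInt_add
  map_smul' := circInt_smul

theorem circInt_sum {κ : Type*} (t : Finset κ) (f : κ → SmoothCirc 𝕂) :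
    circInt (∑ i ∈ t, f i) = ∑ i ∈ t, circInt (f i) := map_sum (circIntₗ 𝕂) f t

theorem circInt_sub (f g : SmoothCirc 𝕂) : circInt (f - g) = circInt f - circInt g :=
  map_sub (circIntₗ 𝕂) f g

theorem circInt_dz (f : SmoothCirc 𝕂) : circInt (dz 𝕂 f) = 0 := by
  have h := intervalIntegral.integral_eq_sub_of_hasDerivAt
    (a := 0) (b := 2 * Real.pi) (fun z _ => circ_hasDerivAt f z)
    (circ_intervalIntegrable (dz 𝕂 f) _ _)
  have hp : f.1 (2 * Real.pi) = f.1 0 := by simpa using f.2.2 0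
  simpa [circInt, hp] using h

theorem circInt_mul_dz (f g : SmoothCirc 𝕂) : circInt (f * dz 𝕂 g) = -circInt (dz 𝕂 f * g) := by
  have h := circInt_dz (f * g)
  rw [dz_mul, circInt_add] at h
  exact eq_neg_of_add_eq_zero_right h

/-- Complex conjugation of functions on the circle. -/
def starCirc (f : SmoothCirc 𝕂) : SmoothCirc 𝕂 :=
  ⟨fun z => star (f.1 z), (starL' ℝ (A := 𝕂) : 𝕂 ≃L[ℝ] 𝕂).contDiff.comp f.2.1,
    fun z => congrArg star (f.2.2 z)⟩

/-- The integrand is the continuous nonnegative function `|f|²`, so it vanishes on one period, and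
periodicity does the rest. This is what makes gradients unique. -/
theorem eq_zero_of_circInt_mul_star {f : SmoothCirc 𝕂} (h : circInt (f * starCirc f) = 0) :
    f = 0 := by
  have hc : Continuous fun z : ℝ => ‖f.1 z‖ ^ 2 := (circ_continuous f).norm.pow 2
  have h1 : ∫ z in (0 : ℝ)..(2 * Real.pi), ‖f.1 z‖ ^ 2 = 0 := by
    have : circInt (f * starCirc f) = ∫ z in (0 : ℝ)..(2 * Real.pi), ((‖f.1 z‖ ^ 2 : ℝ) : 𝕂) := by
      unfold circInt
      congr 1
      funext z
      simpa [starCirc] using RCLike.mul_conj (f.1 z)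
    rw [this, RCLike.intervalIntegral_ofReal] at h
    exact_mod_cast h
  have hpi : (0 : ℝ) < 2 * Real.pi := by positivity
  have h2 : ∀ z ∈ Set.Icc 0 (2 * Real.pi), f.1 z = 0 := by
    intro z hz
    by_contra hne
    have := intervalIntegral.integral_pos hpi hc.continuousOn (fun x _ => by positivity)
      ⟨z, hz, by positivity⟩
    exact this.ne' h1
  refine circ_ext fun z => ?_
  obtain ⟨w, hw, hzw⟩ := f.2.2.exists_mem_Ico₀ hpi z
  rw [hzw]
  exact h2 w ⟨hw.1, hw.2.le⟩

/-! ### Jets of smooth functions on the circle -/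

/-- The sine function. -/
def sinCirc (𝕂 : Type*) [RCLike 𝕂] : SmoothCirc 𝕂 :=
  ⟨fun z => ((Real.sin z : ℝ) : 𝕂), (RCLike.ofRealCLM (K := 𝕂)).contDiff.comp Real.contDiff_sin,
    fun z => by simp⟩

@[simp] theorem sinCirc_zero : (sinCirc 𝕂).1 0 = 0 := by simp [sinCirc]

theorem dz_sinCirc_zero : (dz 𝕂 (sinCirc 𝕂)).1 0 = 1 := by
  have h : HasDerivAt (sinCirc 𝕂).1 ((Real.cos 0 : ℝ) : 𝕂) 0 :=
    (RCLike.ofRealCLM (K := 𝕂)).hasFDerivAt.comp_hasDerivAt 0 (Real.hasDerivAt_sin 0)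
  rw [(circ_hasDerivAt (sinCirc 𝕂) 0).unique h]
  simp

theorem dz_pow_succ_apply (n : ℕ) (f : SmoothCirc 𝕂) :
    (dz 𝕂 ^ (n + 1)) f = (dz 𝕂 ^ n) (dz 𝕂 f) := by
  rw [pow_succ]; rfl

theorem dz_pow_succ_apply' (n : ℕ) (f : SmoothCirc 𝕂) :
    (dz 𝕂 ^ (n + 1)) f = dz 𝕂 ((dz 𝕂 ^ n) f) := by
  rw [pow_succ']; rfl

/-- The sine is a periodic substitute for a local coordinate at `0`: its derivative there is `1`, so
differentiation lowers the order of vanishing by one and multiplies the leading coefficient by the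
order. -/
theorem exists_dz_sin_pow_mul (n : ℕ) (f : SmoothCirc 𝕂) : ∃ f' : SmoothCirc 𝕂,
    dz 𝕂 (sinCirc 𝕂 ^ (n + 1) * f) = sinCirc 𝕂 ^ n * f' ∧ f' 0 = (n + 1) * f 0 := by
  have hpow : ∀ m : ℕ, dz 𝕂 (sinCirc 𝕂 ^ (m + 1)) =
      ((m : 𝕂) + 1) • (sinCirc 𝕂 ^ m * dz 𝕂 (sinCirc 𝕂)) := by
    intro m
    induction m with
    | zero => simp
    | succ m ih =>
      rw [pow_succ, dz_mul, ih]
      refine circ_ext fun z => ?_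
      simp
      ring
  refine ⟨((n : 𝕂) + 1) • (dz 𝕂 (sinCirc 𝕂) * f) + sinCirc 𝕂 * dz 𝕂 f, ?_, ?_⟩
  · rw [dz_mul, hpow]
    refine circ_ext fun z => ?_
    simp
    ring
  · simp [dz_sinCirc_zero]

theorem dz_pow_sin_pow_mul_of_lt (m : ℕ) : ∀ (n : ℕ) (f : SmoothCirc 𝕂), m < n →
    ((dz 𝕂 ^ m) (sinCirc 𝕂 ^ n * f)).1 0 = 0 := by
  induction m with
  | zero => intro n f hn; simp [hn.ne']
  | succ m ih =>
    intro n f hn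
    obtain ⟨n, rfl⟩ := Nat.exists_eq_succ_of_ne_zero (by omega : n ≠ 0)
    obtain ⟨f', hf, -⟩ := exists_dz_sin_pow_mul n f
    rw [dz_pow_succ_apply, Nat.succ_eq_add_one, hf]
    exact ih n f' (by omega)

theorem dz_pow_sin_pow_mul_self (n : ℕ) : ∀ f : SmoothCirc 𝕂,
    ((dz 𝕂 ^ n) (sinCirc 𝕂 ^ n * f)).1 0 = n.factorial * f 0 := by
  induction n with
  | zero => intro f; simp
  | succ n ih =>
    intro f
    obtain ⟨f', hf, hf0⟩ := exists_dz_sin_pow_mul n f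
    rw [dz_pow_succ_apply, hf, ih, hf0, Nat.factorial_succ]
    push_cast
    ring

/-- Every finite jet at a point is the jet of a smooth function on the circle. -/
theorem exists_jet (c : ℕ → 𝕂) (N : ℕ) :
    ∃ f : SmoothCirc 𝕂, ∀ n < N, ((dz 𝕂 ^ n) f).1 0 = c n := by
  induction N with
  | zero => exact ⟨0, by simp⟩
  | succ N ih =>
    obtain ⟨f, hf⟩ := ih
    have hN : (N.factorial : 𝕂) ≠ 0 := by exact_mod_cast N.factorial_ne_zero
    -- The correction vanishes to order `N` at `0`, so it adjusts the `N`-th derivative and leaves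
    -- the lower ones alone.
    refine ⟨f + sinCirc 𝕂 ^ N *
      algebraMap 𝕂 _ ((c N - ((dz 𝕂 ^ N) f).1 0) / N.factorial), fun n hn => ?_⟩
    rw [map_add, add_at]
    rcases Nat.lt_succ_iff_lt_or_eq.1 hn with h | rfl
    · rw [hf n h, dz_pow_sin_pow_mul_of_lt n N _ h, add_zero]
    · rw [dz_pow_sin_pow_mul_self, algebraMap_at]
      field_simp
      ring

end SmoothCirc


/-! ### Loops in `g`, evaluated pointwise. -/

section

variable {𝕂 : Type*} [RCLike 𝕂] {A : Type*}

theorem dLoop_add (x y : Loop 𝕂 A) : dLoop (x + y) = dLoop x + dLoop y :=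
  funext fun _ => map_add _ _ _

theorem dLoop_sub (x y : Loop 𝕂 A) : dLoop (x - y) = dLoop x - dLoop y :=
  funext fun _ => map_sub _ _ _

theorem dLoop_smul (c : 𝕂) (x : Loop 𝕂 A) : dLoop (c • x) = c • dLoop x :=
  funext fun _ => (dz 𝕂).map_smul _ _

theorem dLoop_circ_smul (f : SmoothCirc 𝕂) (x : Loop 𝕂 A) :
    dLoop (f • x) = dz 𝕂 f • x + f • dLoop x :=
  funext fun _ => dz_mul _ _

/-- The derivative as a linear map on loops. -/
def dLoopₗ (𝕂 : Type*) [RCLike 𝕂] (A : Type*) : Loop 𝕂 A →ₗ[𝕂] Loop 𝕂 A where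
  toFun := dLoop
  map_add' := dLoop_add
  map_smul' := dLoop_smul

@[simp] theorem dLoopₗ_apply (x : Loop 𝕂 A) : dLoopₗ 𝕂 A x = dLoop x := rfl

end

section Loops

variable {𝕂 : Type*} [RCLike 𝕂] {g : Type*} [LieRing g] [LieAlgebra 𝕂 g]
  {A : Type*} [Fintype A] (b : Module.Basis A 𝕂 g)

/-- The value in `g` of a loop at a point of the circle. -/
def loopAt (z : ℝ) : Loop 𝕂 A →ₗ[𝕂] g where
  toFun x := ∑ a, (x a).1 z • b a
  map_add' x y := by simp [add_smul, Finset.sum_add_distrib]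
  map_smul' c x := by simp [mul_smul, Finset.smul_sum]

theorem loopAt_apply (z : ℝ) (x : Loop 𝕂 A) : loopAt b z x = ∑ a, (x a).1 z • b a := rfl

@[simp] theorem repr_loopAt (z : ℝ) (x : Loop 𝕂 A) (a : A) :
    b.repr (loopAt b z x) a = (x a).1 z := by
  classical
  rw [loopAt_apply, Module.Basis.repr_sum_self]

/-- With this, identities between loops reduce to identities in the Lie algebra `g`. -/
theorem loop_ext {x y : Loop 𝕂 A} (h : ∀ z, loopAt b z x = loopAt b z y) : x = y := by
  funext a
  refine circ_ext fun z => ?_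
  rw [← repr_loopAt b, h, repr_loopAt]

@[simp] theorem loopAt_circ_smul (z : ℝ) (f : SmoothCirc 𝕂) (x : Loop 𝕂 A) :
    loopAt b z (f • x) = f.1 z • loopAt b z x := by
  simp [loopAt_apply, mul_smul, Finset.smul_sum]

@[simp] theorem loopAt_constLoop (z : ℝ) (x : g) : loopAt b z (constLoop b x) = x := by
  simp [loopAt_apply, constLoop, Module.Basis.sum_repr]

@[simp] theorem loopAt_lieLoop (z : ℝ) (x y : Loop 𝕂 A) :
    loopAt b z (lieLoop b x y) = ⁅loopAt b z x, loopAt b z y⁆ := by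
  apply b.ext_elem
  intro c
  rw [repr_loopAt]
  simp only [lieLoop, sum_at, smul_at, mul_at, loopAt_apply, sum_lie, lie_sum, map_sum,
    Finsupp.coe_finsetSum, Finset.sum_apply, smul_lie, lie_smul, map_smul,
    Finsupp.smul_apply, smul_eq_mul]
  rw [Finset.sum_comm]
  refine Finset.sum_congr rfl fun a _ => ?_
  rw [Finset.mul_sum]
  refine Finset.sum_congr rfl fun d _ => ?_
  ring

theorem killLoop_at (z : ℝ) (x y : Loop 𝕂 A) :
    (killLoop b x y).1 z = killingForm 𝕂 g (loopAt b z x) (loopAt b z y) := by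
  simp only [killLoop, sum_at, smul_at, mul_at, loopAt_apply, map_sum, map_smul,
    LinearMap.sum_apply, LinearMap.smul_apply, smul_eq_mul]
  rw [Finset.sum_comm]
  refine Finset.sum_congr rfl fun a _ => ?_
  rw [Finset.mul_sum]
  refine Finset.sum_congr rfl fun d _ => ?_
  ring

@[simp] theorem dLoop_constLoop (x : g) : dLoop (constLoop b x) = 0 :=
  funext fun _ => dz_algebraMap _

/-- The pointwise adjoint action on loops. -/
def adLoop (x : Loop 𝕂 A) : Loop 𝕂 A →ₗ[𝕂] Loop 𝕂 A where
  toFun := lieLoop b x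
  map_add' y y' := loop_ext b fun z => by simp
  map_smul' c y := loop_ext b fun z => by simp

@[simp] theorem adLoop_apply (x y : Loop 𝕂 A) : adLoop b x y = lieLoop b x y := rfl

theorem lieLoop_add_left (x x' y : Loop 𝕂 A) :
    lieLoop b (x + x') y = lieLoop b x y + lieLoop b x' y := loop_ext b fun z => by simp

theorem dz_killLoop (x y : Loop 𝕂 A) :
    dz 𝕂 (killLoop b x y) = killLoop b (dLoop x) y + killLoop b x (dLoop y) := by
  simp only [killLoop, map_sum, map_smul, dz_mul, dLoop, smul_add, Finset.sum_add_distrib]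

theorem killLoop_add_left (x x' y : Loop 𝕂 A) :
    killLoop b (x + x') y = killLoop b x y + killLoop b x' y :=
  circ_ext fun z => by simp [killLoop_at]

theorem killLoop_sub_left (x x' y : Loop 𝕂 A) :
    killLoop b (x - x') y = killLoop b x y - killLoop b x' y :=
  circ_ext fun z => by simp [killLoop_at]

theorem killLoop_smul_left (c : 𝕂) (x y : Loop 𝕂 A) :
    killLoop b (c • x) y = c • killLoop b x y :=
  circ_ext fun z => by simp [killLoop_at]

theorem killLoop_circ_smul_left (f : SmoothCirc 𝕂) (x y : Loop 𝕂 A) :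
    killLoop b (f • x) y = f * killLoop b x y :=
  circ_ext fun z => by simp [killLoop_at]

theorem killLoop_comm (x y : Loop 𝕂 A) : killLoop b x y = killLoop b y x :=
  circ_ext fun z => by
    simp only [killLoop_at]; exact LieModule.traceForm_comm 𝕂 g g _ _

theorem killLoop_add_right (x y y' : Loop 𝕂 A) :
    killLoop b x (y + y') = killLoop b x y + killLoop b x y' :=
  circ_ext fun z => by simp [killLoop_at]

theorem killLoop_smul_right (c : 𝕂) (x y : Loop 𝕂 A) :
    killLoop b x (c • y) = c • killLoop b x y :=
  circ_ext fun z => by simp [killLoop_at]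

/-- The components of a loop with lowered indices. -/
def lowerIndex (X : Loop 𝕂 A) : Loop 𝕂 A := fun d => killLoop b X (constLoop b (b d))

theorem killLoop_eq_sum_lowerIndex (X η : Loop 𝕂 A) : killLoop b X η = ∑ d, lowerIndex b X d * η d := by
  refine circ_ext fun z => ?_
  simp only [sum_at, mul_at, lowerIndex, killLoop_at, loopAt_constLoop]
  conv_lhs => rw [loopAt_apply b z η, map_sum]
  refine Finset.sum_congr rfl fun a _ => ?_
  rw [map_smul, smul_eq_mul, mul_comm]

theorem lowerIndex_at (X : Loop 𝕂 A) (d : A) (z : ℝ) :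
    (lowerIndex b X d).1 z = killingForm 𝕂 g (loopAt b z X) (b d) := by
  simp [lowerIndex, killLoop_at]

variable [LieAlgebra.IsKilling 𝕂 g]

/-- Nondegeneracy of the Killing form, applied at each point of the circle. -/
theorem lowerIndex_injective : Function.Injective (lowerIndex b : Loop 𝕂 A → Loop 𝕂 A) := by
  intro X Y h
  refine loop_ext b fun z => ?_
  rw [← sub_eq_zero]
  refine (LieAlgebra.IsKilling.killingForm_nondegenerate 𝕂 g).1 _ fun x => ?_
  have : killingForm 𝕂 g (loopAt b z X - loopAt b z Y) = 0 := by
    refine b.ext fun d => ?_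
    have := congrArg (fun f : Loop 𝕂 A => (f d).1 z) h
    simp only [lowerIndex_at] at this
    simp [this]
  simp [this]

variable [DecidableEq A]

/-- Indices are raised by contraction with the Killing-dual basis. -/
theorem lowerIndex_surjective : Function.Surjective (lowerIndex b : Loop 𝕂 A → Loop 𝕂 A) := by
  intro l
  let b' := (killingForm 𝕂 g).dualBasis (LieAlgebra.IsKilling.killingForm_nondegenerate 𝕂 g) b
  refine ⟨∑ d, l d • constLoop b (b' d), funext fun d => circ_ext fun z => ?_⟩
  rw [lowerIndex_at]
  simp [b', LinearMap.BilinForm.apply_dualBasis_left]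

end Loops

/-! ### Gradients, Hamiltonian vectors and the conformal vector field of `T^I`. -/

section Brackets

variable {𝕂 : Type*} [RCLike 𝕂] {g : Type*} [LieRing g] [LieAlgebra 𝕂 g]
  {A : Type*} [Fintype A] (b : Module.Basis A 𝕂 g)

theorem hasDerivAt_quadratic (p q c : 𝕂) :
    HasDerivAt (fun r : ℝ => p + (r : 𝕂) * q + (r : 𝕂) ^ 2 * c) q 0 := by
  have h : HasDerivAt (fun r : ℝ => (r : 𝕂)) 1 0 := by
    simpa using (RCLike.ofRealCLM (K := 𝕂)).hasDerivAt (x := 0)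
  have h' := ((h.mul_const q).const_add p).add ((h.pow 2).mul_const c)
  simp only [RCLike.ofReal_zero, one_mul, Nat.cast_ofNat, Nat.add_one_sub_one, pow_one, mul_zero,
    mul_one, zero_mul, add_zero] at h'
  exact h'

theorem hasDerivAt_linear (p q : 𝕂) : HasDerivAt (fun r : ℝ => p + (r : 𝕂) * q) q 0 := by
  simpa using hasDerivAt_quadratic p q 0

/-- A derivative given by components `l` determines the gradient: the difference of the two
candidates is tested against its own complex conjugate, one component at a time. -/
theorem hasGradient_iff [LieAlgebra.IsKilling 𝕂 g] {F : Loop 𝕂 A → 𝕂} {y l X : Loop 𝕂 A}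
    (hF : ∀ η : Loop 𝕂 A,
      HasDerivAt (fun r : ℝ => F (y + (r : 𝕂) • η)) (circInt (∑ d, l d * η d)) 0) :
    HasGradient b F y X ↔ lowerIndex b X = l := by
  classical
  refine ⟨fun h => funext fun d => ?_, fun h η => ?_⟩
  · have h1 := (h (Pi.single d (starCirc (lowerIndex b X d - l d)))).unique (hF _)
    rw [killLoop_eq_sum_lowerIndex, ← sub_eq_zero, ← circInt_sub, ← Finset.sum_sub_distrib,
      Finset.sum_eq_single d (fun e _ he => by simp [he]) (by simp), Pi.single_eq_same,
      ← sub_mul] at h1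
    exact sub_eq_zero.1 (eq_zero_of_circInt_mul_star h1)
  · rw [killLoop_eq_sum_lowerIndex, h]
    exact hF η

theorem HasGradient.unique [LieAlgebra.IsKilling 𝕂 g] {F : Loop 𝕂 A → 𝕂} {y X Y : Loop 𝕂 A}
    (hX : HasGradient b F y X) (hY : HasGradient b F y Y) : X = Y := by
  refine lowerIndex_injective b ((hasGradient_iff b fun η => ?_).1 hX)
  rw [← killLoop_eq_sum_lowerIndex]
  exact hY η

/-- Fields that are affine functions of the loop, with linear part a component of the loop. -/
theorem hasBracket_component_iff {k : 𝕂} {F : Loop 𝕂 A → 𝕂} {G : Field 𝕂 (Loop 𝕂 A)}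
    {y : Loop 𝕂 A} {B c : SmoothCirc 𝕂} {a : A} (hG : ∀ x, G x = x a - c) :
    HasBracket b k F G y B ↔ ∃ X, HasGradient b F y X ∧ hamiltonianVector b k y X a = B := by
  have key : ∀ (V : Loop 𝕂 A) (w : ℝ),
      HasDerivAt (fun r : ℝ => (G (y + (r : 𝕂) • V)).1 w) ((V a).1 w) 0 := by
    intro V w
    have := hasDerivAt_linear ((y a).1 w - c.1 w) ((V a).1 w)
    refine this.congr_of_eventuallyEq (Filter.Eventually.of_forall fun r => ?_)
    simp only [hG, sub_at, Pi.add_apply, add_at, Pi.smul_apply, smul_at]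
    ring
  refine exists_congr fun X => and_congr_right fun _ => ⟨fun h => ?_, fun h w => h ▸ key _ w⟩
  exact circ_ext fun w => (key _ w).unique (h w)

theorem hasBracket_constraint_iff {ι : Type*} [Fintype ι] {s : ι → ℕ}
    {b : Module.Basis (Label s) 𝕂 g} {tp : g} {k : 𝕂} {F : Loop 𝕂 (Label s) → 𝕂}
    {y : Loop 𝕂 (Label s)} {B : SmoothCirc 𝕂} {a : Label s} :
    HasBracket b k F (constraint b tp a) y B ↔
      ∃ X, HasGradient b F y X ∧ hamiltonianVector b k y X a = B :=
  hasBracket_component_iff b fun _ => rfl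

/-- The derivative of the improved Sugawara tensor. -/
def sugawaraDeriv (k : 𝕂) (t₀ : g) (y η : Loop 𝕂 A) : SmoothCirc 𝕂 :=
  (1 / k) • killLoop b y η + killLoop b (constLoop b t₀) (dLoop η)

theorem improvedSugawara_add_smul (k : 𝕂) (t₀ : g) (y η : Loop 𝕂 A) (r : 𝕂) :
    improvedSugawara b k t₀ (y + r • η) = improvedSugawara b k t₀ y +
      r • sugawaraDeriv b k t₀ y η + r ^ 2 • ((1 / (2 * k)) • killLoop b η η) := by
  unfold improvedSugawara sugawaraDeriv
  rw [dLoop_add, dLoop_smul]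
  simp only [killLoop_add_left, killLoop_add_right, killLoop_smul_left, killLoop_smul_right,
    killLoop_comm b η y, smul_add]
  refine circ_ext fun z => ?_
  simp only [add_at, smul_at]
  -- At `k = 0` the coefficients `1 / k` and `1 / (2 * k)` are both `0` by convention, so the
  -- identity needs no hypothesis on `k`.
  by_cases hk : k = 0
  · simp [hk]
  · field_simp
    ring

theorem improvedSugawara_hasDerivAt (k : 𝕂) (t₀ : g) (y η : Loop 𝕂 A) (w : ℝ) :
    HasDerivAt (fun r : ℝ => (improvedSugawara b k t₀ (y + (r : 𝕂) • η)).1 w)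
      ((sugawaraDeriv b k t₀ y η).1 w) 0 := by
  simp only [improvedSugawara_add_smul, add_at, smul_at]
  simpa only [mul_assoc] using hasDerivAt_quadratic (𝕂 := 𝕂) _ _ _

/-- The gradient of `∫ ε T^I`. -/
def sugawaraGradient (k : 𝕂) (t₀ : g) (ε : SmoothCirc 𝕂) (y : Loop 𝕂 A) : Loop 𝕂 A :=
  (1 / k) • (ε • y) - dz 𝕂 ε • constLoop b t₀

/-- Integration by parts moves the derivative from `∂η` to `ε`, which produces the term `-ε' t₀` of
the gradient. As `T^I` is quadratic in the loop, its expansion in `r` is exact. -/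
theorem hasGradient_smear_improvedSugawara (k : 𝕂) (t₀ : g) (ε : SmoothCirc 𝕂)
    (y : Loop 𝕂 A) :
    HasGradient b (smear ε (improvedSugawara b k t₀)) y (sugawaraGradient b k t₀ ε y) := by
  intro η
  have h1 : circInt (killLoop b (sugawaraGradient b k t₀ ε y) η) =
      circInt (ε * sugawaraDeriv b k t₀ y η) := by
    have h2 := circInt_mul_dz ε (killLoop b (constLoop b t₀) η)
    rw [dz_killLoop, dLoop_constLoop] at h2
    have h0 : killLoop b (0 : Loop 𝕂 A) η = 0 := circ_ext fun z => by simp [killLoop_at]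
    rw [h0, zero_add] at h2
    rw [sugawaraGradient, sugawaraDeriv, killLoop_sub_left, killLoop_smul_left,
      killLoop_circ_smul_left, killLoop_circ_smul_left, mul_add, circInt_add, h2, circInt_sub,
      sub_eq_add_neg, mul_smul_comm]
  rw [h1]
  simp only [smear, improvedSugawara_add_smul, mul_add, circInt_add, mul_smul_comm, circInt_smul]
  simpa only [mul_assoc] using hasDerivAt_quadratic (𝕂 := 𝕂) _ _ _

/-- The term `[y, ε y]` vanishes; what is left is `-∂(ε y)` together with the two contributions of
`-ε' t₀`. -/
theorem hamiltonianVector_sugawaraGradient {k : 𝕂} (hk : k ≠ 0) (t₀ : g) (ε : SmoothCirc 𝕂)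
    (y : Loop 𝕂 A) :
    hamiltonianVector b k y (sugawaraGradient b k t₀ ε y) =
      -(ε • dLoop y) - dz 𝕂 ε • (y - lieLoop b (constLoop b t₀) y) +
        k • ((dz 𝕂 ^ 2) ε • constLoop b t₀) := by
  refine loop_ext b fun z => ?_
  have h2 : (dz 𝕂 ^ 2) ε = dz 𝕂 (dz 𝕂 ε) := rfl
  simp only [hamiltonianVector, sugawaraGradient, dLoop_sub, dLoop_smul, dLoop_circ_smul,
    dLoop_constLoop, map_sub, map_add, map_smul, map_neg, loopAt_lieLoop, loopAt_circ_smul,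
    loopAt_constLoop, map_zero, h2, lie_sub, lie_smul, lie_self, smul_add, smul_sub,
    smul_smul, smul_zero, mul_one_div_cancel hk, one_smul]
  rw [← lie_skew t₀ (loopAt b z y)]
  module

end Brackets


/-! ### The `sl₂` multiplets, the grading and the Killing form. -/

section Multiplets

variable {𝕂 : Type*} [RCLike 𝕂] {g : Type*} [LieRing g] [LieAlgebra 𝕂 g]
  {ι : Type*} {s : ι → ℕ}

/-- The basis vector `t_{j,m}` of the multiplet `i` with `p = j + m`, and zero for `p > 2j`. -/
def multipletVec (b : Module.Basis (Label s) 𝕂 g) (i : ι) (p : ℕ) : g :=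
  if h : p < s i + 1 then b ⟨i, ⟨p, h⟩⟩ else 0

theorem multipletVec_val (b : Module.Basis (Label s) 𝕂 g) (i : ι) (p : Fin (s i + 1)) :
    multipletVec b i p = b ⟨i, p⟩ := dif_pos p.2

theorem multipletVec_of_lt (b : Module.Basis (Label s) 𝕂 g) {i : ι} {p : ℕ} (h : p < s i + 1) :
    multipletVec b i p = b ⟨i, ⟨p, h⟩⟩ := dif_pos h

theorem multipletVec_ne_zero (b : Module.Basis (Label s) 𝕂 g) {i : ι} {p : ℕ} (h : p < s i + 1) :
    multipletVec b i p ≠ 0 := by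
  rw [multipletVec_of_lt b h]; exact b.ne_zero _

theorem multipletVec_of_gt (b : Module.Basis (Label s) 𝕂 g) {i : ι} {p : ℕ} (h : s i < p) :
    multipletVec b i p = 0 := dif_neg (by omega)

variable {t₀ tp tm : g} {b : Module.Basis (Label s) 𝕂 g} {i₀ : ι}

theorem IsMultipletBasis.lie_t₀ (hb : IsMultipletBasis t₀ tp tm b i₀) (a : Label s) :
    ⁅t₀, b a⁆ = ((grade2 a : 𝕂) / 2) • b a := by
  have h := congrArg ((2 : 𝕂)⁻¹ • ·) (hb.weight a)
  simp only [smul_smul] at h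
  rw [inv_mul_cancel₀ two_ne_zero, one_smul] at h
  rw [h]
  congr 1
  ring

theorem IsMultipletBasis.lie_t₀_vec (hb : IsMultipletBasis t₀ tp tm b i₀) (i : ι) (p : ℕ) :
    ⁅t₀, multipletVec b i p⁆ = ((p : 𝕂) - s i / 2) • multipletVec b i p := by
  by_cases h : p < s i + 1
  · rw [multipletVec_of_lt b h, hb.lie_t₀]
    congr 1
    simp [grade2]
    ring
  · simp [multipletVec, h]

theorem lie_tp_tm (ht : IsSl2Triple ((2 : 𝕂) • t₀) tp tm) : ⁅tp, tm⁆ = (2 : 𝕂) • t₀ := ht.lie_e_f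

theorem IsMultipletBasis.vec_zero (hb : IsMultipletBasis t₀ tp tm b i₀) :
    multipletVec b i₀ 0 = tm := by
  rw [multipletVec_of_lt b (by omega)]; exact hb.eq_tm _ rfl

theorem IsMultipletBasis.vec_one (hb : IsMultipletBasis t₀ tp tm b i₀) :
    multipletVec b i₀ 1 = t₀ := by
  rw [multipletVec_of_lt b (by rw [hb.spin_one]; omega)]; exact hb.eq_t₀ _ rfl

theorem IsMultipletBasis.vec_two (hb : IsMultipletBasis t₀ tp tm b i₀) :
    multipletVec b i₀ 2 = tp := by
  rw [multipletVec_of_lt b (by rw [hb.spin_one]; omega)]; exact hb.eq_tp _ rfl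

theorem IsMultipletBasis.lie_t₀_tp (hb : IsMultipletBasis t₀ tp tm b i₀) : ⁅t₀, tp⁆ = tp := by
  have h := hb.lie_t₀_vec i₀ 2
  rw [hb.vec_two, hb.spin_one] at h
  rw [h]
  norm_num

theorem IsMultipletBasis.lie_tm_lowest (hb : IsMultipletBasis t₀ tp tm b i₀) (i : ι) :
    ⁅tm, multipletVec b i 0⁆ = 0 := by
  rw [multipletVec_of_lt b (by omega)]; exact hb.lower_lowest i

/-- The coefficients of the raising and lowering operators in a multiplet; their product is
`j(j+1) - m(m+1)`. -/
theorem IsMultipletBasis.exists_coeff (ht : IsSl2Triple ((2 : 𝕂) • t₀) tp tm)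
    (hb : IsMultipletBasis t₀ tp tm b i₀) :
    ∃ cp cm : ι → ℕ → 𝕂,
      (∀ i p, ⁅tp, multipletVec b i p⁆ = cp i p • multipletVec b i (p + 1)) ∧
      (∀ i p, ⁅tm, multipletVec b i (p + 1)⁆ = cm i p • multipletVec b i p) ∧
      ∀ i p, p < s i → cm i p * cp i p = (p + 1) * (s i - p) := by
  have h1 : ∀ i p, ∃ c : 𝕂, ⁅tp, multipletVec b i p⁆ = c • multipletVec b i (p + 1) := by
    intro i p
    rcases lt_trichotomy p (s i) with h | rfl | h
    · rw [multipletVec_of_lt b (by omega), multipletVec_of_lt b (by omega : p + 1 < s i + 1)]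
      exact hb.raise i _ _ rfl
    · refine ⟨0, ?_⟩
      rw [multipletVec_of_lt b (by omega), zero_smul]
      exact hb.raise_highest i
    · exact ⟨0, by simp [multipletVec_of_gt b h]⟩
  have h2 : ∀ i p, ∃ c : 𝕂, ⁅tm, multipletVec b i (p + 1)⁆ = c • multipletVec b i p := by
    intro i p
    by_cases h : p + 1 < s i + 1
    · rw [multipletVec_of_lt b h, multipletVec_of_lt b (by omega : p < s i + 1)]
      exact hb.lower i _ _ rfl
    · exact ⟨0, by simp [multipletVec_of_gt b (by omega : s i < p + 1)]⟩
  choose cp hcp using h1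
  choose cm hcm using h2
  refine ⟨cp, cm, hcp, hcm, fun i p => ?_⟩
  induction p with
  | zero =>
    intro h
    -- On the lowest weight vector `[t_+, [t_-, v]]` is absent, so the product of coefficients is
    -- minus twice the weight `-s/2`.
    have hJ := leibniz_lie tp tm (multipletVec b i 0)
    rw [hb.lie_tm_lowest, lie_zero, lie_tp_tm ht, hcp, lie_smul, hcm, smul_lie, hb.lie_t₀_vec,
      smul_smul, smul_smul, ← add_smul] at hJ
    have := (smul_eq_zero.1 hJ.symm).resolve_right (multipletVec_ne_zero b (by omega))
    push_cast at this ⊢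
    linear_combination this
  | succ p ih =>
    intro h
    -- The Jacobi identity gives the recursion: the product at `p + 1` is the product at `p` minus
    -- twice the weight of the vector `p + 1`.
    have hJ := leibniz_lie tp tm (multipletVec b i (p + 1))
    rw [hcm, lie_smul, hcp, lie_tp_tm ht, hcp, lie_smul, hcm, smul_lie, hb.lie_t₀_vec,
      smul_smul, smul_smul, smul_smul, ← add_smul, ← sub_eq_zero, ← sub_smul] at hJ
    have := (smul_eq_zero.1 hJ).resolve_right (multipletVec_ne_zero b (by omega))
    have hi := ih (by omega)
    push_cast at this ⊢
    linear_combination hi - this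

theorem coeff_ne_zero {cp cm : ι → ℕ → 𝕂}
    (h : ∀ i p, p < s i → cm i p * cp i p = (p + 1) * (s i - p)) {i : ι} {p : ℕ} (hp : p < s i) :
    cp i p ≠ 0 ∧ cm i p ≠ 0 := by
  have h1 : ((p : 𝕂) + 1) * (s i - p) ≠ 0 := by
    have h2 : (p : 𝕂) + 1 ≠ 0 := by exact_mod_cast p.succ_ne_zero
    have h3 : (s i : 𝕂) - p ≠ 0 := sub_ne_zero.2 (by exact_mod_cast hp.ne')
    exact mul_ne_zero h2 h3
  rw [← h i p hp] at h1
  exact ⟨right_ne_zero_of_mul h1, left_ne_zero_of_mul h1⟩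

/-! ### The grading -/

theorem IsMultipletBasis.repr_lie_t₀ [Fintype ι] (hb : IsMultipletBasis t₀ tp tm b i₀) (x : g)
    (a : Label s) :
    b.repr ⁅t₀, x⁆ a = (grade2 a : 𝕂) / 2 * b.repr x a := by
  classical
  conv_lhs => rw [← b.sum_repr x]
  simp only [lie_sum, lie_smul, hb.lie_t₀, map_sum, map_smul, Finsupp.coe_finsetSum,
    Finset.sum_apply, Finsupp.smul_apply, b.repr_self, Finsupp.single_apply, smul_eq_mul,
    mul_ite, mul_one, mul_zero, Finset.sum_ite_eq', Finset.mem_univ, if_true]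
  ring

/-- `ad t₀` is a derivation, so the bracket of two weight vectors is an eigenvector for the sum of
the weights. -/
theorem IsMultipletBasis.repr_lie_basis [Fintype ι] (hb : IsMultipletBasis t₀ tp tm b i₀)
    {a d e : Label s} (h : grade2 e ≠ grade2 a + grade2 d) : b.repr ⁅b a, b d⁆ e = 0 := by
  have h1 := hb.repr_lie_t₀ ⁅b a, b d⁆ e
  rw [leibniz_lie, hb.lie_t₀, hb.lie_t₀, smul_lie, lie_smul, ← add_smul, map_smul,
    Finsupp.smul_apply, smul_eq_mul, ← sub_eq_zero, ← sub_mul] at h1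
  refine (mul_eq_zero.1 h1).resolve_left fun h2 => h ?_
  have : (grade2 e : 𝕂) = (grade2 a : 𝕂) + (grade2 d : 𝕂) := by linear_combination (-2) * h2
  exact_mod_cast this

/-- The elements of `g` whose components all have twice their grade at most `c`. -/
def gradeLE (b : Module.Basis (Label s) 𝕂 g) (c : ℤ) : Submodule 𝕂 g where
  carrier := {x | ∀ a, c < grade2 a → b.repr x a = 0}
  zero_mem' := by simp
  add_mem' hx hy a ha := by simp [hx a ha, hy a ha]
  smul_mem' r x hx a ha := by simp [hx a ha]

theorem basis_mem_gradeLE (a : Label s) : b a ∈ gradeLE b (grade2 a) := by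
  classical
  intro d hd
  rw [b.repr_self, Finsupp.single_eq_of_ne]
  rintro rfl
  exact lt_irrefl _ hd

theorem IsMultipletBasis.lie_mem_gradeLE [Fintype ι] (hb : IsMultipletBasis t₀ tp tm b i₀)
    {c d : ℤ} {x y : g} (hx : x ∈ gradeLE b c) (hy : y ∈ gradeLE b d) :
    ⁅x, y⁆ ∈ gradeLE b (c + d) := by
  intro e he
  rw [← b.sum_repr x, ← b.sum_repr y]
  simp only [sum_lie, lie_sum, smul_lie, lie_smul, map_sum, map_smul, Finsupp.coe_finsetSum,
    Finset.sum_apply, Finsupp.smul_apply, smul_eq_mul]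
  refine Finset.sum_eq_zero fun a' _ => ?_
  by_cases h2 : d < grade2 a'
  · rw [hy _ h2, zero_mul]
  refine mul_eq_zero_of_right _ <| Finset.sum_eq_zero fun d' _ => ?_
  by_cases h1 : c < grade2 d'
  · simp [hx _ h1]
  · rw [hb.repr_lie_basis (by omega)]
    simp

theorem IsMultipletBasis.tp_mem (hb : IsMultipletBasis t₀ tp tm b i₀) : tp ∈ gradeLE b 2 := by
  have h : 2 < s i₀ + 1 := by rw [hb.spin_one]; omega
  have h1 := basis_mem_gradeLE (b := b) ⟨i₀, ⟨2, h⟩⟩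
  rw [← multipletVec_of_lt b h, hb.vec_two] at h1
  simpa [grade2, hb.spin_one] using h1

theorem IsMultipletBasis.tm_mem (hb : IsMultipletBasis t₀ tp tm b i₀) : tm ∈ gradeLE b (-2) := by
  have h : 0 < s i₀ + 1 := by omega
  have h1 := basis_mem_gradeLE (b := b) ⟨i₀, ⟨0, h⟩⟩
  rw [← multipletVec_of_lt b h, hb.vec_zero] at h1
  simpa [grade2, hb.spin_one] using h1

theorem IsMultipletBasis.t₀_mem (hb : IsMultipletBasis t₀ tp tm b i₀) : t₀ ∈ gradeLE b 0 := by
  have h : 1 < s i₀ + 1 := by rw [hb.spin_one]; omega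
  have h1 := basis_mem_gradeLE (b := b) ⟨i₀, ⟨1, h⟩⟩
  rw [← multipletVec_of_lt b h, hb.vec_one] at h1
  simpa [grade2, hb.spin_one] using h1

/-! ### The Killing form -/

theorem killingForm_invariant (x y z : g) :
    killingForm 𝕂 g ⁅x, y⁆ z = killingForm 𝕂 g x ⁅y, z⁆ :=
  LieModule.traceForm_apply_lie_apply 𝕂 g g x y z

theorem killingForm_symm (x y : g) : killingForm 𝕂 g x y = killingForm 𝕂 g y x :=
  LieModule.traceForm_comm 𝕂 g g x y

theorem killingForm_lie_left (x y z : g) :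
    killingForm 𝕂 g ⁅x, y⁆ z = -killingForm 𝕂 g y ⁅x, z⁆ := by
  rw [← lie_skew, map_neg, LinearMap.neg_apply, killingForm_invariant]

theorem killingForm_self_lie (x y : g) : killingForm 𝕂 g x ⁅y, x⁆ = 0 := by
  rw [← lie_skew, map_neg, ← killingForm_invariant, lie_self, map_zero, LinearMap.zero_apply,
    neg_zero]

/-- Invariance under `ad t₀` multiplies the pairing by the sum of the weights and gives zero. -/
theorem IsMultipletBasis.killingForm_basis (hb : IsMultipletBasis t₀ tp tm b i₀) {a d : Label s}
    (h : grade2 a + grade2 d ≠ 0) : killingForm 𝕂 g (b a) (b d) = 0 := by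
  have h1 := killingForm_lie_left (𝕂 := 𝕂) t₀ (b a) (b d)
  rw [hb.lie_t₀, hb.lie_t₀, map_smul, map_smul, LinearMap.smul_apply, smul_eq_mul, smul_eq_mul,
    ← sub_eq_zero, sub_neg_eq_add, ← add_mul] at h1
  refine (mul_eq_zero.1 h1).resolve_left fun h2 => h ?_
  have : (grade2 a : 𝕂) + (grade2 d : 𝕂) = 0 := by linear_combination 2 * h2
  exact_mod_cast this

theorem IsMultipletBasis.killingForm_gradeLE [Fintype ι] (hb : IsMultipletBasis t₀ tp tm b i₀)
    {c d : ℤ} (h : c + d < 0) {x y : g} (hx : x ∈ gradeLE b c) (hy : y ∈ gradeLE b d) :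
    killingForm 𝕂 g x y = 0 := by
  rw [← b.sum_repr x, ← b.sum_repr y]
  simp only [map_sum, map_smul, LinearMap.sum_apply, LinearMap.smul_apply, smul_eq_mul]
  refine Finset.sum_eq_zero fun a' _ => ?_
  by_cases h2 : d < grade2 a'
  · rw [hy _ h2, zero_mul]
  refine mul_eq_zero_of_right _ <| Finset.sum_eq_zero fun d' _ => ?_
  by_cases h1 : c < grade2 d'
  · simp [hx _ h1]
  · rw [hb.killingForm_basis (by omega), mul_zero]

/-- A vector that is not of highest weight is in the image of `ad t_-`. By invariance `t_-` moves to
the other factor, which it annihilates. -/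
theorem IsMultipletBasis.killingForm_lowest (ht : IsSl2Triple ((2 : 𝕂) • t₀) tp tm)
    (hb : IsMultipletBasis t₀ tp tm b i₀) {i i' : ι} {p : ℕ} (hp : p < s i) :
    killingForm 𝕂 g (multipletVec b i p) (multipletVec b i' 0) = 0 := by
  obtain ⟨cp, cm, hcp, hcm, hc⟩ := hb.exists_coeff ht
  have h := killingForm_lie_left (𝕂 := 𝕂) tm (multipletVec b i (p + 1)) (multipletVec b i' 0)
  rw [hcm, hb.lie_tm_lowest, map_zero, map_smul, LinearMap.smul_apply, neg_zero] at h
  exact (smul_eq_zero.1 h).resolve_left (coeff_ne_zero hc hp).2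

/-- The mirror argument: a vector that is not of lowest weight is in the image of `ad t_+`, which
annihilates highest weight vectors. -/
theorem IsMultipletBasis.killingForm_highest (ht : IsSl2Triple ((2 : 𝕂) • t₀) tp tm)
    (hb : IsMultipletBasis t₀ tp tm b i₀) {i i' : ι} {p : ℕ} (hp : p < s i') :
    killingForm 𝕂 g (multipletVec b i (s i)) (multipletVec b i' (p + 1)) = 0 := by
  obtain ⟨cp, cm, hcp, hcm, hc⟩ := hb.exists_coeff ht
  have h := killingForm_lie_left (𝕂 := 𝕂) tp (multipletVec b i (s i)) (multipletVec b i' p)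
  rw [hcp, hcp, multipletVec_of_gt b (lt_add_one _), smul_zero, map_zero, LinearMap.zero_apply,
    map_smul, eq_comm, neg_eq_zero] at h
  exact (smul_eq_zero.1 h).resolve_left (coeff_ne_zero hc hp).1

/-- The highest weight label of a multiplet. -/
def highest (s : ι → ℕ) (i : ι) : Label s := ⟨i, Fin.last (s i)⟩

theorem basis_lowest (i : ι) : b (lowest s i) = multipletVec b i 0 :=
  (multipletVec_val b i 0).symm

theorem basis_highest (i : ι) : b (highest s i) = multipletVec b i (s i) :=
  (multipletVec_of_lt b (by omega)).symm

/-- The image of `ad t_-` is the orthogonal complement of its kernel. -/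
theorem IsMultipletBasis.repr_highest_eq_zero_iff [Fintype ι] [LieAlgebra.IsKilling 𝕂 g]
    (ht : IsSl2Triple ((2 : 𝕂) • t₀) tp tm) (hb : IsMultipletBasis t₀ tp tm b i₀) (x : g) :
    (∀ i, b.repr x (highest s i) = 0) ↔
      ∀ i, killingForm 𝕂 g x (b (lowest s i)) = 0 := by
  have hlt : ∀ a : Label s, a ≠ highest s a.1 → (a.2 : ℕ) < s a.1 := by
    rintro ⟨i, p⟩ ha
    refine lt_of_le_of_ne (Nat.lt_succ_iff.1 p.2) fun h => ha ?_
    exact congrArg (Sigma.mk i) (Fin.ext h)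
  have hmain : ∀ x : g, (∀ i, b.repr x (highest s i) = 0) →
      ∀ i, killingForm 𝕂 g x (b (lowest s i)) = 0 := by
    intro x hx i
    rw [← b.sum_repr x]
    simp only [map_sum, map_smul, LinearMap.sum_apply, LinearMap.smul_apply]
    refine Finset.sum_eq_zero fun a _ => ?_
    by_cases ha : a = highest s a.1
    · rw [ha, hx, zero_smul]
    · have : killingForm 𝕂 g (b a) (b (lowest s i)) = 0 := by
        rw [basis_lowest, ← multipletVec_val b a.1 a.2]
        exact hb.killingForm_lowest ht (hlt a ha)
      rw [this, smul_zero]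
  refine ⟨hmain x, fun hx => ?_⟩
  classical
  -- The highest weight part of `x`. It is orthogonal to the lowest weight vectors because `x` and
  -- `x - h` are, and to all other basis vectors by `killingForm_highest`, so it is zero by
  -- nondegeneracy.
  let h : g := ∑ i, b.repr x (highest s i) • b (highest s i)
  have hrepr : ∀ i, b.repr h (highest s i) = b.repr x (highest s i) := by
    intro i
    have hinj : ∀ j, highest s j = highest s i ↔ j = i := fun j =>
      ⟨fun h => congrArg Sigma.fst h, fun h => h ▸ rfl⟩
    simp [h, Finsupp.single_apply, hinj]
  have h0 : ∀ i, killingForm 𝕂 g h (b (lowest s i)) = 0 := by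
    intro i
    have := hmain (x - h) (by simp [hrepr]) i
    rw [map_sub, LinearMap.sub_apply, hx, zero_sub, neg_eq_zero] at this
    exact this
  have hh : killingForm 𝕂 g h = 0 := by
    refine b.ext fun d => ?_
    by_cases hd : (d.2 : ℕ) = 0
    · have : d = lowest s d.1 := by
        obtain ⟨i, p⟩ := d
        exact congrArg (Sigma.mk i) (Fin.ext hd)
      rw [this]
      exact h0 _
    · obtain ⟨p, hp⟩ := Nat.exists_eq_succ_of_ne_zero hd
      simp only [h, map_sum, map_smul, LinearMap.sum_apply, LinearMap.smul_apply]
      refine Finset.sum_eq_zero fun i _ => ?_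
      have hd2 := d.2.2
      rw [basis_highest, ← multipletVec_val b d.1 d.2, hp, hb.killingForm_highest ht (by omega),
        smul_zero]
  have hz : h = 0 :=
    (LieAlgebra.IsKilling.killingForm_nondegenerate 𝕂 g).1 _ fun y => by rw [hh]; rfl
  intro i
  rw [← hrepr, hz]
  simp

/-- `ad t₀` is diagonal in the multiplet basis with real eigenvalues, so the trace of its square is
a sum of real squares, among them the weight `1` of `t_+`. Also over `ℂ` no cancellation can occur.
-/
theorem IsMultipletBasis.killingForm_t₀_ne_zero [Fintype ι]
    (hb : IsMultipletBasis t₀ tp tm b i₀) : killingForm 𝕂 g t₀ t₀ ≠ 0 := by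
  classical
  have h1 : killingForm 𝕂 g t₀ t₀ = ((∑ a : Label s, ((grade2 a : ℝ) / 2) ^ 2 : ℝ) : 𝕂) := by
    rw [killingForm_apply_apply, LinearMap.trace_eq_matrix_trace 𝕂 b, Matrix.trace]
    push_cast
    refine Finset.sum_congr rfl fun a _ => ?_
    rw [Matrix.diag_apply, LinearMap.toMatrix_apply]
    simp [hb.lie_t₀]
    ring
  rw [h1]
  have h2 : (0 : ℝ) < ∑ a : Label s, ((grade2 a : ℝ) / 2) ^ 2 := by
    refine Finset.sum_pos' (fun a _ => sq_nonneg _) ⟨highest s i₀, Finset.mem_univ _, ?_⟩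
    have : grade2 (highest s i₀) = 2 := by simp [grade2, highest, hb.spin_one]
    rw [this]
    norm_num
  exact_mod_cast h2.ne'

theorem IsMultipletBasis.killingForm_tp_tm (ht : IsSl2Triple ((2 : 𝕂) • t₀) tp tm)
    (hb : IsMultipletBasis t₀ tp tm b i₀) :
    killingForm 𝕂 g tp tm = 2 * killingForm 𝕂 g t₀ t₀ := by
  have h := killingForm_invariant (𝕂 := 𝕂) t₀ tp tm
  rwa [hb.lie_t₀_tp, lie_tp_tm ht, map_smul, smul_eq_mul] at h

end Multiplets


/-! ### The constrained loops and the gauge group. -/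

section Constrained

variable {𝕂 : Type*} [RCLike 𝕂] {g : Type*} [LieRing g] [LieAlgebra 𝕂 g]
  {ι : Type*} [Fintype ι] {s : ι → ℕ}
  {t₀ tp tm : g} {b : Module.Basis (Label s) 𝕂 g} {i₀ : ι}

/-- The loops whose components all have twice their grade at most `c`. -/
def loopLE (𝕂 : Type*) [RCLike 𝕂] {ι : Type*} (s : ι → ℕ) (c : ℤ) :
    Submodule 𝕂 (Loop 𝕂 (Label s)) where
  carrier := {x | ∀ a, c < grade2 a → x a = 0}
  zero_mem' := by simp
  add_mem' hx hy a ha := by simp [hx a ha, hy a ha]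
  smul_mem' r x hx a ha := by simp [hx a ha]

theorem mem_loopLE_iff_loopAt {c : ℤ} {x : Loop 𝕂 (Label s)} :
    x ∈ loopLE 𝕂 s c ↔ ∀ z, loopAt b z x ∈ gradeLE b c := by
  refine ⟨fun h z a ha => by rw [repr_loopAt, h a ha]; rfl, fun h a ha => circ_ext fun z => ?_⟩
  rw [← repr_loopAt b]
  exact h z a ha

theorem loopLE_mono {c d : ℤ} (h : c ≤ d) : loopLE 𝕂 s c ≤ loopLE 𝕂 s d :=
  fun _ hx a ha => hx a (h.trans_lt ha)

theorem dLoop_mem_loopLE {c : ℤ} {x : Loop 𝕂 (Label s)} (h : x ∈ loopLE 𝕂 s c) :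
    dLoop x ∈ loopLE 𝕂 s c := fun a ha => by rw [dLoop, h a ha, map_zero]

theorem circ_smul_mem_loopLE {c : ℤ} {x : Loop 𝕂 (Label s)} (f : SmoothCirc 𝕂)
    (h : x ∈ loopLE 𝕂 s c) : f • x ∈ loopLE 𝕂 s c := fun a ha => by
  rw [Pi.smul_apply, h a ha, smul_zero]

theorem constLoop_mem_loopLE {c : ℤ} {x : g} (h : x ∈ gradeLE b c) :
    constLoop b x ∈ loopLE 𝕂 s c :=
  mem_loopLE_iff_loopAt.2 fun z => by rwa [loopAt_constLoop]

theorem IsMultipletBasis.lieLoop_mem_loopLE (hb : IsMultipletBasis t₀ tp tm b i₀) {c d : ℤ}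
    {x y : Loop 𝕂 (Label s)} (hx : x ∈ loopLE 𝕂 s c) (hy : y ∈ loopLE 𝕂 s d) :
    lieLoop b x y ∈ loopLE 𝕂 s (c + d) :=
  mem_loopLE_iff_loopAt.2 fun z => by
    rw [loopAt_lieLoop]
    exact hb.lie_mem_gradeLE (mem_loopLE_iff_loopAt.1 hx z) (mem_loopLE_iff_loopAt.1 hy z)

theorem IsMultipletBasis.killLoop_loopLE (hb : IsMultipletBasis t₀ tp tm b i₀) {c d : ℤ}
    (h : c + d < 0) {x y : Loop 𝕂 (Label s)} (hx : x ∈ loopLE 𝕂 s c) (hy : y ∈ loopLE 𝕂 s d) :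
    killLoop b x y = 0 := circ_ext fun z => by
  rw [killLoop_at]
  exact hb.killingForm_gradeLE h (mem_loopLE_iff_loopAt.1 hx z) (mem_loopLE_iff_loopAt.1 hy z)

theorem mem_constrainedLoops_iff {y : Loop 𝕂 (Label s)} :
    y ∈ constrainedLoops b tp ↔ y - constLoop b tp ∈ loopLE 𝕂 s 0 := Iff.rfl

theorem exists_eq_add_of_mem_constrainedLoops {y : Loop 𝕂 (Label s)}
    (hy : y ∈ constrainedLoops b tp) : ∃ w ∈ loopLE 𝕂 s 0, y = constLoop b tp + w :=
  ⟨y - constLoop b tp, hy, by abel⟩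

/-- On loops `t_+ + w` the conformal vector field of `T^I` does not see `t_+`. -/
theorem IsMultipletBasis.hamiltonianVector_sugawaraGradient
    (hb : IsMultipletBasis t₀ tp tm b i₀) {k : 𝕂} (hk : k ≠ 0) (ε : SmoothCirc 𝕂)
    (w : Loop 𝕂 (Label s)) :
    hamiltonianVector b k (constLoop b tp + w)
        (sugawaraGradient b k t₀ ε (constLoop b tp + w)) =
      -(ε • dLoop w) - dz 𝕂 ε • (w - lieLoop b (constLoop b t₀) w) +
        k • ((dz 𝕂 ^ 2) ε • constLoop b t₀) := by
  rw [DSReduction.hamiltonianVector_sugawaraGradient b hk, dLoop_add, dLoop_constLoop, zero_add]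
  have : lieLoop b (constLoop b t₀) (constLoop b tp + w) =
      constLoop b tp + lieLoop b (constLoop b t₀) w :=
    loop_ext b fun z => by simp [hb.lie_t₀_tp]
  rw [this, add_sub_add_left_eq_sub]

/-- Once `t_+` has dropped out, the conformal vector is made of `w`, `∂w`, `[t₀, w]` and `t₀`, all
without components of positive grade. -/
theorem IsMultipletBasis.hasBracket_sugawara_constraint
    (hb : IsMultipletBasis t₀ tp tm b i₀) {k : 𝕂} (hk : k ≠ 0) (ε : SmoothCirc 𝕂)
    {y : Loop 𝕂 (Label s)} (hy : y ∈ constrainedLoops b tp) {a : Label s} (ha : 0 < grade2 a) :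
    HasBracket b k (smear ε (improvedSugawara b k t₀)) (constraint b tp a) y 0 := by
  obtain ⟨w, hw, rfl⟩ := exists_eq_add_of_mem_constrainedLoops hy
  refine hasBracket_constraint_iff.2 ⟨_, hasGradient_smear_improvedSugawara b k t₀ ε _, ?_⟩
  rw [hb.hamiltonianVector_sugawaraGradient hk]
  have h0 := constLoop_mem_loopLE (𝕂 := 𝕂) hb.t₀_mem
  have h : -(ε • dLoop w) - dz 𝕂 ε • (w - lieLoop b (constLoop b t₀) w) +
        k • ((dz 𝕂 ^ 2) ε • constLoop b t₀) ∈ loopLE 𝕂 s 0 := by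
    refine add_mem (sub_mem (neg_mem (circ_smul_mem_loopLE _ (dLoop_mem_loopLE hw)))
      (circ_smul_mem_loopLE _ (sub_mem hw ?_)))
      (Submodule.smul_mem _ _ (circ_smul_mem_loopLE _ h0))
    simpa using hb.lieLoop_mem_loopLE h0 hw
  exact h a ha

/-! ### Gauge invariance -/

theorem IsMultipletBasis.lieLoop_iterate_mem_loopLE (hb : IsMultipletBasis t₀ tp tm b i₀)
    {h x : Loop 𝕂 (Label s)} (hh : h ∈ loopLE 𝕂 s (-2)) {c : ℤ} (hx : x ∈ loopLE 𝕂 s c) (n : ℕ) :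
    (lieLoop b h)^[n] x ∈ loopLE 𝕂 s (c - 2 * n) := by
  induction n with
  | zero => simpa using hx
  | succ n ih =>
    rw [Function.iterate_succ_apply']
    have := hb.lieLoop_mem_loopLE hh ih
    have e : -2 + (c - 2 * (n : ℤ)) = c - 2 * ((n + 1 : ℕ) : ℤ) := by push_cast; ring
    rwa [e] at this

theorem exists_grade2_le (s : ι → ℕ) : ∃ C : ℕ, ∀ a : Label s, |grade2 a| ≤ C := by
  refine ⟨∑ a : Label s, (grade2 a).natAbs, fun a => ?_⟩
  rw [Int.abs_eq_natAbs]
  exact_mod_cast Finset.single_le_sum (f := fun a : Label s => (grade2 a).natAbs)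
    (fun _ _ => Nat.zero_le _) (Finset.mem_univ a)

/-- Bracketing with `h` lowers the grade by at least one, so `ad h` is nilpotent at each point. A
nilpotent endomorphism already vanishes at the power `dim g`, which is where the sum in
`gaugeAction` stops. -/
theorem IsMultipletBasis.lieLoop_iterate_eq_zero (hb : IsMultipletBasis t₀ tp tm b i₀)
    {h : Loop 𝕂 (Label s)} (hh : h ∈ loopLE 𝕂 s (-2)) (x : Loop 𝕂 (Label s)) :
    (lieLoop b h)^[Fintype.card (Label s)] x = 0 := by
  obtain ⟨C, hC⟩ := exists_grade2_le s
  have : FiniteDimensional 𝕂 g := Module.Finite.of_basis b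
  refine loop_ext b fun z => ?_
  have hit : ∀ n, loopAt b z ((lieLoop b h)^[n] x) =
      ((LieAlgebra.ad 𝕂 g (loopAt b z h)) ^ n) (loopAt b z x) := by
    intro n
    induction n with
    | zero => rfl
    | succ n ih => rw [Function.iterate_succ_apply', loopAt_lieLoop, ih, pow_succ']; rfl
  have hz := (mem_loopLE_iff_loopAt (b := b)).1 hh z
  have hn : ∀ n : ℕ, ∀ v ∈ gradeLE b (C : ℤ),
      ((LieAlgebra.ad 𝕂 g (loopAt b z h)) ^ n) v ∈ gradeLE b (C - 2 * n) := by
    intro n v hv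
    induction n with
    | zero => simpa using hv
    | succ n ih =>
      rw [pow_succ']
      have := hb.lie_mem_gradeLE hz ih
      have e : -2 + ((C : ℤ) - 2 * (n : ℤ)) = C - 2 * ((n + 1 : ℕ) : ℤ) := by push_cast; ring
      rwa [e] at this
  have htop : ∀ v, v ∈ gradeLE b (C : ℤ) := fun v a ha =>
    absurd ((le_abs_self _).trans (hC a)) (not_le.2 ha)
  -- Doubled grades lie in `[-C, C]`, and `C + 1` brackets push the bound to `C - 2 (C + 1) < -C`.
  have h0 : ((LieAlgebra.ad 𝕂 g (loopAt b z h)) ^ (C + 1)) (loopAt b z x) = 0 := by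
    apply b.ext_elem
    intro a
    rw [hn _ _ (htop _) a, map_zero]; · rfl
    have := (neg_abs_le _).trans' (neg_le_neg (hC a))
    push_cast
    omega
  rw [hit, map_zero, ← Module.finrank_eq_card_basis b]
  exact Module.End.ker_pow_le_ker_pow_finrank _ (C + 1) h0

theorem hasDerivAt_killLoop {P Q : ℝ → Loop 𝕂 (Label s)} {V W : Loop 𝕂 (Label s)} {t : ℝ} {z : ℝ}
    (hP : ∀ a, HasDerivAt (fun t => (P t a).1 z) ((V a).1 z) t)
    (hQ : ∀ a, HasDerivAt (fun t => (Q t a).1 z) ((W a).1 z) t) :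
    HasDerivAt (fun t => (killLoop b (P t) (Q t)).1 z)
      ((killLoop b V (Q t)).1 z + (killLoop b (P t) W).1 z) t := by
  simp only [killLoop, sum_at, smul_at, mul_at, ← Finset.sum_add_distrib, ← mul_add]
  exact HasDerivAt.fun_sum fun a _ => HasDerivAt.fun_sum fun d _ =>
    ((hP a).mul (hQ d)).const_mul _

theorem hasDerivAt_improvedSugawara {P : ℝ → Loop 𝕂 (Label s)} {V : Loop 𝕂 (Label s)} {t z : ℝ}
    (k : 𝕂) (hP : ∀ a, HasDerivAt (fun t => (P t a).1 z) ((V a).1 z) t)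
    (hP' : ∀ a, HasDerivAt (fun t => (dLoop (P t) a).1 z) ((dLoop V a).1 z) t) :
    HasDerivAt (fun t => (improvedSugawara b k t₀ (P t)).1 z)
      ((sugawaraDeriv b k t₀ (P t) V).1 z) t := by
  have h1 := (hasDerivAt_killLoop (b := b) hP hP).const_mul (1 / (2 * k))
  have h2 := hasDerivAt_killLoop (b := b) (P := fun _ => constLoop b t₀) (V := 0) (z := z)
    (fun a => hasDerivAt_const t _) hP'
  have h3 := h1.add h2
  refine HasDerivAt.congr_deriv h3 ?_
  rw [killLoop_comm b V]
  have h0 : (killLoop b (0 : Loop 𝕂 (Label s)) (dLoop (P t))).1 z = 0 := by simp [killLoop_at]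
  rw [h0]
  simp only [sugawaraDeriv, add_at, smul_at]
  by_cases hk : k = 0
  · simp [hk]
  · field_simp
    ring

/-- `T^I` does not change along infinitesimal gauge transformations of the constrained loops. -/
theorem IsMultipletBasis.sugawaraDeriv_gauge (hb : IsMultipletBasis t₀ tp tm b i₀) {k : 𝕂}
    (hk : k ≠ 0) {h y : Loop 𝕂 (Label s)} (hh : h ∈ loopLE 𝕂 s (-2))
    (hy : y ∈ constrainedLoops b tp) :
    sugawaraDeriv b k t₀ y (lieLoop b h y + k • dLoop h) = 0 := by
  obtain ⟨w, hw, rfl⟩ := exists_eq_add_of_mem_constrainedLoops hy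
  have h0 := constLoop_mem_loopLE (𝕂 := 𝕂) hb.t₀_mem
  have e1 : killLoop b (constLoop b tp + w) (lieLoop b h (constLoop b tp + w)) = 0 :=
    circ_ext fun z => by rw [killLoop_at, loopAt_lieLoop, killingForm_self_lie]; rfl
  have e2 : killLoop b w (dLoop h) = 0 :=
    hb.killLoop_loopLE (by norm_num) hw (dLoop_mem_loopLE hh)
  have e3 : killLoop b (constLoop b t₀) (dLoop (dLoop h)) = 0 :=
    hb.killLoop_loopLE (by norm_num) h0 (dLoop_mem_loopLE (dLoop_mem_loopLE hh))
  have e4 : killLoop b (lieLoop b (constLoop b t₀) h) w = 0 :=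
    hb.killLoop_loopLE (by norm_num) (hb.lieLoop_mem_loopLE h0 hh) hw
  have e5 : killLoop b (constLoop b t₀) (lieLoop b h (constLoop b tp + w)) =
      killLoop b (lieLoop b (constLoop b t₀) h) (constLoop b tp + w) :=
    circ_ext fun z => by simp only [killLoop_at, loopAt_lieLoop, killingForm_invariant]
  have e6 : killLoop b (lieLoop b (constLoop b t₀) h) (constLoop b tp) =
      -killLoop b (constLoop b tp) h := circ_ext fun z => by
    rw [neg_at, killLoop_at, killLoop_at, loopAt_lieLoop, loopAt_constLoop, loopAt_constLoop,
      killingForm_lie_left, hb.lie_t₀_tp, killingForm_symm]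
  -- The heart of the invariance: the improvement term contributes `∂([t₀, h], y) = -(t_+, ∂h)`,
  -- which cancels the only surviving part `(t_+, ∂h)` of the quadratic term. Everything else is
  -- zero by grading or by invariance of the form.
  have e7 : killLoop b (constLoop b t₀) (dLoop (lieLoop b h (constLoop b tp + w))) =
      -killLoop b (constLoop b tp) (dLoop h) := by
    have e0 : ∀ x : Loop 𝕂 (Label s), killLoop b 0 x = 0 := fun x =>
      circ_ext fun z => by simp [killLoop_at]
    have := congrArg (dz 𝕂) (e5.trans ((killLoop_add_right b _ _ _).trans
      (by rw [e4, e6, add_zero])))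
    rwa [dz_killLoop, dLoop_constLoop, map_neg, dz_killLoop, dLoop_constLoop, e0, e0, zero_add,
      zero_add] at this
  unfold sugawaraDeriv
  rw [dLoop_add, dLoop_smul, killLoop_add_right, killLoop_add_right, killLoop_smul_right,
    killLoop_smul_right, e1, e3, e7, killLoop_add_left, e2, zero_add, add_zero, smul_smul,
    one_div_mul_cancel hk, one_smul, smul_zero, add_zero, add_neg_cancel]

/-- The one-parameter family of gauge transforms by `exp (t h)`. -/
def gaugePath (b : Module.Basis (Label s) 𝕂 g) (k : 𝕂) (h y : Loop 𝕂 (Label s)) (t : ℝ) :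
    Loop 𝕂 (Label s) :=
  ∑ n ∈ Finset.range (Fintype.card (Label s)),
    (((t : 𝕂) ^ n / n.factorial) • (lieLoop b h)^[n] y +
      (k * ((t : 𝕂) ^ (n + 1) / (n + 1).factorial)) • (lieLoop b h)^[n] (dLoop h))

theorem gaugePath_one (k : 𝕂) (h y : Loop 𝕂 (Label s)) :
    gaugePath b k h y 1 = gaugeAction b k h y := by
  simp [gaugePath, gaugeAction]

theorem card_label_pos (s : ι → ℕ) (i₀ : ι) : 0 < Fintype.card (Label s) :=
  Fintype.card_pos_iff.2 ⟨lowest s i₀⟩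

theorem gaugePath_zero (i₀ : ι) (k : 𝕂) (h y : Loop 𝕂 (Label s)) : gaugePath b k h y 0 = y := by
  obtain ⟨N, hN⟩ := Nat.exists_eq_succ_of_ne_zero (card_label_pos s i₀).ne'
  rw [gaugePath, hN, Finset.sum_range_succ']
  simp

/-- All terms except `y` itself have grade at most `0`: `y` has grade at most `1` and each bracket
with `h` lowers it, while `∂h` starts in negative grade. -/
theorem IsMultipletBasis.gaugePath_mem (hb : IsMultipletBasis t₀ tp tm b i₀) (k : 𝕂)
    {h y : Loop 𝕂 (Label s)} (hh : h ∈ loopLE 𝕂 s (-2)) (hy : y ∈ constrainedLoops b tp)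
    (t : ℝ) : gaugePath b k h y t ∈ constrainedLoops b tp := by
  obtain ⟨N, hN⟩ := Nat.exists_eq_succ_of_ne_zero (card_label_pos s i₀).ne'
  have hy2 : y ∈ loopLE 𝕂 s 2 := by
    obtain ⟨w, hw, rfl⟩ := exists_eq_add_of_mem_constrainedLoops hy
    exact add_mem (constLoop_mem_loopLE hb.tp_mem) (loopLE_mono (by norm_num) hw)
  have hd : ∀ n : ℕ, (lieLoop b h)^[n] (dLoop h) ∈ loopLE 𝕂 s 0 := fun n =>
    loopLE_mono (by omega) (hb.lieLoop_iterate_mem_loopLE hh (dLoop_mem_loopLE hh) n)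
  rw [mem_constrainedLoops_iff] at hy ⊢
  rw [gaugePath, hN, Finset.sum_range_succ', Function.iterate_zero_apply,
    Function.iterate_zero_apply]
  have hsplit : ∀ p q : Loop 𝕂 (Label s),
      p + (((t : 𝕂) ^ 0 / (Nat.factorial 0)) • y + q) - constLoop b tp =
        p + (q + (y - constLoop b tp)) := by
    intro p q
    simp only [pow_zero, Nat.factorial_zero, Nat.cast_one, div_one, one_smul]
    abel
  rw [hsplit]
  refine add_mem (Submodule.sum_mem _ fun n _ => add_mem (Submodule.smul_mem _ _ ?_)
    (Submodule.smul_mem _ _ (hd _))) (add_mem (Submodule.smul_mem _ _ (hd 0)) hy)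
  exact loopLE_mono (by push_cast; omega) (hb.lieLoop_iterate_mem_loopLE hh hy2 (n + 1))

theorem hasDerivAt_ofReal_pow_div_factorial (n : ℕ) (t : ℝ) :
    HasDerivAt (fun t : ℝ => (t : 𝕂) ^ (n + 1) / (n + 1).factorial)
      ((t : 𝕂) ^ n / n.factorial) t := by
  have h : HasDerivAt (fun r : ℝ => (r : 𝕂)) 1 t := by
    simpa using (RCLike.ofRealCLM (K := 𝕂)).hasDerivAt (x := t)
  have h' := (h.pow (n + 1)).div_const ((n + 1).factorial : 𝕂)
  refine HasDerivAt.congr_deriv h' ?_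
  have h1 : (n.factorial : 𝕂) ≠ 0 := by exact_mod_cast n.factorial_ne_zero
  have h2 : (n : 𝕂) + 1 ≠ 0 := by exact_mod_cast n.succ_ne_zero
  rw [Nat.factorial_succ]
  push_cast
  field_simp

/-- The generator of the gauge flow. -/
theorem IsMultipletBasis.gaugePath_generator (hb : IsMultipletBasis t₀ tp tm b i₀) (k : 𝕂)
    {h : Loop 𝕂 (Label s)} (hh : h ∈ loopLE 𝕂 s (-2)) (y : Loop 𝕂 (Label s)) (t : ℝ) :
    lieLoop b h (gaugePath b k h y t) + k • dLoop h =
      ∑ n ∈ Finset.range (Fintype.card (Label s)),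
        ((if n = 0 then 0 else (t : 𝕂) ^ (n - 1) / (n - 1).factorial) • (lieLoop b h)^[n] y +
        (k * ((t : 𝕂) ^ n / n.factorial)) • (lieLoop b h)^[n] (dLoop h)) := by
  have e : ∀ x, (lieLoop b h)^[Fintype.card (Label s)] x = 0 := hb.lieLoop_iterate_eq_zero hh
  obtain ⟨N, hN⟩ := Nat.exists_eq_succ_of_ne_zero (card_label_pos s i₀).ne'
  rw [gaugePath, ← adLoop_apply, map_sum]
  simp only [map_add, map_smul, adLoop_apply, ← Function.iterate_succ_apply']
  rw [hN] at e ⊢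
  -- The bracket with `h` shifts the index by one. The top term dies by nilpotency, and `k ∂h` is
  -- the missing term of index `0`.
  rw [Finset.sum_range_succ, Finset.sum_range_succ' (n := N), e, e]
  simp only [smul_zero, add_zero, Nat.add_eq_zero_iff, one_ne_zero, and_false, if_false, if_true,
    Nat.add_sub_cancel, zero_smul, zero_add, pow_zero, Nat.factorial_zero, Nat.cast_one, div_one,
    mul_one, Function.iterate_zero_apply]

/-- The path is polynomial in `t`, so it can be differentiated after any linear functional `l`.
Arbitrary `l` covers at once the components of the loop and those of its derivative, both of which
enter `T^I`. -/
theorem IsMultipletBasis.hasDerivAt_gaugePath (hb : IsMultipletBasis t₀ tp tm b i₀) (k : 𝕂)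
    {h : Loop 𝕂 (Label s)} (hh : h ∈ loopLE 𝕂 s (-2)) (y : Loop 𝕂 (Label s)) (t : ℝ)
    (l : Loop 𝕂 (Label s) →ₗ[𝕂] 𝕂) :
    HasDerivAt (fun t => l (gaugePath b k h y t))
      (l (lieLoop b h (gaugePath b k h y t) + k • dLoop h)) t := by
  rw [hb.gaugePath_generator k hh]
  simp only [gaugePath, map_sum, map_add, map_smul, smul_eq_mul]
  refine HasDerivAt.fun_sum fun n _ => ?_
  refine HasDerivAt.add (HasDerivAt.mul_const ?_ _)
    (HasDerivAt.mul_const ((hasDerivAt_ofReal_pow_div_factorial n t).const_mul k) _)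
  rcases n with _ | n
  · simpa using hasDerivAt_const t (1 : 𝕂)
  · simpa using hasDerivAt_ofReal_pow_div_factorial n t

/-- The infinitesimal invariance holds at every point of the path, because the path never leaves the
constrained loops; hence `T^I` has the same value at `t = 0` and `t = 1`. -/
theorem IsMultipletBasis.improvedSugawara_gaugeAction (hb : IsMultipletBasis t₀ tp tm b i₀)
    {k : 𝕂} (hk : k ≠ 0) {h y : Loop 𝕂 (Label s)} (hh : h ∈ loopLE 𝕂 s (-2))
    (hy : y ∈ constrainedLoops b tp) :
    improvedSugawara b k t₀ (gaugeAction b k h y) = improvedSugawara b k t₀ y := by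
  refine circ_ext fun z => ?_
  have key : ∀ t, HasDerivAt
      (fun t => (improvedSugawara b k t₀ (gaugePath b k h y t)).1 z) 0 t := by
    intro t
    have h1 := hasDerivAt_improvedSugawara (b := b) (t₀ := t₀) (z := z)
      (P := gaugePath b k h y) (V := lieLoop b h (gaugePath b k h y t) + k • dLoop h) k
      (fun a => hb.hasDerivAt_gaugePath k hh y t
        ((evalAt 𝕂 z).toLinearMap ∘ₗ LinearMap.proj a))
      (fun a => hb.hasDerivAt_gaugePath k hh y t
        ((evalAt 𝕂 z).toLinearMap ∘ₗ
          (LinearMap.proj a : Loop 𝕂 (Label s) →ₗ[𝕂] SmoothCirc 𝕂) ∘ₗ dLoopₗ 𝕂 (Label s)))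
    rw [hb.sugawaraDeriv_gauge hk hh (hb.gaugePath_mem k hh hy t)] at h1
    exact h1
  have h2 := is_const_of_deriv_eq_zero (fun t => (key t).differentiableAt)
    (fun t => (key t).deriv) 1 0
  rwa [gaugePath_one, gaugePath_zero i₀] at h2

theorem mem_gaugeLoops_iff {h : Loop 𝕂 (Label s)} :
    h ∈ gaugeLoops 𝕂 s ↔ h ∈ loopLE 𝕂 s (-2) := Iff.rfl

end Constrained


/-! ### Inverting the constraint matrix on the lowest weight slice. -/

section Slice

variable {𝕂 : Type*} [RCLike 𝕂] {g : Type*} [LieRing g] [LieAlgebra 𝕂 g]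
  {ι : Type*} [Fintype ι] {s : ι → ℕ}
  {t₀ tp tm : g} {b : Module.Basis (Label s) 𝕂 g} {i₀ : ι}

theorem eq_lowest_of_val_eq_zero {a : Label s} (h : (a.2 : ℕ) = 0) : a = lowest s a.1 := by
  obtain ⟨i, p⟩ := a
  exact congrArg (Sigma.mk i) (Fin.ext h)

theorem eq_highest_of_not_lt {a : Label s} (h : ¬(a.2 : ℕ) < s a.1) : a = highest s a.1 := by
  obtain ⟨i, p⟩ := a
  have hp : (p : ℕ) < s i + 1 := p.2
  change ¬(p : ℕ) < s i at h
  exact congrArg (Sigma.mk i) (Fin.ext (show (p : ℕ) = s i by omega))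

/-- The label `(j, m + 1; μ)`. -/
def raiseLabel (a : Label s) (h : (a.2 : ℕ) < s a.1) : Label s := ⟨a.1, ⟨a.2 + 1, by omega⟩⟩

theorem grade2_raiseLabel (a : Label s) (h : (a.2 : ℕ) < s a.1) :
    grade2 (raiseLabel a h) = grade2 a + 2 := by
  simp only [grade2, raiseLabel]
  push_cast
  ring

theorem exists_eq_raiseLabel {a : Label s} (ha : (a.2 : ℕ) ≠ 0) :
    ∃ (d : Label s) (h : (d.2 : ℕ) < s d.1), a = raiseLabel d h := by
  obtain ⟨i, ⟨p, hp⟩⟩ := a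
  obtain ⟨q, rfl⟩ := Nat.exists_eq_succ_of_ne_zero ha
  exact ⟨⟨i, ⟨q, by omega⟩⟩, by simp only; omega, rfl⟩

/-- The inverse of `ad t_+` from the span of the non-lowest to the span of the non-highest weight
vectors, for given matrix elements of `ad t_+`. -/
def invRaise (cp : ι → ℕ → 𝕂) : Loop 𝕂 (Label s) →ₗ[𝕂] Loop 𝕂 (Label s) where
  toFun u a := if h : (a.2 : ℕ) < s a.1 then (cp a.1 a.2)⁻¹ • u (raiseLabel a h) else 0
  map_add' u v := by
    funext a
    by_cases h : (a.2 : ℕ) < s a.1 <;> simp [h]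
  map_smul' c u := by
    funext a
    by_cases h : (a.2 : ℕ) < s a.1 <;> simp [h, smul_comm c]

theorem invRaise_of_lt (cp : ι → ℕ → 𝕂) (u : Loop 𝕂 (Label s)) {a : Label s}
    (h : (a.2 : ℕ) < s a.1) : invRaise cp u a = (cp a.1 a.2)⁻¹ • u (raiseLabel a h) := dif_pos h

theorem invRaise_highest (cp : ι → ℕ → 𝕂) (u : Loop 𝕂 (Label s)) (i : ι) :
    invRaise cp u (highest s i) = 0 := dif_neg (by simp [highest])

theorem invRaise_mem_loopLE (cp : ι → ℕ → 𝕂) {u : Loop 𝕂 (Label s)} {c : ℤ}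
    (hu : u ∈ loopLE 𝕂 s c) : invRaise cp u ∈ loopLE 𝕂 s (c - 2) := by
  intro a ha
  by_cases h : (a.2 : ℕ) < s a.1
  · rw [invRaise_of_lt cp u h, hu _ (by rw [grade2_raiseLabel]; omega), smul_zero]
  · exact dif_neg h

theorem repr_lie_tp {cp : ι → ℕ → 𝕂}
    (hcp : ∀ i p, ⁅tp, multipletVec b i p⁆ = cp i p • multipletVec b i (p + 1)) (x : g)
    (a : Label s) (h : (a.2 : ℕ) < s a.1) :
    b.repr ⁅tp, x⁆ (raiseLabel a h) = cp a.1 a.2 * b.repr x a := by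
  classical
  have key : ∀ d : Label s, b.repr ⁅tp, b d⁆ (raiseLabel a h) =
      if d = a then cp a.1 a.2 else 0 := by
    intro d
    rw [← multipletVec_val b d.1 d.2, hcp]
    by_cases hd : (d.2 : ℕ) + 1 < s d.1 + 1
    · have e : multipletVec b d.1 ((d.2 : ℕ) + 1) = b (raiseLabel d (by omega)) :=
        multipletVec_of_lt b hd
      rw [e, map_smul, Finsupp.smul_apply, b.repr_self, Finsupp.single_apply]
      by_cases hda : d = a
      · subst hda
        simp
      · have : raiseLabel d (by omega) ≠ raiseLabel a h := by
          intro hr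
          apply hda
          obtain ⟨i, p⟩ := d
          obtain ⟨j, q⟩ := a
          simp only [raiseLabel, Sigma.mk.injEq] at hr
          obtain ⟨rfl, hr⟩ := hr
          have := Fin.mk.inj (eq_of_heq hr)
          exact congrArg (Sigma.mk i) (Fin.ext (by omega))
        simp [hda, this]
    · have hda : d ≠ a := by rintro rfl; omega
      rw [multipletVec_of_gt b (by omega), smul_zero]
      simp [hda]
  conv_lhs => rw [← b.sum_repr x]
  simp only [lie_sum, lie_smul, map_sum, map_smul, Finsupp.coe_finsetSum,
    Finset.sum_apply, Finsupp.smul_apply, smul_eq_mul, key, mul_ite, mul_zero,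
    Finset.sum_ite_eq', Finset.mem_univ, if_true]
  ring

/-- The perturbation of `ad t_+` in the operator `[t_+ + w, ·] - k ∂`. -/
def perturbation (b : Module.Basis (Label s) 𝕂 g) (cp : ι → ℕ → 𝕂) (k : 𝕂)
    (w : Loop 𝕂 (Label s)) : Module.End 𝕂 (Loop 𝕂 (Label s)) :=
  invRaise cp ∘ₗ (adLoop b w - k • dLoopₗ 𝕂 (Label s))

theorem perturbation_apply (cp : ι → ℕ → 𝕂) (k : 𝕂) (w X : Loop 𝕂 (Label s)) :
    perturbation b cp k w X = invRaise cp (hamiltonianVector b k w X) := rfl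

theorem hamiltonianVector_add_left (k : 𝕂) (y y' X : Loop 𝕂 (Label s)) :
    hamiltonianVector b k (y + y') X = lieLoop b y X + hamiltonianVector b k y' X := by
  rw [hamiltonianVector, lieLoop_add_left, hamiltonianVector, add_sub_assoc]

/-- At a raised label `ad t_+` contributes `cp` times the component before raising, so dividing by
`cp` puts the equation in fixed-point form. `invRaise` is zero at highest labels, so there the
fixed-point equation says precisely that `X` has no highest weight component. -/
theorem add_perturbation_eq_iff {cp : ι → ℕ → 𝕂}
    (hcp : ∀ i p, ⁅tp, multipletVec b i p⁆ = cp i p • multipletVec b i (p + 1))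
    (hne : ∀ i p, p < s i → cp i p ≠ 0) (k : 𝕂) (w X u : Loop 𝕂 (Label s)) :
    ((∀ i, X (highest s i) = 0) ∧ ∀ a : Label s, (a.2 : ℕ) ≠ 0 →
        hamiltonianVector b k (constLoop b tp + w) X a = u a) ↔
      X + perturbation b cp k w X = invRaise cp u := by
  have key : ∀ (a : Label s) (h : (a.2 : ℕ) < s a.1),
      hamiltonianVector b k (constLoop b tp + w) X (raiseLabel a h) =
        cp a.1 a.2 • X a + hamiltonianVector b k w X (raiseLabel a h) := by
    intro a h
    rw [hamiltonianVector_add_left, Pi.add_apply]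
    congr 1
    refine circ_ext fun z => ?_
    rw [← repr_loopAt b, loopAt_lieLoop, loopAt_constLoop, repr_lie_tp hcp, repr_loopAt, smul_at]
  have key2 : ∀ (a : Label s) (h : (a.2 : ℕ) < s a.1),
      hamiltonianVector b k (constLoop b tp + w) X (raiseLabel a h) = u (raiseLabel a h) ↔
      X a + perturbation b cp k w X a = invRaise cp u a := by
    intro a h
    have hc := hne a.1 a.2 h
    rw [key, perturbation_apply, invRaise_of_lt _ _ h, invRaise_of_lt _ _ h]
    constructor
    · intro hE
      rw [← hE, smul_add, smul_smul, inv_mul_cancel₀ hc, one_smul]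
    · intro hE
      have := congrArg (cp a.1 a.2 • ·) hE
      simpa only [smul_add, smul_smul, mul_inv_cancel₀ hc, one_smul] using this
  constructor
  · rintro ⟨h1, h2⟩
    funext a
    rw [Pi.add_apply]
    by_cases h : (a.2 : ℕ) < s a.1
    · exact (key2 a h).1 (h2 _ (Nat.succ_ne_zero _))
    · rw [eq_highest_of_not_lt h, h1, perturbation_apply, invRaise_highest, invRaise_highest,
        add_zero]
  · intro hE
    refine ⟨fun i => ?_, fun a ha => ?_⟩
    · have := congrFun hE (highest s i)
      rwa [Pi.add_apply, perturbation_apply, invRaise_highest, invRaise_highest, add_zero] at this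
    · obtain ⟨d, h, rfl⟩ := exists_eq_raiseLabel ha
      exact (key2 d h).2 (congrFun hE d)

/-- Neither `∂` nor the bracket with `w` raises the grade, and inverting `ad t_+` lowers it by one.
The exponent does not depend on `w`; `diracClosed` needs this, since one differential operator must
serve the whole slice. -/
theorem IsMultipletBasis.exists_perturbation_pow_eq_zero (hb : IsMultipletBasis t₀ tp tm b i₀)
    (cp : ι → ℕ → 𝕂) (k : 𝕂) :
    ∃ N, ∀ w ∈ loopLE 𝕂 s 0, perturbation b cp k w ^ N = 0 := by
  obtain ⟨C, hC⟩ := exists_grade2_le s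
  refine ⟨C + 1, fun w hw => LinearMap.ext fun X => ?_⟩
  have hn : ∀ n : ℕ, (perturbation b cp k w ^ n) X ∈ loopLE 𝕂 s (C - 2 * n) := by
    intro n
    induction n with
    | zero => exact fun a ha => absurd ((le_abs_self _).trans (hC a)) (by simpa using ha)
    | succ n ih =>
      rw [pow_succ', Module.End.mul_apply, perturbation_apply]
      have e : (C : ℤ) - 2 * ((n + 1 : ℕ) : ℤ) = C - 2 * n - 2 := by push_cast; ring
      rw [e]
      refine invRaise_mem_loopLE cp (sub_mem ?_ (Submodule.smul_mem _ _ (dLoop_mem_loopLE ih)))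
      simpa using hb.lieLoop_mem_loopLE hw ih
  funext a
  refine hn _ a ?_
  have := (neg_abs_le _).trans' (neg_le_neg (hC a))
  push_cast
  omega

/-- The finite geometric series in `-M` is a two-sided inverse of `1 + M`. -/
theorem add_apply_eq_iff_of_pow_eq_zero {V : Type*} [AddCommGroup V] [Module 𝕂 V]
    {M : Module.End 𝕂 V} {N : ℕ} (hN : M ^ N = 0) (x v : V) :
    x + M x = v ↔ x = ∑ n ∈ Finset.range N, (-1 : 𝕂) ^ n • (M ^ n) v := by
  have hN' : (-M) ^ N = 0 := by rw [neg_pow, hN, mul_zero]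
  have h1 := mul_neg_geom_sum (-M) N
  have h2 := geom_sum_mul_neg (-M) N
  rw [hN', sub_zero, sub_neg_eq_add] at h1 h2
  have e : ∑ n ∈ Finset.range N, (-1 : 𝕂) ^ n • (M ^ n) v =
      (∑ n ∈ Finset.range N, (-M) ^ n) v := by
    rw [LinearMap.sum_apply]
    refine Finset.sum_congr rfl fun n _ => ?_
    rw [← neg_one_smul 𝕂 M, smul_pow, LinearMap.smul_apply]
  constructor
  · intro h
    rw [e, ← h]
    exact (LinearMap.congr_fun h2 x).symm
  · rintro rfl
    rw [e]
    exact LinearMap.congr_fun h1 v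

/-- The solution of `X + M X = L u` for the nilpotent perturbation `M`. -/
def sliceSolution (b : Module.Basis (Label s) 𝕂 g) (cp : ι → ℕ → 𝕂) (k : 𝕂) (N : ℕ)
    (w u : Loop 𝕂 (Label s)) : Loop 𝕂 (Label s) :=
  ∑ n ∈ Finset.range N, (-1 : 𝕂) ^ n • (perturbation b cp k w ^ n) (invRaise cp u)

theorem add_perturbation_eq_iff_eq_sliceSolution {cp : ι → ℕ → 𝕂} {k : 𝕂} {N : ℕ}
    {w : Loop 𝕂 (Label s)} (hN : perturbation b cp k w ^ N = 0) (X u : Loop 𝕂 (Label s)) :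
    X + perturbation b cp k w X = invRaise cp u ↔ X = sliceSolution b cp k N w u :=
  add_apply_eq_iff_of_pow_eq_zero hN _ _

/-! ### The gauge slice -/

theorem mem_gaugeSlice_iff {y : Loop 𝕂 (Label s)} : y ∈ gaugeSlice b tp ↔
    ∀ a : Label s, (a.2 : ℕ) ≠ 0 → (y - constLoop b tp) a = 0 :=
  ⟨fun h a ha => h ⟨a, ha⟩, fun h a => h a.1 a.2⟩

/-- The loops in the span of the lowest weight vectors. -/
def lowestLoops (𝕂 : Type*) [RCLike 𝕂] {ι : Type*} (s : ι → ℕ) :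
    Submodule 𝕂 (Loop 𝕂 (Label s)) where
  carrier := {w | ∀ a : Label s, (a.2 : ℕ) ≠ 0 → w a = 0}
  zero_mem' := by simp
  add_mem' hx hy a ha := by simp [hx a ha, hy a ha]
  smul_mem' r x hx a ha := by simp [hx a ha]

theorem exists_eq_add_of_mem_gaugeSlice {y : Loop 𝕂 (Label s)} (hy : y ∈ gaugeSlice b tp) :
    ∃ w ∈ lowestLoops 𝕂 s, y = constLoop b tp + w :=
  ⟨y - constLoop b tp, mem_gaugeSlice_iff.1 hy, by abel⟩

theorem lowestLoops_le_loopLE : lowestLoops 𝕂 s ≤ loopLE 𝕂 s 0 := by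
  intro w hw a ha
  refine hw a fun h0 => ?_
  rw [grade2, h0] at ha
  push_cast at ha
  omega

/-- Extension by zero of a family indexed by the constraints. -/
def extendZero (v : NonLowest s → SmoothCirc 𝕂) : Loop 𝕂 (Label s) :=
  fun a => if h : (a.2 : ℕ) ≠ 0 then v ⟨a, h⟩ else 0

theorem extendZero_apply (v : NonLowest s → SmoothCirc 𝕂) (a : NonLowest s) :
    extendZero v a.1 = v a := dif_pos a.2

theorem extendZero_lowest (v : NonLowest s → SmoothCirc 𝕂) (i : ι) :
    extendZero v (lowest s i) = 0 := dif_neg (by simp [lowest])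

theorem sum_extendZero_mul (v : NonLowest s → SmoothCirc 𝕂) (η : Loop 𝕂 (Label s)) :
    ∑ d, extendZero v d * η d = ∑ a : NonLowest s, v a * η a.1 := by
  rw [← Fintype.sum_subtype_add_sum_subtype (fun a : Label s => (a.2 : ℕ) ≠ 0)]
  have h0 : ∑ a : {a : Label s // ¬(a.2 : ℕ) ≠ 0}, extendZero v a.1 * η a.1 = 0 :=
    Finset.sum_eq_zero fun a _ => by
      have : extendZero v a.1 = 0 := dif_neg a.2
      rw [this, zero_mul]
  rw [h0, add_zero]
  exact Finset.sum_congr rfl fun a _ => by rw [extendZero_apply]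

variable [LieAlgebra.IsKilling 𝕂 g]

theorem hasGradient_smearFamily_iff (v : NonLowest s → SmoothCirc 𝕂) (y X : Loop 𝕂 (Label s)) :
    HasGradient b (smearFamily (sliceConstraints b tp) v) y X ↔ lowerIndex b X = extendZero v := by
  refine hasGradient_iff b fun η => ?_
  have h : ∀ r : ℝ, smearFamily (sliceConstraints b tp) v (y + (r : 𝕂) • η) =
      smearFamily (sliceConstraints b tp) v y +
        (r : 𝕂) * circInt (∑ d, extendZero v d * η d) := by
    intro r
    rw [sum_extendZero_mul, circInt_sum, Finset.mul_sum, smearFamily, smearFamily,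
      ← Finset.sum_add_distrib]
    refine Finset.sum_congr rfl fun a _ => ?_
    rw [smear, smear, ← circInt_smul, ← circInt_add]
    congr 1
    simp only [sliceConstraints, constraint, current, Pi.add_apply, Pi.smul_apply, mul_sub,
      mul_add, mul_smul_comm]
    abel
  simp only [h]
  exact hasDerivAt_linear _ _

/-- Pointwise this is `repr_highest_eq_zero_iff`: a combination of the slice constraints has a
gradient whose lowered components vanish at the lowest labels, and these are its pairings with the
kernel of `ad t_-`. -/
theorem IsMultipletBasis.highest_eq_zero_iff (ht : IsSl2Triple ((2 : 𝕂) • t₀) tp tm)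
    (hb : IsMultipletBasis t₀ tp tm b i₀) (X : Loop 𝕂 (Label s)) :
    (∀ i, X (highest s i) = 0) ↔ ∃ v, lowerIndex b X = extendZero v := by
  have h1 : (∀ i, X (highest s i) = 0) ↔ ∀ i, lowerIndex b X (lowest s i) = 0 := by
    constructor
    · refine fun h i => circ_ext fun z => ?_
      rw [lowerIndex_at]
      refine (hb.repr_highest_eq_zero_iff ht _).1 (fun j => ?_) i
      rw [repr_loopAt, h j]; rfl
    · refine fun h i => circ_ext fun z => ?_
      rw [← repr_loopAt b]
      refine (hb.repr_highest_eq_zero_iff ht _).2 (fun j => ?_) i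
      rw [← lowerIndex_at, h j]; rfl
  rw [h1]
  constructor
  · refine fun h => ⟨fun a => lowerIndex b X a.1, funext fun a => ?_⟩
    by_cases ha : (a.2 : ℕ) ≠ 0
    · exact (extendZero_apply (fun a => lowerIndex b X a.1) ⟨a, ha⟩).symm
    · rw [eq_lowest_of_val_eq_zero (not_not.1 ha), h, extendZero_lowest]
  · rintro ⟨v, hv⟩ i
    rw [hv, extendZero_lowest]

theorem IsMultipletBasis.isSecondClassAt (ht : IsSl2Triple ((2 : 𝕂) • t₀) tp tm)
    (hb : IsMultipletBasis t₀ tp tm b i₀) (k : 𝕂) {y : Loop 𝕂 (Label s)}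
    (hy : y ∈ gaugeSlice b tp) : IsSecondClassAt b k (sliceConstraints b tp) y := by
  classical
  obtain ⟨w, hw, rfl⟩ := exists_eq_add_of_mem_gaugeSlice hy
  obtain ⟨cp, cm, hcp, -, hc⟩ := hb.exists_coeff ht
  obtain ⟨N, hN⟩ := hb.exists_perturbation_pow_eq_zero cp k
  have hne : ∀ i p, p < s i → cp i p ≠ 0 := fun i p hp => (coeff_ne_zero hc hp).1
  have hsol := fun X u => (add_perturbation_eq_iff hcp hne k w X u).trans
    (add_perturbation_eq_iff_eq_sliceSolution (hN w (lowestLoops_le_loopLE hw)) X u)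
  intro u
  set X := sliceSolution b cp k N w (extendZero u) with hX
  obtain ⟨h1, h2⟩ := (hsol X (extendZero u)).2 hX
  obtain ⟨v, hv⟩ := (hb.highest_eq_zero_iff ht X).1 h1
  refine ⟨v, fun β => hasBracket_constraint_iff.2
    ⟨X, (hasGradient_smearFamily_iff v _ X).2 hv, ?_⟩, fun v' hv' => ?_⟩
  · rw [h2 β.1 β.2, extendZero_apply]
  · obtain ⟨X', hX'⟩ := lowerIndex_surjective b (extendZero v')
    have h3 : X' = X := by
      refine (hsol X' (extendZero u)).1 ⟨(hb.highest_eq_zero_iff ht X').2 ⟨v', hX'⟩,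
        fun a ha => ?_⟩
      obtain ⟨Y, hY, hYu⟩ := hasBracket_constraint_iff.1 (hv' ⟨a, ha⟩)
      rw [hY.unique b ((hasGradient_smearFamily_iff v' _ X').2 hX')] at hYu
      rw [hYu]
      exact (extendZero_apply u ⟨a, ha⟩).symm
    funext a
    rw [← extendZero_apply v', ← extendZero_apply v, ← hX', ← hv, h3]

/-- The Dirac bracket, computed from the gradient of a functional and the compensating
combination of the constraints. -/
theorem IsMultipletBasis.hasDiracBracket_of (ht : IsSl2Triple ((2 : 𝕂) • t₀) tp tm)
    (hb : IsMultipletBasis t₀ tp tm b i₀) {k : 𝕂} {F : Loop 𝕂 (Label s) → 𝕂}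
    {G : Field 𝕂 (Loop 𝕂 (Label s))} {y X Y : Loop 𝕂 (Label s)} {B : SmoothCirc 𝕂}
    {DG : Loop 𝕂 (Label s) → SmoothCirc 𝕂}
    (hX : HasGradient b F y X) (hY : ∀ i, Y (highest s i) = 0)
    (hXY : ∀ a : Label s, (a.2 : ℕ) ≠ 0 →
      hamiltonianVector b k y Y a = hamiltonianVector b k y X a)
    (hG : ∀ V w, HasDerivAt (fun r : ℝ => (G (y + (r : 𝕂) • V)).1 w) ((DG V).1 w) 0)
    (hB : B = DG (hamiltonianVector b k y X) - DG (hamiltonianVector b k y Y)) :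
    HasDiracBracket b k (sliceConstraints b tp) F G y B := by
  obtain ⟨v, hv⟩ := (hb.highest_eq_zero_iff ht Y).1 hY
  have hv' := (hasGradient_smearFamily_iff (tp := tp) v y Y).2 hv
  exact ⟨fun a => hamiltonianVector b k y X a.1, v, _, _,
    fun β => hasBracket_constraint_iff.2 ⟨X, hX, rfl⟩,
    fun β => hasBracket_constraint_iff.2 ⟨Y, hv', hXY β.1 β.2⟩,
    ⟨X, hX, fun w => hG _ w⟩, ⟨Y, hv', fun w => hG _ w⟩, hB⟩

theorem hasDerivAt_current (a : Label s) (y V : Loop 𝕂 (Label s)) (w : ℝ) :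
    HasDerivAt (fun r : ℝ => (current 𝕂 a (y + (r : 𝕂) • V)).1 w) ((V a).1 w) 0 :=
  hasDerivAt_linear ((y a).1 w) ((V a).1 w)

end Slice

/-! ### Differential operators with coefficients in an algebra of fields. -/

section DifferentialOperators

variable {𝕂 : Type*} [RCLike 𝕂] {M : Type*}

theorem derivField_mem_fieldAlgebra {κ : Type*} (X : κ → Field 𝕂 M) {f : Field 𝕂 M}
    (hf : f ∈ fieldAlgebra X) : (fun y => dz 𝕂 (f y)) ∈ fieldAlgebra X := by
  induction hf using Algebra.adjoin_induction with
  | mem x hx =>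
    obtain ⟨p, rfl⟩ := hx
    refine Algebra.subset_adjoin ⟨(p.1, p.2 + 1), ?_⟩
    funext y
    exact dz_pow_succ_apply' _ _
  | algebraMap r =>
    have : (fun y => dz 𝕂 (algebraMap 𝕂 (Field 𝕂 M) r y)) = 0 := funext fun y => dz_algebraMap r
    rw [this]
    exact zero_mem _
  | add x y _ _ hx hy =>
    have : (fun z => dz 𝕂 ((x + y) z)) = (fun z => dz 𝕂 (x z)) + fun z => dz 𝕂 (y z) :=
      funext fun z => map_add _ _ _
    rw [this]
    exact add_mem hx hy
  | mul x y hx' hy' hx hy =>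
    have : (fun z => dz 𝕂 ((x * y) z)) = (fun z => dz 𝕂 (x z)) * y + x * fun z => dz 𝕂 (y z) :=
      funext fun z => dz_mul _ _
    rw [this]
    exact add_mem (mul_mem hx hy') (mul_mem hx' hy)

/-- Differential operators with coefficients in an algebra of fields. -/
def diffOps (W : Subalgebra 𝕂 (Field 𝕂 M)) : Submodule W (SmoothCirc 𝕂 → Field 𝕂 M) :=
  Submodule.span W (Set.range fun (n : ℕ) ε (_ : M) => (dz 𝕂 ^ n) ε)

variable {W : Subalgebra 𝕂 (Field 𝕂 M)}

theorem id_mem_diffOps : (fun ε (_ : M) => ε) ∈ diffOps W :=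
  Submodule.subset_span ⟨0, rfl⟩

theorem mul_mem_diffOps {f : Field 𝕂 M} (hf : f ∈ W) {Q : SmoothCirc 𝕂 → Field 𝕂 M}
    (hQ : Q ∈ diffOps W) : (fun ε y => f y * Q ε y) ∈ diffOps W :=
  Submodule.smul_mem _ (⟨f, hf⟩ : W) hQ

theorem smul_mem_diffOps (c : 𝕂) {Q : SmoothCirc 𝕂 → Field 𝕂 M} (hQ : Q ∈ diffOps W) :
    (fun ε y => c • Q ε y) ∈ diffOps W := by
  have := mul_mem_diffOps (W.algebraMap_mem c) hQ
  simpa [Algebra.smul_def] using this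

theorem sub_mem_diffOps {Q R : SmoothCirc 𝕂 → Field 𝕂 M} (hQ : Q ∈ diffOps W)
    (hR : R ∈ diffOps W) : (fun ε y => Q ε y - R ε y) ∈ diffOps W := by
  have h := add_mem hQ (smul_mem_diffOps (-1) hR)
  refine (congrArg (· ∈ diffOps W) ?_).mp h
  funext ε y
  simp only [Pi.add_apply, neg_smul, one_smul, sub_eq_add_neg]

/-- By the Leibniz rule the derivative also hits the coefficients, which is why `W` must be stable
under `∂`. -/
theorem dz_mem_diffOps (hW : ∀ f ∈ W, (fun y => dz 𝕂 (f y)) ∈ W) {Q : SmoothCirc 𝕂 → Field 𝕂 M}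
    (hQ : Q ∈ diffOps W) : (fun ε y => dz 𝕂 (Q ε y)) ∈ diffOps W := by
  induction hQ using Submodule.span_induction with
  | mem x hx =>
    obtain ⟨n, rfl⟩ := hx
    refine Submodule.subset_span ⟨n + 1, ?_⟩
    funext ε y
    exact dz_pow_succ_apply' _ _
  | zero =>
    have : (fun ε y => dz 𝕂 ((0 : SmoothCirc 𝕂 → Field 𝕂 M) ε y)) = 0 := by
      funext ε y; exact map_zero _
    rw [this]
    exact zero_mem _
  | add x y _ _ hx hy =>
    have : (fun ε z => dz 𝕂 ((x + y) ε z)) = (fun ε z => dz 𝕂 (x ε z)) + fun ε z =>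
        dz 𝕂 (y ε z) := by
      funext ε z; exact map_add _ _ _
    rw [this]
    exact add_mem hx hy
  | smul f x hx' hx =>
    have : (fun ε y => dz 𝕂 ((f • x) ε y)) =
        (fun ε y => dz 𝕂 (f.1 y) * x ε y) + fun ε y => f.1 y * dz 𝕂 (x ε y) := by
      funext ε y; exact dz_mul _ _
    rw [this]
    exact add_mem (mul_mem_diffOps (hW _ f.2) hx') (mul_mem_diffOps f.2 hx)

theorem exists_coeff_of_mem_diffOps {Q : SmoothCirc 𝕂 → Field 𝕂 M} (hQ : Q ∈ diffOps W) :
    ∃ (N : ℕ) (P : ℕ → W), ∀ ε y,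
      Q ε y = ∑ n ∈ Finset.range N, (dz 𝕂 ^ n) ε * (P n).1 y := by
  obtain ⟨c, rfl⟩ := (Finsupp.mem_span_range_iff_exists_finsupp).1 hQ
  -- One more than the largest order that occurs, since `Finset.range` omits its endpoint.
  refine ⟨c.support.sup id + 1, c, fun ε y => ?_⟩
  have h := Finsupp.sum_of_support_subset c (s := Finset.range (c.support.sup id + 1))
    (fun n hn => Finset.mem_range.2 (Nat.lt_succ_of_le (Finset.le_sup (f := id) hn)))
    (fun i a => a • fun ε (_ : M) => (dz 𝕂 ^ i) ε) (fun n _ => zero_smul _ _)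
  rw [h, Finset.sum_apply, Finset.sum_apply]
  exact Finset.sum_congr rfl fun n _ => mul_comm _ _

end DifferentialOperators

/-! ### Closure of the Dirac bracket on the lowest weight fields. -/

section DiracClosed

variable {𝕂 : Type*} [RCLike 𝕂] {g : Type*} [LieRing g] [LieAlgebra 𝕂 g]
  {ι : Type*} [Fintype ι] {s : ι → ℕ}
  {t₀ tp tm : g} {b : Module.Basis (Label s) 𝕂 g} {i₀ : ι}

/-- On the slice the other currents are constants, namely the components of `t_+`. -/
theorem current_mem_lowestFields (a : Label s) :
    restrictSlice b tp (current 𝕂 a) ∈ lowestFields b tp := by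
  by_cases ha : (a.2 : ℕ) = 0
  · rw [eq_lowest_of_val_eq_zero ha]
    exact Algebra.subset_adjoin ⟨(a.1, 0), rfl⟩
  · have : restrictSlice b tp (current 𝕂 a) = algebraMap 𝕂 _ (b.repr tp a) := by
      funext y
      exact sub_eq_zero.1 (mem_gaugeSlice_iff.1 y.2 a ha)
    rw [this]
    exact Subalgebra.algebraMap_mem _ _

/-- Loops that depend on a smooth function and a point of the slice by differential operators. -/
def IsDiffOpLoop (b : Module.Basis (Label s) 𝕂 g) (tp : g)
    (Q : SmoothCirc 𝕂 → gaugeSlice b tp → Loop 𝕂 (Label s)) : Prop :=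
  ∀ a, (fun ε y => Q ε y a) ∈ diffOps (lowestFields b tp)

theorem IsDiffOpLoop.sub {Q R : SmoothCirc 𝕂 → gaugeSlice b tp → Loop 𝕂 (Label s)}
    (hQ : IsDiffOpLoop b tp Q) (hR : IsDiffOpLoop b tp R) :
    IsDiffOpLoop b tp fun ε y => Q ε y - R ε y := fun a =>
  sub_mem_diffOps (hQ a) (hR a)

theorem IsDiffOpLoop.smul (c : 𝕂) {Q : SmoothCirc 𝕂 → gaugeSlice b tp → Loop 𝕂 (Label s)}
    (hQ : IsDiffOpLoop b tp Q) : IsDiffOpLoop b tp fun ε y => c • Q ε y :=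
  fun a => smul_mem_diffOps c (hQ a)

theorem IsDiffOpLoop.sum {N : ℕ}
    {Q : ℕ → SmoothCirc 𝕂 → gaugeSlice b tp → Loop 𝕂 (Label s)}
    (hQ : ∀ n, IsDiffOpLoop b tp (Q n)) :
    IsDiffOpLoop b tp fun ε y => ∑ n ∈ Finset.range N, Q n ε y := by
  intro a
  have : (fun ε y => (∑ n ∈ Finset.range N, Q n ε y) a) =
      ∑ n ∈ Finset.range N, fun ε y => Q n ε y a := by
    funext ε y
    simp only [Finset.sum_apply]
  rw [this]
  exact sum_mem fun n _ => hQ n a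

theorem IsDiffOpLoop.hamiltonianVector (k : 𝕂)
    {Q : SmoothCirc 𝕂 → gaugeSlice b tp → Loop 𝕂 (Label s)}
    {v : gaugeSlice b tp → Loop 𝕂 (Label s)} (hv : ∀ a, (fun y => v y a) ∈ lowestFields b tp)
    (hQ : IsDiffOpLoop b tp Q) :
    IsDiffOpLoop b tp fun ε y => hamiltonianVector b k (v y) (Q ε y) := by
  intro c
  refine sub_mem_diffOps ?_ (smul_mem_diffOps k (dz_mem_diffOps
    (fun f hf => derivField_mem_fieldAlgebra _ hf) (hQ c)))
  have : (fun ε y => lieLoop b (v y) (Q ε y) c) =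
      ∑ a, ∑ d, fun ε y => b.repr ⁅b a, b d⁆ c • (v y a * Q ε y d) := by
    funext ε y
    simp only [lieLoop, Finset.sum_apply]
  rw [this]
  exact sum_mem fun a _ => sum_mem fun d _ => smul_mem_diffOps _ (mul_mem_diffOps (hv a) (hQ d))

theorem IsDiffOpLoop.invRaise (cp : ι → ℕ → 𝕂)
    {Q : SmoothCirc 𝕂 → gaugeSlice b tp → Loop 𝕂 (Label s)} (hQ : IsDiffOpLoop b tp Q) :
    IsDiffOpLoop b tp fun ε y => invRaise cp (Q ε y) := by
  intro a
  by_cases h : (a.2 : ℕ) < s a.1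
  · simp only [invRaise_of_lt cp _ h]
    exact smul_mem_diffOps _ (hQ _)
  · rw [eq_highest_of_not_lt h]
    simp only [invRaise_highest]
    exact zero_mem _

/-- Each term of the Neumann series is obtained by repeating brackets with `v`, derivatives and
constant rescalings of components, and all of these preserve differential operators. -/
theorem IsDiffOpLoop.sliceSolution (cp : ι → ℕ → 𝕂) (k : 𝕂) (N : ℕ)
    {Q : SmoothCirc 𝕂 → gaugeSlice b tp → Loop 𝕂 (Label s)}
    {v : gaugeSlice b tp → Loop 𝕂 (Label s)} (hv : ∀ a, (fun y => v y a) ∈ lowestFields b tp)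
    (hQ : IsDiffOpLoop b tp Q) :
    IsDiffOpLoop b tp fun ε y => sliceSolution b cp k N (v y) (Q ε y) := by
  refine IsDiffOpLoop.sum fun n => IsDiffOpLoop.smul _ ?_
  induction n with
  | zero => exact hQ.invRaise cp
  | succ n ih =>
    simp only [pow_succ']
    exact (ih.hamiltonianVector k hv).invRaise cp

variable [LieAlgebra.IsKilling 𝕂 g]

theorem IsMultipletBasis.diracClosed (ht : IsSl2Triple ((2 : 𝕂) • t₀) tp tm)
    (hb : IsMultipletBasis t₀ tp tm b i₀) (k : 𝕂) (i₁ i₂ : ι) :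
    DiracClosed b tp k (lowestFields b tp) (current 𝕂 (lowest s i₁))
      (current 𝕂 (lowest s i₂)) := by
  classical
  obtain ⟨cp, cm, hcp, -, hc⟩ := hb.exists_coeff ht
  obtain ⟨N, hN⟩ := hb.exists_perturbation_pow_eq_zero cp k
  have hne : ∀ i p, p < s i → cp i p ≠ 0 := fun i p hp => (coeff_ne_zero hc hp).1
  obtain ⟨D, hD⟩ := lowerIndex_surjective b (Pi.single (lowest s i₁) (1 : SmoothCirc 𝕂))
  -- The lowered components of `D` are constant, so its value at any point, here `0`, is the
  -- Killing-dual of the lowest weight vector, and `ε d` is the gradient of the smeared current.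
  let d : g := loopAt b 0 D
  have hd : ∀ a, killingForm 𝕂 g d (b a) = if a = lowest s i₁ then 1 else 0 := by
    intro a
    rw [← lowerIndex_at, hD, Pi.single_apply]
    split_ifs <;> rfl
  let X : SmoothCirc 𝕂 → Loop 𝕂 (Label s) := fun ε => ε • constLoop b d
  have hgrad : ∀ ε y, HasGradient b (smear ε (current 𝕂 (lowest s i₁))) y (X ε) := by
    intro ε y
    refine (hasGradient_iff b (l := Pi.single (lowest s i₁) ε) fun η => ?_).2 ?_
    · rw [Finset.sum_eq_single (lowest s i₁) (fun e _ he => by simp [he]) (by simp),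
        Pi.single_eq_same]
      have h : ∀ r : ℝ, smear ε (current 𝕂 (lowest s i₁)) (y + (r : 𝕂) • η) =
          smear ε (current 𝕂 (lowest s i₁)) y + (r : 𝕂) * circInt (ε * η (lowest s i₁)) := by
        intro r
        rw [smear, smear, ← circInt_smul, ← circInt_add]
        congr 1
        simp only [current, Pi.add_apply, Pi.smul_apply, mul_add, mul_smul_comm]
      simp only [h]
      exact hasDerivAt_linear _ _
    · funext a
      refine circ_ext fun z => ?_
      rw [lowerIndex_at, loopAt_circ_smul, loopAt_constLoop, map_smul, LinearMap.smul_apply, hd,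
        Pi.single_apply]
      split_ifs <;> simp
  -- The gradient of the compensating constraints: its Hamiltonian vector cancels that of `X ε` in
  -- all non-lowest components, and the lowest components of the difference are the Dirac brackets.
  let Y : SmoothCirc 𝕂 → gaugeSlice b tp → Loop 𝕂 (Label s) := fun ε y =>
    sliceSolution b cp k N (y.1 - constLoop b tp) (hamiltonianVector b k y.1 (X ε))
  have hv1 : ∀ a, (fun y : gaugeSlice b tp => y.1 a) ∈ lowestFields b tp :=
    current_mem_lowestFields
  have hv2 : ∀ a, (fun y : gaugeSlice b tp => (y.1 - constLoop b tp) a) ∈ lowestFields b tp :=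
    fun a => sub_mem (hv1 a) ((lowestFields b tp).algebraMap_mem (b.repr tp a))
  have hX : IsDiffOpLoop b tp fun ε _ => X ε := by
    intro a
    have := smul_mem_diffOps (b.repr d a) (id_mem_diffOps (W := lowestFields b tp))
    refine (congrArg (· ∈ diffOps (lowestFields b tp)) ?_).mp this
    funext ε y
    simp only [X, Pi.smul_apply, constLoop, smul_eq_mul]
    rw [mul_comm, Algebra.smul_def]
  have hY : IsDiffOpLoop b tp Y :=
    IsDiffOpLoop.sliceSolution cp k N hv2 (hX.hamiltonianVector k hv1)
  have hB := (hX.hamiltonianVector k hv1).sub (hY.hamiltonianVector k hv1)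
  obtain ⟨n, P, hP⟩ := exists_coeff_of_mem_diffOps (hB (lowest s i₂))
  refine ⟨n, P, fun ε y => ?_⟩
  rw [← hP]
  have hw : y.1 - constLoop b tp ∈ lowestLoops 𝕂 s := mem_gaugeSlice_iff.1 y.2
  have hyw : constLoop b tp + (y.1 - constLoop b tp) = y.1 := by abel
  have hsol := (add_perturbation_eq_iff hcp hne k (y.1 - constLoop b tp) (Y ε y)
    (hamiltonianVector b k y.1 (X ε))).2 ((add_perturbation_eq_iff_eq_sliceSolution
      (hN _ (lowestLoops_le_loopLE hw)) _ _).2 rfl)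
  rw [hyw] at hsol
  exact hb.hasDiracBracket_of ht (hgrad ε y.1) hsol.1 hsol.2
    (fun V w => hasDerivAt_current _ _ V w) rfl

end DiracClosed


/-! ### Conformal transformations on the slice. -/

section Virasoro

variable {𝕂 : Type*} [RCLike 𝕂] {g : Type*} [LieRing g] [LieAlgebra 𝕂 g]
  {ι : Type*} [Fintype ι] {s : ι → ℕ}
  {t₀ tp tm : g} {b : Module.Basis (Label s) 𝕂 g} {i₀ : ι}

theorem IsMultipletBasis.basis_lowest_eq_tm (hb : IsMultipletBasis t₀ tp tm b i₀) :
    b (lowest s i₀) = tm := hb.eq_tm _ rfl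

theorem IsMultipletBasis.exists_label_tp (hb : IsMultipletBasis t₀ tp tm b i₀) :
    ∃ a : Label s, a.1 = i₀ ∧ (a.2 : ℕ) = 2 ∧ b a = tp := by
  have h : 2 < s i₀ + 1 := by rw [hb.spin_one]; omega
  exact ⟨⟨i₀, ⟨2, h⟩⟩, rfl, rfl, hb.eq_tp _ rfl⟩

theorem IsMultipletBasis.repr_tp_lowest (hb : IsMultipletBasis t₀ tp tm b i₀) (i : ι) :
    b.repr tp (lowest s i) = 0 := by
  classical
  obtain ⟨a, -, ha, rfl⟩ := hb.exists_label_tp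
  rw [b.repr_self, Finsupp.single_eq_of_ne]
  rintro rfl
  simp [lowest] at ha

theorem IsMultipletBasis.constLoop_tp_lowest (hb : IsMultipletBasis t₀ tp tm b i₀) (i : ι) :
    constLoop b tp (lowest s i) = 0 := by
  rw [constLoop, hb.repr_tp_lowest, map_zero]

theorem IsMultipletBasis.repr_tm (hb : IsMultipletBasis t₀ tp tm b i₀) [DecidableEq (Label s)]
    (a : Label s) : b.repr tm a = if a = lowest s i₀ then 1 else 0 := by
  rw [← hb.basis_lowest_eq_tm, b.repr_self, Finsupp.single_apply]
  simp only [eq_comm]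

theorem loopAt_lowest {w : Loop 𝕂 (Label s)} (hw : w ∈ lowestLoops 𝕂 s) (z : ℝ) :
    loopAt b z w = ∑ i, (w (lowest s i)).1 z • b (lowest s i) := by
  rw [loopAt_apply, Fintype.sum_sigma]
  refine Finset.sum_congr rfl fun i _ => ?_
  refine Finset.sum_eq_single (0 : Fin (s i + 1)) (fun p _ hp => ?_) (by simp)
  rw [hw ⟨i, p⟩ (fun h => hp (Fin.ext h))]
  exact zero_smul _ _

theorem IsMultipletBasis.lie_loopAt_tm (hb : IsMultipletBasis t₀ tp tm b i₀)
    {w : Loop 𝕂 (Label s)} (hw : w ∈ lowestLoops 𝕂 s) (z : ℝ) : ⁅loopAt b z w, tm⁆ = 0 := by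
  rw [← lie_skew, loopAt_lowest hw, lie_sum, neg_eq_zero]
  exact Finset.sum_eq_zero fun i _ => by rw [lie_smul, hb.lower_lowest, smul_zero]

/-- The vectors in question are `t_-` and `t₀`, which lie in the image of `ad t_-` and so are
orthogonal to its kernel. -/
theorem IsMultipletBasis.killingForm_loopAt_lowest (ht : IsSl2Triple ((2 : 𝕂) • t₀) tp tm)
    (hb : IsMultipletBasis t₀ tp tm b i₀) {p : ℕ} (hp : p < 2) {w : Loop 𝕂 (Label s)}
    (hw : w ∈ lowestLoops 𝕂 s) (z : ℝ) :
    killingForm 𝕂 g (multipletVec b i₀ p) (loopAt b z w) = 0 := by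
  rw [loopAt_lowest hw, map_sum]
  refine Finset.sum_eq_zero fun i _ => ?_
  rw [map_smul, basis_lowest, hb.killingForm_lowest ht (by rw [hb.spin_one]; exact hp), smul_zero]

theorem dLoop_mem_lowestLoops {w : Loop 𝕂 (Label s)} (hw : w ∈ lowestLoops 𝕂 s) :
    dLoop w ∈ lowestLoops 𝕂 s := fun a ha => by rw [dLoop, hw a ha, map_zero]

theorem circ_smul_mem_lowestLoops (f : SmoothCirc 𝕂) {w : Loop 𝕂 (Label s)}
    (hw : w ∈ lowestLoops 𝕂 s) : f • w ∈ lowestLoops 𝕂 s := fun a ha => by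
  rw [Pi.smul_apply, hw a ha, smul_zero]

theorem IsMultipletBasis.lieLoop_t₀ (hb : IsMultipletBasis t₀ tp tm b i₀)
    (w : Loop 𝕂 (Label s)) (a : Label s) :
    lieLoop b (constLoop b t₀) w a = ((grade2 a : 𝕂) / 2) • w a := circ_ext fun z => by
  rw [← repr_loopAt b, loopAt_lieLoop, loopAt_constLoop, hb.repr_lie_t₀, repr_loopAt, smul_at]

theorem IsMultipletBasis.constLoop_tm_mem (hb : IsMultipletBasis t₀ tp tm b i₀) :
    constLoop b tm ∈ lowestLoops 𝕂 s := fun a ha => by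
  classical
  rw [constLoop, hb.repr_tm, if_neg, map_zero]
  rintro rfl
  exact ha rfl

/-- The variation of a loop `t_+ + w` in the slice generated by `∫ ε T^I` and the Dirac bracket. -/
def conformalVector (b : Module.Basis (Label s) 𝕂 g) (t₀ tm : g) (k : 𝕂) (ε : SmoothCirc 𝕂)
    (w : Loop 𝕂 (Label s)) : Loop 𝕂 (Label s) :=
  -(ε • dLoop w) - dz 𝕂 ε • (w - lieLoop b (constLoop b t₀) w) +
    (k ^ 2 / 2) • ((dz 𝕂 ^ 3) ε • constLoop b tm)

theorem IsMultipletBasis.conformalVector_mem (hb : IsMultipletBasis t₀ tp tm b i₀) (k : 𝕂)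
    (ε : SmoothCirc 𝕂) {w : Loop 𝕂 (Label s)} (hw : w ∈ lowestLoops 𝕂 s) :
    conformalVector b t₀ tm k ε w ∈ lowestLoops 𝕂 s := by
  refine add_mem (sub_mem (neg_mem (circ_smul_mem_lowestLoops _ (dLoop_mem_lowestLoops hw)))
    (circ_smul_mem_lowestLoops _ (sub_mem hw fun a ha => ?_)))
    (Submodule.smul_mem _ _ (circ_smul_mem_lowestLoops _ hb.constLoop_tm_mem))
  rw [hb.lieLoop_t₀, hw a ha, smul_zero]

/-- The gradient of the combination of constraints that compensates `∫ ε T^I`. -/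
def compensator (b : Module.Basis (Label s) 𝕂 g) (tm : g) (k : 𝕂) (ε : SmoothCirc 𝕂) :
    Loop 𝕂 (Label s) := (k / 2) • ((dz 𝕂 ^ 2) ε • constLoop b tm)

theorem IsMultipletBasis.compensator_highest (hb : IsMultipletBasis t₀ tp tm b i₀) (k : 𝕂)
    (ε : SmoothCirc 𝕂) (i : ι) : compensator b tm k ε (highest s i) = 0 := by
  classical
  have h : highest s i ≠ lowest s i₀ := by
    intro h
    have h1 : i = i₀ := congrArg Sigma.fst h
    subst h1
    have h2 := congrArg (fun a : Label s => (a.2 : ℕ)) h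
    have := hb.spin_one
    simp [highest, lowest] at h2
    omega
  have h2 : constLoop b tm (highest s i) = 0 := by
    rw [constLoop, hb.repr_tm, if_neg h, map_zero]
  rw [compensator, Pi.smul_apply, Pi.smul_apply, h2, smul_zero, smul_zero]

/-- Since `[w, t_-] = 0` and `[t_+, t_-] = 2 t₀`, the compensator reproduces exactly the term `k ε''
t₀`. Its own derivative leaves the `ε'''` term, the source of both central terms. -/
theorem IsMultipletBasis.hamiltonianVector_sub_compensator
    (ht : IsSl2Triple ((2 : 𝕂) • t₀) tp tm) (hb : IsMultipletBasis t₀ tp tm b i₀) {k : 𝕂}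
    (hk : k ≠ 0) (ε : SmoothCirc 𝕂) {w : Loop 𝕂 (Label s)} (hw : w ∈ lowestLoops 𝕂 s) :
    hamiltonianVector b k (constLoop b tp + w)
        (sugawaraGradient b k t₀ ε (constLoop b tp + w)) -
      hamiltonianVector b k (constLoop b tp + w) (compensator b tm k ε) =
    conformalVector b t₀ tm k ε w := by
  rw [hb.hamiltonianVector_sugawaraGradient hk]
  have h : hamiltonianVector b k (constLoop b tp + w) (compensator b tm k ε) =
      k • ((dz 𝕂 ^ 2) ε • constLoop b t₀) -
        (k ^ 2 / 2) • ((dz 𝕂 ^ 3) ε • constLoop b tm) := by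
    refine loop_ext b fun z => ?_
    simp only [hamiltonianVector, compensator, dLoop_smul, dLoop_circ_smul, dLoop_constLoop,
      map_sub, map_add, map_smul, loopAt_lieLoop, loopAt_circ_smul, loopAt_constLoop, add_lie,
      lie_smul, hb.lie_loopAt_tm hw, lie_tp_tm ht, smul_zero, add_zero,
      dz_pow_succ_apply' 2]
    module
  rw [h, conformalVector]
  abel

variable [LieAlgebra.IsKilling 𝕂 g]

/-- The corrected vector lies in the span of the lowest weight vectors, so the two Hamiltonian
vectors agree at every non-lowest label, as `hasDiracBracket_of` requires. -/
theorem IsMultipletBasis.hasDiracBracket_sugawara (ht : IsSl2Triple ((2 : 𝕂) • t₀) tp tm)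
    (hb : IsMultipletBasis t₀ tp tm b i₀) {k : 𝕂} (hk : k ≠ 0) (ε : SmoothCirc 𝕂)
    {G : Field 𝕂 (Loop 𝕂 (Label s))} {w : Loop 𝕂 (Label s)} (hw : w ∈ lowestLoops 𝕂 s)
    (DG : Loop 𝕂 (Label s) →+ SmoothCirc 𝕂)
    (hG : ∀ V z, HasDerivAt (fun r : ℝ => (G (constLoop b tp + w + (r : 𝕂) • V)).1 z)
      ((DG V).1 z) 0) :
    HasDiracBracket b k (sliceConstraints b tp) (smear ε (improvedSugawara b k t₀)) G
      (constLoop b tp + w) (DG (conformalVector b t₀ tm k ε w)) := by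
  have h := hb.hamiltonianVector_sub_compensator ht hk ε hw
  refine hb.hasDiracBracket_of ht (hasGradient_smear_improvedSugawara b k t₀ ε _)
    (hb.compensator_highest k ε) (fun a ha => ?_) hG ?_
  · have h1 := hb.conformalVector_mem k ε hw a ha
    rw [← h, Pi.sub_apply, sub_eq_zero] at h1
    exact h1.symm
  · rw [← map_sub, h]

/-- `ad t₀` acts by `-j` on a lowest weight component, so `w - [t₀, w]` contributes the factor `1 +
j`; the central term is the component along `t_-`. -/
theorem IsMultipletBasis.hasDiracBracket_sugawara_current
    (ht : IsSl2Triple ((2 : 𝕂) • t₀) tp tm)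
    (hb : IsMultipletBasis t₀ tp tm b i₀) {k : 𝕂} (hk : k ≠ 0) (i : ι) {c : 𝕂}
    (hc : (k ^ 2 / 2) * b.repr tm (lowest s i) = c) :
    TransformsWith b tp k (improvedSugawara b k t₀) (current 𝕂 (lowest s i))
      ((s i : 𝕂) / 2 + 1) c := by
  intro ε y hy
  obtain ⟨w, hw, rfl⟩ := exists_eq_add_of_mem_gaugeSlice hy
  have h := hb.hasDiracBracket_sugawara ht hk ε hw (G := current 𝕂 (lowest s i))
    (Pi.evalAddMonoidHom _ (lowest s i)) (fun V z => hasDerivAt_current _ _ V z)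
  have e : (Pi.evalAddMonoidHom (fun _ => SmoothCirc 𝕂) (lowest s i))
      (conformalVector b t₀ tm k ε w) =
      -(ε * dz 𝕂 (current 𝕂 (lowest s i) (constLoop b tp + w)) + ((s i : 𝕂) / 2 + 1) •
        (dz 𝕂 ε * current 𝕂 (lowest s i) (constLoop b tp + w))) + c • (dz 𝕂 ^ 3) ε := by
    rw [current, Pi.add_apply, hb.constLoop_tp_lowest, zero_add, Pi.evalAddMonoidHom_apply,
      ← hc]
    simp only [conformalVector, Pi.add_apply, Pi.sub_apply, Pi.neg_apply, Pi.smul_apply,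
      hb.lieLoop_t₀, dLoop, constLoop]
    refine circ_ext fun z => ?_
    simp only [add_at, sub_at, neg_at, smul_at, mul_at, smul_eq_mul, algebraMap_at, grade2,
      lowest]
    push_cast
    simp only [Fin.val_zero, Nat.cast_zero]
    ring
  rwa [e] at h

/-- The terms `(t_+, t_+)` and `(t₀, ∂w)` vanish, the first by grading, the second because `t₀` is
orthogonal to lowest weight vectors. -/
theorem IsMultipletBasis.improvedSugawara_slice (ht : IsSl2Triple ((2 : 𝕂) • t₀) tp tm)
    (hb : IsMultipletBasis t₀ tp tm b i₀) {k : 𝕂} (hk : k ≠ 0) {w : Loop 𝕂 (Label s)}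
    (hw : w ∈ lowestLoops 𝕂 s) :
    improvedSugawara b k t₀ (constLoop b tp + w) =
      (1 / k) • killLoop b (constLoop b tp) w + (1 / (2 * k)) • killLoop b w w := by
  refine circ_ext fun z => ?_
  have h1 : killingForm 𝕂 g tp tp = 0 := by
    obtain ⟨a, h1, h2, h3⟩ := hb.exists_label_tp
    rw [← h3]
    apply hb.killingForm_basis
    have := hb.spin_one
    rw [grade2, h2, h1, this]
    norm_num
  have h2 := hb.killingForm_loopAt_lowest ht one_lt_two (dLoop_mem_lowestLoops hw) z
  rw [hb.vec_one] at h2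
  simp only [improvedSugawara, add_at, smul_at, killLoop_at, loopAt_constLoop, dLoop_add,
    dLoop_constLoop, map_add, LinearMap.add_apply, h1, h2, killingForm_symm (loopAt b z w) tp,
    zero_add, add_zero]
  field_simp
  ring

/-- The derivative of `T^I` at `y` as an additive map. -/
def sugawaraDerivHom (b : Module.Basis (Label s) 𝕂 g) (k : 𝕂) (t₀ : g)
    (y : Loop 𝕂 (Label s)) : Loop 𝕂 (Label s) →+ SmoothCirc 𝕂 :=
  AddMonoidHom.mk' (sugawaraDeriv b k t₀ y) fun x x' => by
    simp only [sugawaraDeriv, killLoop_add_right, dLoop_add, smul_add]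
    abel

/-- Both terms of `T^I` on the slice have weight `2`: `(t_+, [t₀, w]) = -(t_+, w)` for the linear
one, and `(w, [t₀, w]) = 0` for the quadratic one. The central term is `(1/k) (k²/2) (t_+, t_-)`
with `(t_+, t_-) = 2 (t₀, t₀)`. -/
theorem IsMultipletBasis.transformsWith_sugawara (ht : IsSl2Triple ((2 : 𝕂) • t₀) tp tm)
    (hb : IsMultipletBasis t₀ tp tm b i₀) {k : 𝕂} (hk : k ≠ 0) :
    TransformsWith b tp k (improvedSugawara b k t₀) (improvedSugawara b k t₀) 2
      (k * killingForm 𝕂 g t₀ t₀) := by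
  intro ε y hy
  obtain ⟨w, hw, rfl⟩ := exists_eq_add_of_mem_gaugeSlice hy
  have h := hb.hasDiracBracket_sugawara ht hk ε hw (G := improvedSugawara b k t₀)
    (sugawaraDerivHom b k t₀ (constLoop b tp + w))
    (fun V z => improvedSugawara_hasDerivAt b k t₀ _ V z)
  have e : sugawaraDerivHom b k t₀ (constLoop b tp + w) (conformalVector b t₀ tm k ε w) =
      -(ε * dz 𝕂 (improvedSugawara b k t₀ (constLoop b tp + w)) + (2 : 𝕂) •
        (dz 𝕂 ε * improvedSugawara b k t₀ (constLoop b tp + w))) +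
        (k * killingForm 𝕂 g t₀ t₀) • (dz 𝕂 ^ 3) ε := by
    rw [hb.improvedSugawara_slice ht hk hw]
    refine circ_ext fun z => ?_
    have h1 := hb.killingForm_loopAt_lowest ht one_lt_two
      (dLoop_mem_lowestLoops (hb.conformalVector_mem k ε hw)) z
    have h2 := hb.killingForm_loopAt_lowest ht two_pos hw z
    rw [hb.vec_one] at h1
    rw [hb.vec_zero, killingForm_symm] at h2
    have h3 : killingForm 𝕂 g tp ⁅t₀, loopAt b z w⁆ = -killingForm 𝕂 g tp (loopAt b z w) := by
      rw [← killingForm_invariant, ← lie_skew, hb.lie_t₀_tp, map_neg, LinearMap.neg_apply]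
    have h4 := killingForm_self_lie (𝕂 := 𝕂) (loopAt b z w) t₀
    have h5 := hb.killingForm_tp_tm ht
    have h6 := killingForm_symm (𝕂 := 𝕂) (loopAt b z (dLoop w)) (loopAt b z w)
    have hd : dz 𝕂 ((1 / k) • killLoop b (constLoop b tp) w + (1 / (2 * k)) • killLoop b w w) =
        (1 / k) • killLoop b (constLoop b tp) (dLoop w) + (1 / k) • killLoop b w (dLoop w) := by
      rw [map_add, map_smul, map_smul, dz_killLoop, dz_killLoop, dLoop_constLoop,
        killLoop_comm b (dLoop w) w]
      refine circ_ext fun z => ?_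
      simp only [add_at, smul_at, killLoop_at, map_zero, LinearMap.zero_apply, zero_add]
      field_simp
      ring
    rw [hd]
    change (sugawaraDeriv b k t₀ (constLoop b tp + w) (conformalVector b t₀ tm k ε w)).1 z = _
    rw [sugawaraDeriv]
    simp only [add_at, smul_at, neg_at, mul_at, killLoop_at, loopAt_constLoop, h1, add_zero]
    simp only [conformalVector, map_add, map_sub, map_neg, map_smul, loopAt_circ_smul,
      loopAt_lieLoop, loopAt_constLoop, LinearMap.add_apply, smul_eq_mul, h2, h3, h4, h5]
    field_simp
    ring
  rwa [e] at h

theorem IsMultipletBasis.isPrimary_current (ht : IsSl2Triple ((2 : 𝕂) • t₀) tp tm)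
    (hb : IsMultipletBasis t₀ tp tm b i₀) {k : 𝕂} (hk : k ≠ 0) {i : ι} (hi : i ≠ i₀) :
    IsPrimary b tp k (improvedSugawara b k t₀) (current 𝕂 (lowest s i))
      ((s i : 𝕂) / 2 + 1) := by
  classical
  refine hb.hasDiracBracket_sugawara_current ht hk i ?_
  rw [hb.repr_tm, if_neg fun h => hi (congrArg Sigma.fst h), mul_zero]

theorem IsMultipletBasis.transformsWith_current_tm (ht : IsSl2Triple ((2 : 𝕂) • t₀) tp tm)
    (hb : IsMultipletBasis t₀ tp tm b i₀) {k : 𝕂} (hk : k ≠ 0) :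
    TransformsWith b tp k (improvedSugawara b k t₀) (current 𝕂 (lowest s i₀))
      ((s i₀ : 𝕂) / 2 + 1) (k ^ 2 / 2) := by
  classical
  refine hb.hasDiracBracket_sugawara_current ht hk i₀ ?_
  rw [hb.repr_tm, if_pos rfl, mul_one]

end Virasoro


/-! ### Differential algebraic independence. -/

section FreeGeneration

variable {𝕂 : Type*} [RCLike 𝕂] {M κ : Type*}

/-- Fields that take all values are differentially algebraically independent. -/
theorem algebraicIndependent_derivField {X : κ → Field 𝕂 M}
    (hX : ∀ f : κ → SmoothCirc 𝕂, ∃ y, ∀ i, X i y = f i) :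
    AlgebraicIndependent 𝕂 fun p : κ × ℕ => derivField p.2 (X p.1) := by
  rw [algebraicIndependent_iff]
  intro p hp
  -- Over an infinite field it is enough that all values of the polynomial vanish. Any assignment
  -- `c` is realised at `z = 0` by fields with the prescribed jets.
  refine MvPolynomial.funext fun c => ?_
  rw [map_zero]
  -- Exceeds every order of derivative that occurs in `p`.
  let N := p.vars.sup Prod.snd + 1
  choose f hf using fun i => exists_jet (fun n => c (i, n)) N
  obtain ⟨y, hy⟩ := hX f
  have h1 := congrArg (fun F : Field 𝕂 M => (F y).1 0) hp
  let φ : Field 𝕂 M →ₐ[𝕂] 𝕂 := (evalAt 𝕂 0).comp (Pi.evalAlgHom 𝕂 (fun _ => SmoothCirc 𝕂) y)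
  have h2 : φ (MvPolynomial.aeval (fun p : κ × ℕ => derivField p.2 (X p.1)) p) = 0 := h1
  rw [← AlgHom.comp_apply, MvPolynomial.comp_aeval] at h2
  rw [← h2, MvPolynomial.aeval_def, MvPolynomial.eval, MvPolynomial.coe_eval₂Hom]
  refine MvPolynomial.eval₂Hom_congr' (f₁ := RingHom.id 𝕂) rfl (fun q hq _ => ?_) rfl
  change c q = ((dz 𝕂 ^ q.2) (X q.1 y)).1 0
  rw [hy, hf q.1 q.2 (Nat.lt_succ_of_le (Finset.le_sup (f := Prod.snd) hq))]

theorem derivField_iterate_mem (X : κ → Field 𝕂 M) {f : Field 𝕂 M} (hf : f ∈ fieldAlgebra X)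
    (n : ℕ) : derivField n f ∈ fieldAlgebra X := by
  induction n with
  | zero => exact hf
  | succ n ih =>
    have : derivField (n + 1) f = fun y => dz 𝕂 (derivField n f y) :=
      funext fun y => dz_pow_succ_apply' _ _
    rw [this]
    exact derivField_mem_fieldAlgebra X ih

theorem mem_fieldAlgebra (X : κ → Field 𝕂 M) (i : κ) : X i ∈ fieldAlgebra X :=
  Algebra.subset_adjoin ⟨(i, 0), rfl⟩

theorem fieldAlgebra_le {κ' : Type*} {X : κ → Field 𝕂 M} {Y : κ' → Field 𝕂 M}
    (h : ∀ i, X i ∈ fieldAlgebra Y) : fieldAlgebra X ≤ fieldAlgebra Y := by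
  refine Algebra.adjoin_le ?_
  rintro _ ⟨p, rfl⟩
  exact derivField_iterate_mem Y (h p.1) p.2

end FreeGeneration

/-! ### The two systems of generators. -/

section Generators

variable {𝕂 : Type*} [RCLike 𝕂] {g : Type*} [LieRing g] [LieAlgebra 𝕂 g]
  {ι : Type*} {s : ι → ℕ}
  {t₀ tp tm : g} {b : Module.Basis (Label s) 𝕂 g} {i₀ : ι}

theorem exists_gaugeSlice (b : Module.Basis (Label s) 𝕂 g) (tp : g) (f : ι → SmoothCirc 𝕂) :
    ∃ y : gaugeSlice b tp, ∀ i, restrictSlice b tp (current 𝕂 (lowest s i)) y = f i := by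
  refine ⟨⟨fun a => if (a.2 : ℕ) = 0 then f a.1 else constLoop b tp a, fun a => ?_⟩, fun i => ?_⟩
  · simp only [sliceConstraints, constraint, current, if_neg a.2, sub_self]
  · change (if ((lowest s i).2 : ℕ) = 0 then f i else constLoop b tp (lowest s i)) = f i
    exact if_pos (Fin.val_zero _)

theorem freelyGenerates_lowest (b : Module.Basis (Label s) 𝕂 g) (tp : g) :
    FreelyGenerates (fun i : ι => restrictSlice b tp (current 𝕂 (lowest s i)))
      (lowestFields b tp) := by
  exact ⟨by rw [lowestFields], algebraicIndependent_derivField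
    (X := fun i : ι => restrictSlice b tp (current 𝕂 (lowest s i))) (exists_gaugeSlice b tp)⟩

variable [Fintype ι] [DecidableEq ι] [LieAlgebra.IsKilling 𝕂 g]

/-- The part of `T^I` on the gauge slice that does not involve the current along `t_-`. -/
def sugawaraRest {R : Type*} [CommRing R] [Algebra 𝕂 R] (b : Module.Basis (Label s) 𝕂 g)
    (tp : g) (k : 𝕂) (i₀ : ι) (f : ι → R) : R :=
  ∑ i ∈ Finset.univ.erase i₀, ((1 / k * killingForm 𝕂 g tp (b (lowest s i))) • f i +
    ∑ j ∈ Finset.univ.erase i₀,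
      (1 / (2 * k) * killingForm 𝕂 g (b (lowest s i)) (b (lowest s j))) • (f i * f j))

theorem sugawaraRest_congr {R : Type*} [CommRing R] [Algebra 𝕂 R]
    {k : 𝕂} {f f' : ι → R} (h : ∀ i, i ≠ i₀ → f i = f' i) :
    sugawaraRest b tp k i₀ f = sugawaraRest b tp k i₀ f' := by
  refine Finset.sum_congr rfl fun i hi => ?_
  rw [h i (Finset.ne_of_mem_erase hi)]
  congr 1
  refine Finset.sum_congr rfl fun j hj => ?_
  rw [h j (Finset.ne_of_mem_erase hj)]

theorem grade2_lowest (i : ι) : grade2 (lowest s i) = -(s i : ℤ) := by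
  simp [grade2, lowest]

theorem IsMultipletBasis.killingForm_lowest_tm (hb : IsMultipletBasis t₀ tp tm b i₀) (i : ι) :
    killingForm 𝕂 g (b (lowest s i₀)) (b (lowest s i)) = 0 := by
  apply hb.killingForm_basis
  rw [grade2_lowest, grade2_lowest, hb.spin_one]
  omega

/-- By grading `t_-` is orthogonal to every lowest weight vector, itself included. Its current
therefore drops out of the quadratic term. -/
theorem IsMultipletBasis.improvedSugawara_eq_add_rest
    (ht : IsSl2Triple ((2 : 𝕂) • t₀) tp tm)
    (hb : IsMultipletBasis t₀ tp tm b i₀) {k : 𝕂} (hk : k ≠ 0) (y : gaugeSlice b tp) :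
    improvedSugawara b k t₀ y.1 = (1 / k * killingForm 𝕂 g tp tm) • y.1 (lowest s i₀) +
      sugawaraRest b tp k i₀ fun i => y.1 (lowest s i) := by
  obtain ⟨y, hy⟩ := y
  obtain ⟨w, hw, rfl⟩ := exists_eq_add_of_mem_gaugeSlice hy
  simp only [hb.improvedSugawara_slice ht hk hw, Pi.add_apply, hb.constLoop_tp_lowest, zero_add]
  refine circ_ext fun z => ?_
  simp only [sugawaraRest, add_at, sum_at, smul_at, mul_at, killLoop_at, loopAt_constLoop]
  set v : g := ∑ i ∈ Finset.univ.erase i₀, (w (lowest s i)).1 z • b (lowest s i) with hv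
  have h0 : loopAt b z w = (w (lowest s i₀)).1 z • tm + v := by
    rw [loopAt_lowest hw, ← hb.basis_lowest_eq_tm]
    exact (Finset.add_sum_erase _ _ (Finset.mem_univ i₀)).symm
  have h1 : killingForm 𝕂 g tm tm = 0 := by
    rw [← hb.basis_lowest_eq_tm]; exact hb.killingForm_lowest_tm i₀
  have h2 : killingForm 𝕂 g tm v = 0 := by
    rw [hv, map_sum, ← hb.basis_lowest_eq_tm]
    exact Finset.sum_eq_zero fun i _ => by rw [map_smul, hb.killingForm_lowest_tm, smul_zero]
  have h3 : killingForm 𝕂 g v v = ∑ i ∈ Finset.univ.erase i₀, ∑ j ∈ Finset.univ.erase i₀,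
      (w (lowest s i)).1 z * (w (lowest s j)).1 z *
        killingForm 𝕂 g (b (lowest s i)) (b (lowest s j)) := by
    rw [hv, LinearMap.map_sum₂]
    refine Finset.sum_congr rfl fun i _ => ?_
    rw [map_smul, LinearMap.smul_apply, map_sum, Finset.smul_sum]
    refine Finset.sum_congr rfl fun j _ => ?_
    rw [map_smul, smul_eq_mul, smul_eq_mul, mul_assoc]
  have h4 : killingForm 𝕂 g tp v = ∑ i ∈ Finset.univ.erase i₀,
      (w (lowest s i)).1 z * killingForm 𝕂 g tp (b (lowest s i)) := by
    rw [hv, map_sum]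
    exact Finset.sum_congr rfl fun i _ => by rw [map_smul, smul_eq_mul]
  rw [h0]
  simp only [map_add, map_smul, LinearMap.add_apply, LinearMap.smul_apply, h1, h2,
    killingForm_symm v tm, zero_add, smul_eq_mul, mul_zero, add_zero]
  rw [h3, h4, Finset.sum_add_distrib, mul_add, Finset.mul_sum, Finset.mul_sum, add_assoc]
  simp only [Finset.mul_sum]
  congr 1
  · ring
  congr 1
  · exact Finset.sum_congr rfl fun i _ => by ring
  · exact Finset.sum_congr rfl fun i _ => Finset.sum_congr rfl fun j _ => by ring

/-- The change of generators is triangular: `T^I` is `a` times the current along `t_-` plus a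
polynomial in the other currents, with `a ≠ 0`. The same formula, solved for that current, shows
that the new family takes all values. -/
theorem IsMultipletBasis.freelyGenerates_sugawara (ht : IsSl2Triple ((2 : 𝕂) • t₀) tp tm)
    (hb : IsMultipletBasis t₀ tp tm b i₀) {k : 𝕂} (hk : k ≠ 0) :
    FreelyGenerates
      (Function.update (fun i : ι => restrictSlice b tp (current 𝕂 (lowest s i))) i₀
        (restrictSlice b tp (improvedSugawara b k t₀)))
      (lowestFields b tp) := by
  set X : ι → Field 𝕂 (gaugeSlice b tp) := fun i => restrictSlice b tp (current 𝕂 (lowest s i))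
    with hX
  set T := restrictSlice b tp (improvedSugawara b k t₀) with hT
  have ha : 1 / k * killingForm 𝕂 g tp tm ≠ 0 := by
    rw [hb.killingForm_tp_tm ht]
    exact mul_ne_zero (one_div_ne_zero hk) (mul_ne_zero two_ne_zero hb.killingForm_t₀_ne_zero)
  set a := 1 / k * killingForm 𝕂 g tp tm
  have hTX : ∀ y, T y = a • X i₀ y + sugawaraRest b tp k i₀ fun i => X i y :=
    fun y => hb.improvedSugawara_eq_add_rest ht hk y
  have hrest : ∀ Y : ι → Field 𝕂 (gaugeSlice b tp),
      (fun y => sugawaraRest b tp k i₀ fun i => Y i y) = sugawaraRest b tp k i₀ Y := by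
    intro Y
    funext y
    simp only [sugawaraRest, Finset.sum_apply, Pi.add_apply, Pi.smul_apply, Pi.mul_apply]
  have hmem : ∀ Y : ι → Field 𝕂 (gaugeSlice b tp),
      sugawaraRest b tp k i₀ Y ∈ fieldAlgebra Y := fun Y =>
    sum_mem fun i _ => add_mem (Subalgebra.smul_mem _ (mem_fieldAlgebra Y i) _)
      (sum_mem fun j _ => Subalgebra.smul_mem _
        (mul_mem (mem_fieldAlgebra Y i) (mem_fieldAlgebra Y j)) _)
  have hTX' : T = a • X i₀ + sugawaraRest b tp k i₀ X := by
    rw [← hrest]; exact funext hTX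
  have hcongr : sugawaraRest b tp k i₀ (Function.update X i₀ T) = sugawaraRest b tp k i₀ X :=
    sugawaraRest_congr fun i hi => Function.update_of_ne hi _ _
  refine ⟨le_antisymm (fieldAlgebra_le fun i => ?_) (fieldAlgebra_le fun i => ?_),
    algebraicIndependent_derivField fun f => ?_⟩
  · by_cases hi : i = i₀
    · subst hi
      rw [Function.update_self, hTX']
      exact add_mem (Subalgebra.smul_mem _ (mem_fieldAlgebra X _) _) (hmem X)
    · rw [Function.update_of_ne hi]
      exact mem_fieldAlgebra X i
  · by_cases hi : i = i₀
    · subst hi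
      have h1 : X i = a⁻¹ • (T - sugawaraRest b tp k i (Function.update X i T)) := by
        rw [hcongr, hTX', add_sub_cancel_right, smul_smul, inv_mul_cancel₀ ha, one_smul]
      have h2 := mem_fieldAlgebra (Function.update X i T) i
      rw [Function.update_self] at h2
      change X i ∈ _
      rw [h1]
      exact Subalgebra.smul_mem _ (sub_mem h2 (hmem _)) _
    · have h2 := mem_fieldAlgebra (Function.update X i₀ T) i
      rwa [Function.update_of_ne hi] at h2
  · obtain ⟨y, hy⟩ := exists_gaugeSlice b tp
      (Function.update f i₀ (a⁻¹ • (f i₀ - sugawaraRest b tp k i₀ f)))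
    refine ⟨y, fun i => ?_⟩
    by_cases hi : i = i₀
    · subst hi
      have h1 : (sugawaraRest b tp k i fun j => X j y) = sugawaraRest b tp k i f :=
        sugawaraRest_congr fun j hj => (hy j).trans (Function.update_of_ne hj _ _)
      rw [Function.update_self, hTX, h1]
      have h2 : X i y = _ := hy i
      rw [h2, Function.update_self, smul_smul, mul_inv_cancel₀ ha, one_smul, sub_add_cancel]
    · rw [Function.update_of_ne hi]
      exact (hy i).trans (Function.update_of_ne hi _ _)

end Generators


/-! ### Internal direct sums over a finite index type. -/

section DirectSums

variable {R M ι : Type*} [Ring R] [AddCommGroup M] [Module R M] [Fintype ι] [DecidableEq ι]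

theorem isInternal_iff_of_fintype (A : ι → Submodule R M) : DirectSum.IsInternal A ↔
    (∀ v : ι → M, (∀ i, v i ∈ A i) → ∑ i, v i = 0 → ∀ i, v i = 0) ∧
      ∀ x, ∃ v : ι → M, (∀ i, v i ∈ A i) ∧ ∑ i, v i = x := by
  have key : ∀ d : DirectSum ι fun i => A i,
      DirectSum.coeAddMonoidHom A d = ∑ i, (d i : M) := fun d => by
    classical
    rw [DirectSum.coeAddMonoidHom_eq_dfinsuppSum]
    exact DFinsupp.sum_eq_sum_fintype d fun _ => rfl
  let e : (∀ i, A i) → DirectSum ι fun i => A i := DFinsupp.equivFunOnFintype.symm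
  have he : ∀ v i, e v i = v i := fun v i => rfl
  constructor
  · refine fun h => ⟨fun v hv h0 i => ?_, fun x => ?_⟩
    · have h1 : e (fun i => ⟨v i, hv i⟩) = 0 := h.1 (by rw [key, map_zero]; exact h0)
      have h2 := congrArg (fun d : DirectSum ι fun i => A i => (d i : M)) h1
      exact h2
    · obtain ⟨d, hd⟩ := h.2 x
      exact ⟨fun i => d i, fun i => (d i).2, by rw [← hd, key]⟩
  · rintro ⟨h1, h2⟩
    refine ⟨(injective_iff_map_eq_zero _).2 fun d hd => ?_, fun x => ?_⟩
    · rw [key] at hd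
      exact DFinsupp.ext fun i => Subtype.ext (h1 (fun i => d i) (fun i => (d i).2) hd i)
    · obtain ⟨v, hv, hx⟩ := h2 x
      exact ⟨e fun i => ⟨v i, hv i⟩, by rw [key]; exact hx⟩

end DirectSums

/-! ### The multiplets as irreducible `sl₂`-modules. -/

section Modules

variable {𝕂 : Type*} [RCLike 𝕂] {g : Type*} [LieRing g] [LieAlgebra 𝕂 g]
  {ι : Type*} {s : ι → ℕ}
  {t₀ tp tm : g} {b : Module.Basis (Label s) 𝕂 g} {i₀ : ι}

/-- A subspace stable under `t_±` is an `sl₂`-submodule. -/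
def sl2Submodule (ht : IsSl2Triple ((2 : 𝕂) • t₀) tp tm) (N : Submodule 𝕂 g)
    (hp : ∀ x ∈ N, ⁅tp, x⁆ ∈ N) (hm : ∀ x ∈ N, ⁅tm, x⁆ ∈ N) :
    LieSubmodule 𝕂 (ht.toLieSubalgebra 𝕂) g where
  __ := N
  lie_mem := by
    intro x m hxm
    obtain ⟨c₁, c₂, c₃, hx⟩ := IsSl2Triple.mem_toLieSubalgebra_iff.1 x.2
    rw [LieSubalgebra.coe_bracket_of_module, hx, add_lie, add_lie, smul_lie, smul_lie, smul_lie,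
      lie_lie]
    exact N.add_mem (N.add_mem (N.smul_mem _ (hp _ hxm)) (N.smul_mem _ (hm _ hxm)))
      (N.smul_mem _ (N.sub_mem (hp _ (hm _ hxm)) (hm _ (hp _ hxm))))

theorem lie_tp_mem {ht : IsSl2Triple ((2 : 𝕂) • t₀) tp tm}
    (N : LieSubmodule 𝕂 (ht.toLieSubalgebra 𝕂) g) {x : g} (hx : x ∈ N) : ⁅tp, x⁆ ∈ N :=
  N.lie_mem (x := ⟨tp, IsSl2Triple.mem_toLieSubalgebra_iff.2 ⟨1, 0, 0, by simp⟩⟩) hx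

theorem lie_tm_mem {ht : IsSl2Triple ((2 : 𝕂) • t₀) tp tm}
    (N : LieSubmodule 𝕂 (ht.toLieSubalgebra 𝕂) g) {x : g} (hx : x ∈ N) : ⁅tm, x⁆ ∈ N :=
  N.lie_mem (x := ⟨tm, IsSl2Triple.mem_toLieSubalgebra_iff.2 ⟨0, 1, 0, by simp⟩⟩) hx

theorem lie_t₀_mem {ht : IsSl2Triple ((2 : 𝕂) • t₀) tp tm}
    (N : LieSubmodule 𝕂 (ht.toLieSubalgebra 𝕂) g) {x : g} (hx : x ∈ N) : ⁅t₀, x⁆ ∈ N := by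
  have h := sub_mem (lie_tp_mem N (lie_tm_mem N hx)) (lie_tm_mem N (lie_tp_mem N hx))
  rw [← lie_lie, lie_tp_tm ht, smul_lie] at h
  have h2 := N.smul_mem (2 : 𝕂)⁻¹ h
  rwa [smul_smul, inv_mul_cancel₀ two_ne_zero, one_smul] at h2

variable [Fintype ι]

/-- The kernel of `ad t_-` is spanned by the lowest weight vectors. -/
theorem IsMultipletBasis.repr_eq_zero_of_lie_tm (ht : IsSl2Triple ((2 : 𝕂) • t₀) tp tm)
    (hb : IsMultipletBasis t₀ tp tm b i₀) {x : g} (hx : ⁅tm, x⁆ = 0) {a : Label s}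
    (ha : (a.2 : ℕ) ≠ 0) : b.repr x a = 0 := by
  classical
  obtain ⟨cp, cm, hcp, hcm, hc⟩ := hb.exists_coeff ht
  obtain ⟨d, hd, rfl⟩ := exists_eq_raiseLabel ha
  have key : ∀ e : Label s, b.repr ⁅tm, b e⁆ d = if e = raiseLabel d hd then cm d.1 d.2 else 0 := by
    intro e
    by_cases he : (e.2 : ℕ) = 0
    · have h1 : e ≠ raiseLabel d hd := by
        rintro rfl
        exact absurd he (Nat.succ_ne_zero _)
      rw [if_neg h1, eq_lowest_of_val_eq_zero he, hb.lower_lowest, map_zero]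
      rfl
    · obtain ⟨f, hf, rfl⟩ := exists_eq_raiseLabel he
      have h1 : ⁅tm, b (raiseLabel f hf)⁆ = cm f.1 f.2 • b f := by
        have := hcm f.1 f.2
        rwa [multipletVec_val, multipletVec_of_lt b (by omega)] at this
      rw [h1, map_smul, Finsupp.smul_apply, b.repr_self, Finsupp.single_apply]
      by_cases hfd : f = d
      · subst hfd
        simp
      · have h2 : raiseLabel f hf ≠ raiseLabel d hd := by
          intro hr
          apply hfd
          obtain ⟨i, p⟩ := f
          obtain ⟨j, q⟩ := d
          simp only [raiseLabel, Sigma.mk.injEq] at hr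
          obtain ⟨rfl, hr⟩ := hr
          have := Fin.mk.inj (eq_of_heq hr)
          exact congrArg (Sigma.mk i) (Fin.ext (by omega))
        simp [hfd, h2]
  have h0 : b.repr ⁅tm, x⁆ d = cm d.1 d.2 * b.repr x (raiseLabel d hd) := by
    conv_lhs => rw [← b.sum_repr x]
    simp only [lie_sum, lie_smul, map_sum, map_smul, Finsupp.coe_finsetSum,
      Finset.sum_apply, Finsupp.smul_apply, smul_eq_mul, key, mul_ite, mul_zero,
      Finset.sum_ite_eq', Finset.mem_univ, if_true]
    ring
  rw [hx, map_zero, Finsupp.zero_apply] at h0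
  exact (mul_eq_zero.1 h0.symm).resolve_left (coeff_ne_zero hc hd).2

theorem IsMultipletBasis.lie_tm_of_repr (hb : IsMultipletBasis t₀ tp tm b i₀) {x : g}
    (hx : ∀ a : Label s, (a.2 : ℕ) ≠ 0 → b.repr x a = 0) : ⁅tm, x⁆ = 0 := by
  rw [← b.sum_repr x, lie_sum]
  refine Finset.sum_eq_zero fun a _ => ?_
  rw [lie_smul]
  by_cases ha : (a.2 : ℕ) = 0
  · rw [eq_lowest_of_val_eq_zero ha, hb.lower_lowest, smul_zero]
  · rw [hx a ha, zero_smul]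

/-- `ad t_-` lowers the grade and is therefore nilpotent; the last nonzero iterate does it. -/
theorem IsMultipletBasis.exists_lie_tm_eq_zero (hb : IsMultipletBasis t₀ tp tm b i₀)
    (N : Submodule 𝕂 g) (hm : ∀ x ∈ N, ⁅tm, x⁆ ∈ N) {x : g} (hx : x ∈ N) (hx0 : x ≠ 0) :
    ∃ z ∈ N, z ≠ 0 ∧ ⁅tm, z⁆ = 0 := by
  classical
  obtain ⟨C, hC⟩ := exists_grade2_le s
  have hle : ∀ n : ℕ, (fun x => ⁅tm, x⁆)^[n] x ∈ gradeLE b (C - 2 * n) := by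
    intro n
    induction n with
    | zero => exact fun a ha => absurd ((le_abs_self _).trans (hC a)) (by simpa using ha)
    | succ n ih =>
      rw [Function.iterate_succ_apply']
      have h := hb.lie_mem_gradeLE hb.tm_mem ih
      have e : -2 + ((C : ℤ) - 2 * (n : ℤ)) = C - 2 * ((n + 1 : ℕ) : ℤ) := by push_cast; ring
      rwa [e] at h
  have h0 : ∃ n, (fun x => ⁅tm, x⁆)^[n] x = 0 := by
    refine ⟨C + 1, b.ext_elem fun a => ?_⟩
    rw [hle _ a, map_zero]; · rfl
    have := (neg_abs_le _).trans' (neg_le_neg (hC a))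
    push_cast
    omega
  have hmem : ∀ n, (fun x => ⁅tm, x⁆)^[n] x ∈ N := by
    intro n
    induction n with
    | zero => exact hx
    | succ n ih => rw [Function.iterate_succ_apply']; exact hm _ ih
  obtain ⟨n, hn⟩ : ∃ n, Nat.find h0 = n + 1 :=
    Nat.exists_eq_succ_of_ne_zero fun h => hx0 (by simpa [h] using Nat.find_spec h0)
  refine ⟨(fun x => ⁅tm, x⁆)^[n] x, hmem n, Nat.find_min h0 (by omega), ?_⟩
  rw [← Function.iterate_succ_apply' (fun x => ⁅tm, x⁆), ← Nat.succ_eq_add_one] at *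
  rw [← hn]
  exact Nat.find_spec h0

/-- The subspace spanned by a multiplet. -/
def multipletSpan (b : Module.Basis (Label s) 𝕂 g) (i : ι) : Submodule 𝕂 g :=
  Submodule.span 𝕂 (Set.range fun p => b ⟨i, p⟩)

theorem multipletVec_mem (b : Module.Basis (Label s) 𝕂 g) (i : ι) (p : ℕ) :
    multipletVec b i p ∈ multipletSpan b i := by
  by_cases h : p < s i + 1
  · rw [multipletVec_of_lt b h]
    exact Submodule.subset_span ⟨_, rfl⟩
  · rw [multipletVec, dif_neg h]
    exact zero_mem _

theorem repr_of_mem_multipletSpan {i : ι} {x : g} (hx : x ∈ multipletSpan b i) {a : Label s}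
    (ha : a.1 ≠ i) : b.repr x a = 0 := by
  have h : multipletSpan b i ≤ LinearMap.ker (b.coord a) := by
    refine Submodule.span_le.2 ?_
    rintro _ ⟨p, rfl⟩
    classical
    rw [SetLike.mem_coe, LinearMap.mem_ker, b.coord_apply, b.repr_self, Finsupp.single_eq_of_ne]
    rintro rfl
    exact ha rfl
  exact h hx

theorem multipletSpan_stable {t : g}
    (h : ∀ i p, ⁅t, multipletVec b i p⁆ ∈ multipletSpan b i) (i : ι) :
    ∀ x ∈ multipletSpan b i, ⁅t, x⁆ ∈ multipletSpan b i := by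
  have h1 : multipletSpan b i ≤ (multipletSpan b i).comap (LieAlgebra.ad 𝕂 g t) := by
    refine Submodule.span_le.2 ?_
    rintro _ ⟨p, rfl⟩
    have := h i p
    rwa [multipletVec_val] at this
  exact h1

theorem IsMultipletBasis.lie_tp_mem_multipletSpan (ht : IsSl2Triple ((2 : 𝕂) • t₀) tp tm)
    (hb : IsMultipletBasis t₀ tp tm b i₀) (i : ι) :
    ∀ x ∈ multipletSpan b i, ⁅tp, x⁆ ∈ multipletSpan b i := by
  obtain ⟨cp, cm, hcp, hcm, hc⟩ := hb.exists_coeff ht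
  refine multipletSpan_stable (fun i p => ?_) i
  rw [hcp]
  exact Submodule.smul_mem _ _ (multipletVec_mem b i _)

theorem IsMultipletBasis.lie_tm_mem_multipletSpan (ht : IsSl2Triple ((2 : 𝕂) • t₀) tp tm)
    (hb : IsMultipletBasis t₀ tp tm b i₀) (i : ι) :
    ∀ x ∈ multipletSpan b i, ⁅tm, x⁆ ∈ multipletSpan b i := by
  obtain ⟨cp, cm, hcp, hcm, hc⟩ := hb.exists_coeff ht
  refine multipletSpan_stable (fun i p => ?_) i
  rcases p with _ | p
  · rw [hb.lie_tm_lowest]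
    exact zero_mem _
  · rw [hcm]
    exact Submodule.smul_mem _ _ (multipletVec_mem b i _)

/-- The multiplet as an `sl₂`-module. -/
def multipletModule (ht : IsSl2Triple ((2 : 𝕂) • t₀) tp tm)
    (hb : IsMultipletBasis t₀ tp tm b i₀) (i : ι) : LieSubmodule 𝕂 (ht.toLieSubalgebra 𝕂) g :=
  sl2Submodule ht (multipletSpan b i) (hb.lie_tp_mem_multipletSpan ht i)
    (hb.lie_tm_mem_multipletSpan ht i)

/-- A submodule that meets a multiplet contains it. -/
theorem IsMultipletBasis.multipletSpan_le (ht : IsSl2Triple ((2 : 𝕂) • t₀) tp tm)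
    (hb : IsMultipletBasis t₀ tp tm b i₀) (N : LieSubmodule 𝕂 (ht.toLieSubalgebra 𝕂) g) {i : ι}
    {x : g} (hx : x ∈ N) (hxi : x ∈ multipletSpan b i) (hx0 : x ≠ 0) :
    ∀ y ∈ multipletSpan b i, y ∈ N := by
  obtain ⟨cp, cm, hcp, hcm, hc⟩ := hb.exists_coeff ht
  obtain ⟨z, ⟨hzN, hzi⟩, hz0, hz⟩ := hb.exists_lie_tm_eq_zero
    ((N : Submodule 𝕂 g) ⊓ multipletSpan b i)
    (fun x hx => ⟨lie_tm_mem N hx.1, hb.lie_tm_mem_multipletSpan ht i x hx.2⟩) ⟨hx, hxi⟩ hx0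
  -- The kernel of `ad t_-` meets a multiplet only in its lowest weight line. From there the nonzero
  -- raising coefficients reach the whole multiplet.
  have hzl : z = b.repr z (lowest s i) • b (lowest s i) := by
    conv_lhs => rw [← b.sum_repr z]
    refine Finset.sum_eq_single (lowest s i) (fun a _ ha => ?_) (by simp)
    by_cases h : (a.2 : ℕ) = 0
    · have hai : a.1 ≠ i := by
        rintro rfl
        exact ha (eq_lowest_of_val_eq_zero h)
      rw [repr_of_mem_multipletSpan hzi hai, zero_smul]
    · rw [hb.repr_eq_zero_of_lie_tm ht hz h, zero_smul]
  have hc0 : b.repr z (lowest s i) ≠ 0 := fun h => hz0 (by rw [hzl, h, zero_smul])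
  have hl : multipletVec b i 0 ∈ N := by
    rw [hzl] at hzN
    have := N.smul_mem (b.repr z (lowest s i))⁻¹ hzN
    rwa [smul_smul, inv_mul_cancel₀ hc0, one_smul, basis_lowest] at this
  have hp : ∀ p, p < s i + 1 → multipletVec b i p ∈ N := by
    intro p
    induction p with
    | zero => exact fun _ => hl
    | succ p ih =>
      intro h
      have h1 := lie_tp_mem N (ih (by omega))
      rw [hcp] at h1
      have := N.smul_mem (cp i p)⁻¹ h1
      rwa [smul_smul, inv_mul_cancel₀ (coeff_ne_zero hc (by omega)).1, one_smul] at this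
  have hle : multipletSpan b i ≤ (N : Submodule 𝕂 g) := by
    refine Submodule.span_le.2 ?_
    rintro _ ⟨p, rfl⟩
    have := hp p p.2
    rwa [multipletVec_val] at this
  exact hle

theorem IsMultipletBasis.isIrreducible_multipletModule (ht : IsSl2Triple ((2 : 𝕂) • t₀) tp tm)
    (hb : IsMultipletBasis t₀ tp tm b i₀) (i : ι) :
    LieModule.IsIrreducible 𝕂 (ht.toLieSubalgebra 𝕂) (multipletModule ht hb i) := by
  have hmem : b (lowest s i) ∈ multipletModule ht hb i := Submodule.subset_span ⟨_, rfl⟩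
  have : Nontrivial (multipletModule ht hb i) :=
    ⟨⟨⟨_, hmem⟩, 0, fun h => b.ne_zero _ (congrArg Subtype.val h)⟩⟩
  refine LieModule.IsIrreducible.mk fun N hN => ?_
  obtain ⟨x, hx, hx0⟩ : ∃ x ∈ N, x ≠ 0 := by
    by_contra! h
    exact hN ((LieSubmodule.eq_bot_iff N).2 h)
  have h := hb.multipletSpan_le ht (N.map (multipletModule ht hb i).incl) (i := i) (x := x.1)
    (LieSubmodule.mem_map _ |>.2 ⟨x, hx, rfl⟩) x.2 (fun h => hx0 (Subtype.ext h))
  refine eq_top_iff.2 fun y _ => ?_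
  obtain ⟨y', hy', hyy⟩ := (LieSubmodule.mem_map _).1 (h y.1 y.2)
  have : y' = y := Subtype.ext hyy
  rwa [← this]

theorem isInternal_multipletSpan [DecidableEq ι] (b : Module.Basis (Label s) 𝕂 g) :
    DirectSum.IsInternal (multipletSpan b) := by
  refine (isInternal_iff_of_fintype _).2 ⟨fun v hv h0 i => b.ext_elem fun a => ?_, fun x => ?_⟩
  · rw [map_zero, Finsupp.zero_apply]
    by_cases ha : a.1 = i
    · have h1 := congrArg (fun x => b.repr x a) h0
      simp only [map_sum, Finsupp.coe_finsetSum, Finset.sum_apply, map_zero,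
        Finsupp.zero_apply] at h1
      rwa [Finset.sum_eq_single i (fun j _ hj =>
        repr_of_mem_multipletSpan (hv j) (fun h => hj (h.symm.trans ha))) (by simp)] at h1
    · exact repr_of_mem_multipletSpan (hv i) ha
  · refine ⟨fun i => ∑ p, b.repr x ⟨i, p⟩ • b ⟨i, p⟩, fun i => sum_mem fun p _ =>
      Submodule.smul_mem _ _ (Submodule.subset_span ⟨p, rfl⟩), ?_⟩
    rw [← Fintype.sum_sigma (fun a : Label s => b.repr x a • b a), b.sum_repr]

/-! ### Counting irreducible summands -/

/-- A nonzero submodule contains a lowest weight vector. -/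
theorem IsMultipletBasis.exists_lowest_weight_vector (ht : IsSl2Triple ((2 : 𝕂) • t₀) tp tm)
    (hb : IsMultipletBasis t₀ tp tm b i₀) (N : LieSubmodule 𝕂 (ht.toLieSubalgebra 𝕂) g)
    {x : g} (hx : x ∈ N) (hx0 : x ≠ 0) :
    ∃ z ∈ N, z ≠ 0 ∧ ⁅tm, z⁆ = 0 ∧ ∃ c : 𝕂, ⁅t₀, z⁆ = c • z := by
  classical
  -- A member of `S` with the fewest nonzero components is a weight vector: otherwise subtracting a
  -- suitable multiple from `[t₀, z]` yields a member with smaller support. No existence theorem for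
  -- eigenvalues is needed, so the argument covers `ℝ`.
  let S : Set g := {z | z ∈ N ∧ z ≠ 0 ∧ ⁅tm, z⁆ = 0}
  have hS : S.Nonempty := by
    obtain ⟨z, hz⟩ := hb.exists_lie_tm_eq_zero (N : Submodule 𝕂 g)
      (fun x hx => lie_tm_mem N hx) hx hx0
    exact ⟨z, hz⟩
  obtain ⟨z, ⟨hzN, hz0, hz⟩, hmin⟩ :=
    (measure fun z : g => (b.repr z).support.card).wf.has_min S hS
  obtain ⟨a, ha⟩ : ∃ a, b.repr z a ≠ 0 := by
    by_contra! h
    exact hz0 (b.ext_elem fun a => by rw [h a, map_zero]; rfl)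
  refine ⟨z, hzN, hz0, hz, (grade2 a : 𝕂) / 2, ?_⟩
  by_contra hne
  let z' := ⁅t₀, z⁆ - ((grade2 a : 𝕂) / 2) • z
  have hrepr : ∀ d, b.repr z' d = ((grade2 d : 𝕂) / 2 - (grade2 a : 𝕂) / 2) * b.repr z d := by
    intro d
    rw [map_sub, Finsupp.sub_apply, hb.repr_lie_t₀, map_smul, Finsupp.smul_apply, smul_eq_mul,
      sub_mul]
  refine hmin z' ⟨sub_mem (lie_t₀_mem N hzN) (N.smul_mem _ hzN), sub_ne_zero.2 hne,
    hb.lie_tm_of_repr fun d hd => ?_⟩ (Finset.card_lt_card ⟨fun d hd => ?_, fun h => ?_⟩)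
  · rw [hrepr, hb.repr_eq_zero_of_lie_tm ht hz hd, mul_zero]
  · rw [Finsupp.mem_support_iff, hrepr] at hd
    exact Finsupp.mem_support_iff.2 (right_ne_zero_of_mul hd)
  · have := h (Finsupp.mem_support_iff.2 ha)
    rw [Finsupp.mem_support_iff, hrepr, sub_self, zero_mul] at this
    exact this rfl

/-- An irreducible submodule has exactly one lowest weight vector up to scalars. -/
theorem IsMultipletBasis.exists_unique_lowest_weight_vector
    (ht : IsSl2Triple ((2 : 𝕂) • t₀) tp tm) (hb : IsMultipletBasis t₀ tp tm b i₀)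
    (V : LieSubmodule 𝕂 (ht.toLieSubalgebra 𝕂) g)
    (hV : LieModule.IsIrreducible 𝕂 (ht.toLieSubalgebra 𝕂) V) :
    ∃ z ∈ V, z ≠ 0 ∧ ⁅tm, z⁆ = 0 ∧ ∀ x ∈ V, ⁅tm, x⁆ = 0 → ∃ c : 𝕂, x = c • z := by
  have hnt : Nontrivial V := LieModule.nontrivial_of_isIrreducible 𝕂 (ht.toLieSubalgebra 𝕂) V
  obtain ⟨x, hx0⟩ := exists_ne (0 : V)
  obtain ⟨z, hzV, hz0, hz, c, hc⟩ := hb.exists_lowest_weight_vector ht V x.2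
    (fun h => hx0 (Subtype.ext h))
  obtain ⟨cp, cm, hcp, -, -⟩ := hb.exists_coeff ht
  refine ⟨z, hzV, hz0, hz, fun x hxV hx => ?_⟩
  -- The string of raised vectors over `z`; its span is an `sl₂`-submodule and hence, by
  -- irreducibility, contains `V`.
  let E : ℕ → g := fun p => ((LieAlgebra.ad 𝕂 g tp) ^ p) z
  have hE : ∀ p, ⁅tp, E p⁆ = E (p + 1) := fun p => by
    simp only [E, pow_succ']; rfl
  have hEt : ∀ p : ℕ, ⁅t₀, E p⁆ = (c + p) • E p := by
    intro p
    induction p with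
    | zero => simpa [E] using hc
    | succ p ih =>
      rw [← hE, leibniz_lie, hb.lie_t₀_tp, ih, lie_smul, hE]
      push_cast
      module
  have hEm : ∀ p, ∃ r : 𝕂, ⁅tm, E (p + 1)⁆ = r • E p := by
    intro p
    have h1 : ∀ p, ⁅tm, E (p + 1)⁆ = ⁅tp, ⁅tm, E p⁆⁆ - (2 * (c + p) : 𝕂) • E p := by
      intro p
      have h2 := leibniz_lie tp tm (E p)
      rw [lie_tp_tm ht, smul_lie, hEt, hE, smul_smul] at h2
      rw [h2]
      abel
    induction p with
    | zero =>
      have h0 : E 0 = z := rfl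
      refine ⟨-(2 * (c + (0 : ℕ))), ?_⟩
      rw [h1, h0, hz, lie_zero, zero_sub, neg_smul]
    | succ p ih =>
      obtain ⟨r, hr⟩ := ih
      refine ⟨r - 2 * (c + (p + 1 : ℕ)), ?_⟩
      rw [h1, hr, lie_smul, hE, sub_smul]
  let U := Submodule.span 𝕂 (Set.range E)
  have hUp : ∀ x ∈ U, ⁅tp, x⁆ ∈ U := by
    have : U ≤ U.comap (LieAlgebra.ad 𝕂 g tp) := by
      refine Submodule.span_le.2 ?_
      rintro _ ⟨p, rfl⟩
      exact Submodule.subset_span ⟨p + 1, (hE p).symm⟩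
    exact this
  have hUm : ∀ x ∈ U, ⁅tm, x⁆ ∈ U := by
    have : U ≤ U.comap (LieAlgebra.ad 𝕂 g tm) := by
      refine Submodule.span_le.2 ?_
      rintro _ ⟨p, rfl⟩
      change ⁅tm, E p⁆ ∈ U
      rcases p with _ | p
      · have h0 : E 0 = z := rfl
        rw [h0, hz]
        exact zero_mem _
      · obtain ⟨r, hr⟩ := hEm p
        rw [hr]
        exact Submodule.smul_mem _ _ (Submodule.subset_span ⟨p, rfl⟩)
    exact this
  let U' := sl2Submodule ht U hUp hUm
  have hzU : z ∈ U' := Submodule.subset_span ⟨0, rfl⟩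
  have htop : U'.comap V.incl = ⊤ := by
    refine (hV.eq_bot_or_eq_top _).resolve_left fun h => hz0 ?_
    have h1 : (⟨z, hzV⟩ : V) ∈ U'.comap V.incl := hzU
    rw [h, LieSubmodule.mem_bot] at h1
    exact congrArg Subtype.val h1
  have hxU : x ∈ U := by
    have h1 : (⟨x, hxV⟩ : V) ∈ U'.comap V.incl := by rw [htop]; exact LieSubmodule.mem_top _
    exact h1
  -- the components of `E p` at the lowest labels vanish for `p > 0`
  have hlow : ∀ y : g, ∀ i, b.repr ⁅tp, y⁆ (lowest s i) = 0 := by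
    classical
    intro y i
    rw [← b.sum_repr y, lie_sum, map_sum, Finsupp.coe_finsetSum, Finset.sum_apply]
    refine Finset.sum_eq_zero fun a _ => ?_
    rw [lie_smul, ← multipletVec_val b a.1 a.2, hcp]
    by_cases h : (a.2 : ℕ) + 1 < s a.1 + 1
    · have hne : (⟨a.1, ⟨a.2 + 1, h⟩⟩ : Label s) ≠ lowest s i := fun h =>
        Nat.succ_ne_zero _ (congrArg (fun a : Label s => (a.2 : ℕ)) h)
      rw [multipletVec_of_lt b h, map_smul, map_smul, Finsupp.smul_apply, Finsupp.smul_apply,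
        b.repr_self, Finsupp.single_eq_of_ne hne.symm, smul_zero, smul_zero]
    · rw [multipletVec_of_gt b (by omega), smul_zero, smul_zero, map_zero]
      rfl
  -- Vectors that agree with a multiple of `z` in the lowest components. The string lies in `K`, and
  -- a vector killed by `t_-` has only lowest components, so it is itself that multiple.
  let K : Submodule 𝕂 g :=
    { carrier := {y | ∃ r : 𝕂, ∀ i, b.repr (y - r • z) (lowest s i) = 0}
      zero_mem' := ⟨0, fun i => by simp⟩
      add_mem' := by
        rintro y y' ⟨r, hr⟩ ⟨r', hr'⟩
        refine ⟨r + r', fun i => ?_⟩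
        rw [add_smul, add_sub_add_comm, map_add, Finsupp.add_apply, hr, hr', add_zero]
      smul_mem' := by
        rintro q y ⟨r, hr⟩
        refine ⟨q * r, fun i => ?_⟩
        rw [mul_smul, ← smul_sub, map_smul, Finsupp.smul_apply, hr, smul_zero] }
  have hUK : U ≤ K := by
    refine Submodule.span_le.2 ?_
    rintro _ ⟨p, rfl⟩
    rcases p with _ | p
    · exact ⟨1, fun i => by simp [E]⟩
    · refine ⟨0, fun i => ?_⟩
      rw [zero_smul, sub_zero, ← hE, hlow]
  obtain ⟨r, hr⟩ := hUK hxU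
  refine ⟨r, sub_eq_zero.1 (b.ext_elem fun a => ?_)⟩
  rw [map_zero, Finsupp.zero_apply]
  by_cases ha : (a.2 : ℕ) = 0
  · rw [eq_lowest_of_val_eq_zero ha, hr]
  · exact hb.repr_eq_zero_of_lie_tm ht (by rw [lie_sub, lie_smul, hx, hz, smul_zero, sub_zero]) ha

/-- The lowest weight basis vectors, one for each multiplet, form a basis of the kernel. -/
theorem IsMultipletBasis.finrank_ker_ad_tm (ht : IsSl2Triple ((2 : 𝕂) • t₀) tp tm)
    (hb : IsMultipletBasis t₀ tp tm b i₀) :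
    Module.finrank 𝕂 (LinearMap.ker (LieAlgebra.ad 𝕂 g tm)) = Fintype.card ι := by
  have h1 : LinearMap.ker (LieAlgebra.ad 𝕂 g tm) =
      Submodule.span 𝕂 (Set.range fun i => b (lowest s i)) := by
    refine le_antisymm (fun x hx => ?_) (Submodule.span_le.2 ?_)
    · rw [← b.sum_repr x]
      refine sum_mem fun a _ => ?_
      by_cases ha : (a.2 : ℕ) = 0
      · rw [eq_lowest_of_val_eq_zero ha]
        exact Submodule.smul_mem _ _ (Submodule.subset_span ⟨_, rfl⟩)
      · rw [hb.repr_eq_zero_of_lie_tm ht hx ha, zero_smul]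
        exact zero_mem _
    · rintro _ ⟨i, rfl⟩
      exact hb.lower_lowest i
  rw [h1, finrank_span_eq_card]
  exact b.linearIndependent.comp _ fun i j h => congrArg Sigma.fst h

/-- The number of summands in a decomposition into irreducible modules. -/
theorem IsMultipletBasis.card_eq_of_isInternal (ht : IsSl2Triple ((2 : 𝕂) • t₀) tp tm)
    (hb : IsMultipletBasis t₀ tp tm b i₀) (n : ℕ)
    (V : Fin n → LieSubmodule 𝕂 (ht.toLieSubalgebra 𝕂) g)
    (hV : ∀ i, LieModule.IsIrreducible 𝕂 (ht.toLieSubalgebra 𝕂) (V i))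
    (hI : DirectSum.IsInternal fun i => (V i : Submodule 𝕂 g)) : Fintype.card ι = n := by
  choose z hzV hz0 hz huniq using fun i => hb.exists_unique_lowest_weight_vector ht (V i) (hV i)
  obtain ⟨hI1, hI2⟩ := (isInternal_iff_of_fintype _).1 hI
  have hli : LinearIndependent 𝕂 z := by
    refine Fintype.linearIndependent_iff.2 fun c hc i => ?_
    have := hI1 (fun i => c i • z i) (fun i => (V i).smul_mem _ (hzV i)) hc i
    exact (smul_eq_zero.1 this).resolve_right (hz0 i)
  have hspan : LinearMap.ker (LieAlgebra.ad 𝕂 g tm) = Submodule.span 𝕂 (Set.range z) := by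
    refine le_antisymm (fun x hx => ?_) (Submodule.span_le.2 ?_)
    · obtain ⟨v, hv, rfl⟩ := hI2 x
      refine sum_mem fun i _ => ?_
      -- Each summand `[t_-, v i]` lies in `V i`, so directness forces all of them to vanish and `v
      -- i` is a multiple of `z i`. Thus the `z i` form a basis of the kernel of `ad t_-`.
      have hx' : ∑ i, ⁅tm, v i⁆ = 0 := by
        rw [← lie_sum]; exact hx
      obtain ⟨c, hc⟩ := huniq i (v i) (hv i)
        (hI1 (fun i => ⁅tm, v i⁆) (fun i => lie_tm_mem (V i) (hv i)) hx' i)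
      rw [hc]
      exact Submodule.smul_mem _ _ (Submodule.subset_span ⟨i, rfl⟩)
    · rintro _ ⟨i, rfl⟩
      exact hz i
  rw [← hb.finrank_ker_ad_tm ht, hspan, finrank_span_eq_card hli, Fintype.card_fin]

end Modules

end DSReduction

end

/-! ### The theorem. -/

open DSReduction in
theorem mainTheorem9 {𝕂 : Type*} [RCLike 𝕂] {g : Type*} [LieRing g] [LieAlgebra 𝕂 g]
    [FiniteDimensional 𝕂 g] [LieAlgebra.IsSimple 𝕂 g]
    (t₀ tp tm : g) (ht : IsSl2Triple ((2 : 𝕂) • t₀) tp tm)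
    {ι : Type*} [Fintype ι] [DecidableEq ι] (s : ι → ℕ)
    (b : Module.Basis (Label s) 𝕂 g) (i₀ : ι) (hb : IsMultipletBasis t₀ tp tm b i₀)
    (k : 𝕂) (hk : k ≠ 0) :
    -- `T^I` commutes weakly with the constraints
    (∀ ε : SmoothCirc 𝕂, ∀ y ∈ constrainedLoops b tp, ∀ a : Label s, 0 < grade2 a →
      HasBracket b k (smear ε (improvedSugawara b k t₀)) (constraint b tp a) y 0) ∧
    -- `T^I` is a gauge invariant field on the constrained loops
    (∀ h ∈ gaugeLoops 𝕂 s, ∀ y ∈ constrainedLoops b tp,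
      gaugeAction b k h y ∈ constrainedLoops b tp ∧
        improvedSugawara b k t₀ (gaugeAction b k h y) = improvedSugawara b k t₀ y) ∧
    -- the Dirac bracket on the gauge slice exists, and closes on the lowest weight fields
    (∀ y ∈ gaugeSlice b tp, IsSecondClassAt b k (sliceConstraints b tp) y) ∧
    (∀ i₁ i₂ : ι, DiracClosed b tp k (lowestFields b tp)
      (current 𝕂 (lowest s i₁)) (current 𝕂 (lowest s i₂))) ∧
    -- `T^I` is a Virasoro field for the Dirac bracket
    TransformsWith b tp k (improvedSugawara b k t₀) (improvedSugawara b k t₀) 2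
      (k * killingForm 𝕂 g t₀ t₀) ∧
    -- the lowest weight currents are primary of dimension `j + 1`, up to the central term of the
    -- current along `t_-`
    (∀ i : ι, i ≠ i₀ → IsPrimary b tp k (improvedSugawara b k t₀) (current 𝕂 (lowest s i))
      ((s i : 𝕂) / 2 + 1)) ∧
    TransformsWith b tp k (improvedSugawara b k t₀) (current 𝕂 (lowest s i₀))
      ((s i₀ : 𝕂) / 2 + 1) (k ^ 2 / 2) ∧
    -- the algebra is freely generated by the lowest weight currents, and also by `T^I` and the
    -- primary currents
    FreelyGenerates (fun i : ι => restrictSlice b tp (current 𝕂 (lowest s i)))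
      (lowestFields b tp) ∧
    FreelyGenerates
      (Function.update (fun i : ι => restrictSlice b tp (current 𝕂 (lowest s i))) i₀
        (restrictSlice b tp (improvedSugawara b k t₀)))
      (lowestFields b tp) ∧
    -- the generators are labelled by the `sl₂` multiplets of `g`, and their number is the number of
    -- summands in any decomposition of `g` into irreducible `sl₂`-modules
    (∃ V : ι → LieSubmodule 𝕂 (ht.toLieSubalgebra 𝕂) g,
      (∀ i, (V i : Submodule 𝕂 g) = Submodule.span 𝕂 (Set.range fun p => b ⟨i, p⟩)) ∧
      (∀ i, LieModule.IsIrreducible 𝕂 (ht.toLieSubalgebra 𝕂) (V i)) ∧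
      DirectSum.IsInternal fun i => (V i : Submodule 𝕂 g)) ∧
    (∀ (n : ℕ) (V : Fin n → LieSubmodule 𝕂 (ht.toLieSubalgebra 𝕂) g),
      (∀ i, LieModule.IsIrreducible 𝕂 (ht.toLieSubalgebra 𝕂) (V i)) →
      (DirectSum.IsInternal fun i => (V i : Submodule 𝕂 g)) → Fintype.card ι = n) := by
  -- Cartan's criterion: in characteristic zero a simple Lie algebra has a nondegenerate Killing
  -- form.
  have hK : LieAlgebra.IsKilling 𝕂 g := inferInstance
  refine ⟨fun ε y hy a ha => hb.hasBracket_sugawara_constraint hk ε hy ha,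
    fun h hh y hy => ⟨?_, hb.improvedSugawara_gaugeAction hk (mem_gaugeLoops_iff.1 hh) hy⟩,
    fun y hy => hb.isSecondClassAt ht k hy, hb.diracClosed ht k,
    hb.transformsWith_sugawara ht hk, fun i hi => hb.isPrimary_current ht hk hi,
    hb.transformsWith_current_tm ht hk, freelyGenerates_lowest b tp,
    hb.freelyGenerates_sugawara ht hk,
    ⟨multipletModule ht hb, fun i => rfl, hb.isIrreducible_multipletModule ht,
      isInternal_multipletSpan b⟩, hb.card_eq_of_isInternal ht⟩
  rw [← gaugePath_one]
  exact hb.gaugePath_mem k (mem_gaugeLoops_iff.1 hh) hy 1
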